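/- Fix an integer $n\ge 2$. A tableau of height $n$ is a complex vector $L=(l_{ij})_{1\le j\le i\le n}$, written $T(L)$. Relations between positions are formal expressions: $T(L)$ satisfies $(i,j)\ge(s,t)$ (resp. $(i,j)>(s,t)$) if $l_{ij}-l_{st}\in\mathbb Z_{\ge0}$ (resp. $\mathbb Z_{>0}$). Let $\mathcal R$ be the set of relations $(i,j)\ge(i-1,j')$ and $(i-1,j')>(i,j)$, and $\mathcal R^0$ the set of relations $(n,i)\ge(n,j)$, $i\ne j$. For $\mathcal C\subseteq\mathcal R\cup\mathcal R^0$ and $T(L)$ satisfying $\mathcal C$, let $\mathcal B_{\mathcal C}(T(L))$ be the set of tableaux $T(L+z)$ satisfying $\mathcal C$, where $z$ is integral and vanishes on row $n$, and let $V_{\mathcal C}(T(L))$ be the complex vector space with basis $\mathcal B_{\mathcal C}(T(L))$. The tableau $T(L)$ is a $\mathcal C$-realization if it satisfies $\mathcal C$ and no tableau of $\mathcal B_{\mathcal C}(T(L))$ has two equal entries in one of the rows $1,\dots,n-1$. The set $\mathcal C$ is admissible if for every $\mathcal C$-realization $T(L)$ the space $V_{\mathcal C}(T(L))$ is a $\mathfrak{gl}_n(\mathbb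 C)$-module under the Gelfand–Tsetlin formulas $$E_{k,k+1}T(R)=-\sum_{i=1}^{k}\frac{\prod_{j=1}^{k+1}(r_{ki}-r_{k+1,j})}{\prod_{j\ne i}(r_{ki}-r_{kj})}\,T(R+\delta^{ki}),\qquad E_{k+1,k}T(R)=\sum_{i=1}^{k}\frac{\prod_{j=1}^{k-1}(r_{ki}-r_{k-1,j})}{\prod_{j\ne i}(r_{ki}-r_{kj})}\,T(R-\delta^{ki}),$$ $$E_{kk}T(R)=\Bigl(k-1+\sum_{i=1}^{k}r_{ki}-\sum_{i=1}^{k-1}r_{k-1,i}\Bigr)T(R),$$ where $\delta^{ki}$ is the unit vector at position $(k,i)$ and tableaux outside $\mathcal B_{\mathcal C}(T(L))$ are read as $0$. For such $\mathcal C$ and $T(L)$ the module $V_{\mathcal C}(T(L))$ is called an admissible Gelfand–Tsetlin module. A Gelfand–Tsetlin module is a finitely generated $U(\mathfrak{gl}_n)$-module $M$ with $M=\bigoplus_{\mathfrak m}M(\mathfrak m)$, where $\mathfrak m$ runs over the maximal ideals of the Gelfand–Tsetlin subalgebra $\Gamma$ (generated by the centers of $U(\mathfrak{gl}_1)\subset\dots\subset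 U(\mathfrak{gl}_n)$) and $M(\mathfrak m)=\{v\mid\mathfrak m^kv=0\text{ for some }k\ge0\}$. **Proposition.** Let $\lambda=(\lambda_1,\dots,\lambda_n)\in\mathbb C^n$ be such that for all $1\le i<j\le n-1$ either $\lambda_i-\lambda_j\notin\mathbb Z$, or $\lambda_i-\lambda_j$ is an integer with $\lambda_i-\lambda_j>i-j$. Then the irreducible highest weight module $L(\lambda)$ is an admissible Gelfand–Tsetlin module. Explicitly, put $l_i=\lambda_i-i+1$, and write $i\prec j$ if $l_i-l_j\in\mathbb Z_{>0}$, or if $i=n>j$ and $l_i=l_j$; this is a strict linear order on each class of indices modulo the relation $l_i-l_j\in\mathbb Z$. Let $\mathcal C$ consist of the relations 1. $(k+1,i)\ge(k,i)$ for $1\le i\le k\le n-1$; 2. $(k,i)>(k+1,j)$ for $1\le i\le k\le n-1$, $1\le j\le k+1$, where $j$ is the immediate successor of $i$ for $\prec$ in $\{1,\dots,k+1\}$; 3. $(n,i)\ge(n,j)$ for $1\le i,j\le n$, where $j$ is the immediate successor of $i$ for $\prec$ in $\{1,\dots,n\}$; and let $T(L)$ be the tableau with $l_{ki}=l_i$ for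 $1\le i\le k\le n$. Then $\mathcal C$ is admissible, $T(L)$ is a $\mathcal C$-realization, $V_{\mathcal C}(T(L))$ is isomorphic to $L(\lambda)$, and $L(\lambda)$ is a Gelfand–Tsetlin module. -/

import Mathlib

namespace GelfandTsetlin

noncomputable section

-- An associative algebra is a Lie algebra under the commutator.
attribute [local instance 100] LieRing.ofAssociativeRing

/-! ## Tableaux and relations

All row and column indices are 1-based: the positions of a tableau of height `n` are the pairs
`(i, j)` with `1 ≤ j ≤ i ≤ n`; row `n` is the top row. -/

/-- The set of positions `(i, j)`, `1 ≤ j ≤ i ≤ n`. -/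
def Pos (n : ℕ) : Type := {p : ℕ × ℕ // 1 ≤ p.2 ∧ p.2 ≤ p.1 ∧ p.1 ≤ n}

/-- The row of a position. -/
def Pos.row {n : ℕ} (p : Pos n) : ℕ := p.1.1

/-- The column of a position. -/
def Pos.col {n : ℕ} (p : Pos n) : ℕ := p.1.2

/-- A Gelfand–Tsetlin tableau `T(L)` of height `n`, that is, a vector `L` of `ℂ^{n(n+1)/2}`. -/
abbrev Tableau (n : ℕ) : Type := Pos n → ℂ

/-- The entry `l_{ki}` of a tableau (the value outside the range `1 ≤ i ≤ k ≤ n` is irrelevant). -/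
def entry {n : ℕ} (L : Tableau n) (k i : ℕ) : ℂ :=
  if h : 1 ≤ i ∧ i ≤ k ∧ k ≤ n then L ⟨(k, i), h⟩ else 0

/-- The vector `δ^{ki}`. -/
def delta (n k i : ℕ) : Tableau n := fun p => if p.row = k ∧ p.col = i then 1 else 0

/-- A relation between two positions: `ge p q` stands for `p ≥ q` and `gt p q` for `p > q`. -/
inductive Rel (n : ℕ) : Type
  | ge (p q : Pos n) : Rel n
  | gt (p q : Pos n) : Rel n

/-- `T(L)` satisfies `p ≥ q` (resp. `p > q`) if `l_p - l_q ∈ ℤ_{≥ 0}` (resp. `ℤ_{> 0}`). -/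
def Rel.Holds {n : ℕ} (L : Tableau n) : Rel n → Prop
  | .ge p q => ∃ m : ℤ, 0 ≤ m ∧ L p - L q = m
  | .gt p q => ∃ m : ℤ, 0 < m ∧ L p - L q = m

/-- The set `ℛ` of relations `(i, j) ≥ (i - 1, j')` and `(i - 1, j') > (i, j)`. -/
def relR (n : ℕ) : Set (Rel n) :=
  {r | ∃ p q : Pos n, p.row = q.row + 1 ∧ (r = .ge p q ∨ r = .gt q p)}

/-- The set `ℛ⁰` of relations `(n, i) ≥ (n, j)` with `i ≠ j`. -/
def relR0 (n : ℕ) : Set (Rel n) :=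
  {r | ∃ p q : Pos n, p.row = n ∧ q.row = n ∧ p ≠ q ∧ r = .ge p q}

/-- `T(L)` satisfies all the relations of `C`. -/
def Satisfies {n : ℕ} (C : Set (Rel n)) (L : Tableau n) : Prop := ∀ r ∈ C, r.Holds L

/-- `ℬ_C(T(L))`: the tableaux `T(L + z)` that satisfy `C`, where `z` is an integral vector that
vanishes on the top row. -/
def tableaux {n : ℕ} (C : Set (Rel n)) (L : Tableau n) : Set (Tableau n) :=
  {R | Satisfies C R ∧ ∃ z : Pos n → ℤ, (∀ p, p.row = n → z p = 0) ∧ ∀ p, R p = L p + z p}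

/-- `V_C(T(L))`: the complex vector space with basis `ℬ_C(T(L))`. -/
abbrev TableauSpace {n : ℕ} (C : Set (Rel n)) (L : Tableau n) : Type := tableaux C L →₀ ℂ

/-- A tableau is noncritical if no row other than the top one has two equal entries. -/
def Noncritical {n : ℕ} (L : Tableau n) : Prop :=
  ∀ k i j : ℕ, 1 ≤ i → i < j → j ≤ k → k < n → entry L k i ≠ entry L k j

/-- `T(L)` is a `C`-realization. -/
def IsRealization {n : ℕ} (C : Set (Rel n)) (L : Tableau n) : Prop :=
  Satisfies C L ∧ ∀ R ∈ tableaux C L, Noncritical R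

/-! ## The Gelfand–Tsetlin formulas -/

/-- The Lie algebra `𝔤𝔩ₙ` of all complex `n × n` matrices. -/
abbrev gl (n : ℕ) : Type := Matrix (Fin n) (Fin n) ℂ

/-- The elementary matrix `E_{ij}`, `1 ≤ i, j ≤ n`. -/
def E (n i j : ℕ) : gl n := Matrix.of fun a b => if a.val + 1 = i ∧ b.val + 1 = j then 1 else 0

open Classical in
/-- The tableau `T(R)` as an element of `V_C(T(L))`; it is zero if `T(R)` is not in
`ℬ_C(T(L))`. -/
def tab {n : ℕ} (C : Set (Rel n)) (L R : Tableau n) : TableauSpace C L :=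
  if h : R ∈ tableaux C L then Finsupp.single ⟨R, h⟩ 1 else 0

/-- The coefficient of `T(R + δ^{ki})` in `E_{k,k+1} T(R)`. -/
def raiseCoeff {n : ℕ} (R : Tableau n) (k i : ℕ) : ℂ :=
  -((∏ j ∈ Finset.Icc 1 (k + 1), (entry R k i - entry R (k + 1) j)) /
    ∏ j ∈ (Finset.Icc 1 k).erase i, (entry R k i - entry R k j))

/-- The coefficient of `T(R - δ^{ki})` in `E_{k+1,k} T(R)`. -/
def lowerCoeff {n : ℕ} (R : Tableau n) (k i : ℕ) : ℂ :=
  (∏ j ∈ Finset.Icc 1 (k - 1), (entry R k i - entry R (k - 1) j)) /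
    ∏ j ∈ (Finset.Icc 1 k).erase i, (entry R k i - entry R k j)

/-- The eigenvalue of `E_{kk}` on `T(R)`. -/
def weightCoeff {n : ℕ} (R : Tableau n) (k : ℕ) : ℂ :=
  (k : ℂ) - 1 + ∑ i ∈ Finset.Icc 1 k, entry R k i
    - ∑ i ∈ Finset.Icc 1 (k - 1), entry R (k - 1) i

/-- The representation `ρ` of `𝔤𝔩ₙ` on `V_C(T(L))` is given by the Gelfand–Tsetlin formulas. -/
def IsGTAction {n : ℕ} (C : Set (Rel n)) (L : Tableau n)
    (ρ : gl n →ₗ⁅ℂ⁆ Module.End ℂ (TableauSpace C L)) : Prop :=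
  ∀ R ∈ tableaux C L,
    (∀ k, 1 ≤ k → k < n → ρ (E n k (k + 1)) (tab C L R) =
      ∑ i ∈ Finset.Icc 1 k, raiseCoeff R k i • tab C L (R + delta n k i)) ∧
    (∀ k, 1 ≤ k → k < n → ρ (E n (k + 1) k) (tab C L R) =
      ∑ i ∈ Finset.Icc 1 k, lowerCoeff R k i • tab C L (R - delta n k i)) ∧
    (∀ k, 1 ≤ k → k ≤ n → ρ (E n k k) (tab C L R) = weightCoeff R k • tab C L R)

/-- A set of relations `C ⊆ ℛ ∪ ℛ⁰` is admissible if for every `C`-realization `T(L)` the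
Gelfand–Tsetlin formulas define a `𝔤𝔩ₙ`-module structure on `V_C(T(L))`. -/
def IsAdmissible {n : ℕ} (C : Set (Rel n)) : Prop :=
  C ⊆ relR n ∪ relR0 n ∧
    ∀ L : Tableau n, IsRealization C L →
      ∃ ρ : gl n →ₗ⁅ℂ⁆ Module.End ℂ (TableauSpace C L), IsGTAction C L ρ

/-! ## Irreducible highest weight modules -/

/-- The universal enveloping algebra `U(𝔤𝔩ₙ)`. -/
abbrev U (n : ℕ) : Type := UniversalEnvelopingAlgebra ℂ (gl n)

/-- The image of `E_{ij}` in `U(𝔤𝔩ₙ)`. -/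
def e (n i j : ℕ) : U n := UniversalEnvelopingAlgebra.ι ℂ (E n i j)

/-- The left ideal `J(lam)` of `U(𝔤𝔩ₙ)` generated by the `E_{ij}`, `i < j`, and the
`E_{ii} - lam_i`, so that `U(𝔤𝔩ₙ) ⧸ J(lam)` is the Verma module `M(lam)`. -/
def vermaIdeal {n : ℕ} (lam : Fin n → ℂ) : Submodule (U n) (U n) :=
  Submodule.span (U n)
    ({x | ∃ i j : ℕ, 1 ≤ i ∧ i < j ∧ j ≤ n ∧ x = e n i j} ∪
      {x | ∃ i : Fin n, x = e n (i.val + 1) (i.val + 1) - algebraMap ℂ (U n) (lam i)})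

/-- The sum of all proper left ideals containing `J(lam)`, that is, the left ideal corresponding to
the largest proper submodule of the Verma module. -/
def maxIdeal {n : ℕ} (lam : Fin n → ℂ) : Submodule (U n) (U n) :=
  sSup {I | vermaIdeal lam ≤ I ∧ I ≠ ⊤}

/-- The irreducible highest weight module `L(lam)`: the quotient of the Verma module `M(lam)` by
its largest proper submodule. -/
abbrev IrrHW {n : ℕ} (lam : Fin n → ℂ) : Type := U n ⧸ maxIdeal lam

/-- The `U(𝔤𝔩ₙ)`-module `M` is isomorphic to `V_C(T(L))` with the action given by the
Gelfand–Tsetlin formulas (in particular these formulas do define an action). -/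
def IsoTableauModule {n : ℕ} (M : Type*) [AddCommGroup M] [Module ℂ M] [Module (U n) M]
    (C : Set (Rel n)) (L : Tableau n) : Prop :=
  ∃ ρ : gl n →ₗ⁅ℂ⁆ Module.End ℂ (TableauSpace C L), IsGTAction C L ρ ∧
    ∃ φ : M ≃ₗ[ℂ] TableauSpace C L,
      ∀ (x : gl n) (v : M), φ (UniversalEnvelopingAlgebra.ι ℂ x • v) = ρ x (φ v)

/-! ## Gelfand–Tsetlin modules -/

/-- The subalgebra `U_m = U(𝔤𝔩_m)` of `U(𝔤𝔩ₙ)`, generated by the `E_{ij}`, `1 ≤ i, j ≤ m`. -/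
def Usub (n m : ℕ) : Subalgebra ℂ (U n) :=
  Algebra.adjoin ℂ {x | ∃ i j : ℕ, 1 ≤ i ∧ i ≤ m ∧ 1 ≤ j ∧ j ≤ m ∧ x = e n i j}

/-- The center `Z_m` of `U_m`. -/
def Zset (n m : ℕ) : Set (U n) := {x | x ∈ Usub n m ∧ ∀ y ∈ Usub n m, x * y = y * x}

/-- The Gelfand–Tsetlin subalgebra `Γ`, generated by `Z_1, …, Z_n`. -/
def Γ (n : ℕ) : Subalgebra ℂ (U n) :=
  Algebra.adjoin ℂ {x | ∃ m : ℕ, 1 ≤ m ∧ m ≤ n ∧ x ∈ Zset n m}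

theorem Usub_mono (n : ℕ) {m k : ℕ} (h : m ≤ k) : Usub n m ≤ Usub n k := by
  refine Algebra.adjoin_mono ?_
  rintro x ⟨i, j, h1, h2, h3, h4, rfl⟩
  exact ⟨i, j, h1, h2.trans h, h3, h4.trans h, rfl⟩

theorem Γ_comm (n : ℕ) (x y : Γ n) : x * y = y * x := by
  have key : ∀ a ∈ {x | ∃ m : ℕ, 1 ≤ m ∧ m ≤ n ∧ x ∈ Zset n m},
      ∀ b ∈ {x | ∃ m : ℕ, 1 ≤ m ∧ m ≤ n ∧ x ∈ Zset n m}, a * b = b * a := by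
    rintro a ⟨m, -, -, ha⟩ b ⟨k, -, -, hb⟩
    rcases le_total m k with h | h
    · exact (hb.2 a (Usub_mono n h ha.1)).symm
    · exact ha.2 b (Usub_mono n h hb.1)
  exact (Algebra.isMulCommutative_adjoin ℂ key).is_comm.comm x y

instance (n : ℕ) : CommRing (Γ n) :=
  { (Γ n).toRing with mul_comm := Γ_comm n }

/-- `M(𝔪)`: the vectors of `M` killed by some power of the ideal `𝔪` of `Γ`. -/
def gtComponent {n : ℕ} (M : Type*) [AddCommGroup M] [Module (U n) M] (𝔪 : Ideal (Γ n)) :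
    Submodule (Γ n) M where
  carrier := {v | ∃ k : ℕ, ∀ a ∈ 𝔪 ^ k, a • v = 0}
  zero_mem' := ⟨0, fun a _ => smul_zero a⟩
  add_mem' := by
    rintro v w ⟨k, hk⟩ ⟨l, hl⟩
    refine ⟨max k l, fun a ha => ?_⟩
    rw [smul_add, hk a (Ideal.pow_le_pow_right (le_max_left k l) ha),
      hl a (Ideal.pow_le_pow_right (le_max_right k l) ha), add_zero]
  smul_mem' := by
    rintro c v ⟨k, hk⟩
    refine ⟨k, fun a ha => ?_⟩
    rw [smul_smul, mul_comm, ← smul_smul, hk a ha, smul_zero]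

open Classical in
/-- A Gelfand–Tsetlin module: a finitely generated `U(𝔤𝔩ₙ)`-module that is the direct sum of the
`M(𝔪)`, where `𝔪` runs over the maximal ideals of `Γ`. -/
def IsGTModule (n : ℕ) (M : Type*) [AddCommGroup M] [Module (U n) M] : Prop :=
  Module.Finite (U n) M ∧
    DirectSum.IsInternal fun 𝔪 : MaximalSpectrum (Γ n) => gtComponent M 𝔪.asIdeal

/-! ## The relations and the tableau attached to a weight -/

/-- The number `l_i = lam_i - i + 1`, `1 ≤ i ≤ n`. -/
def shifted {n : ℕ} (lam : Fin n → ℂ) (i : ℕ) : ℂ :=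
  if h : 1 ≤ i ∧ i ≤ n then lam ⟨i - 1, by omega⟩ - i + 1 else 0

/-- The tableau all of whose rows are initial segments of `(l_1, …, l_n)`: `l_{ki} = l_i`. -/
def hwTableau {n : ℕ} (lam : Fin n → ℂ) : Tableau n := fun p => shifted lam p.col

/-- `i` precedes `j`: either `l_i - l_j` is a positive integer, or `i = n` and `l_i = l_j`
(`j < n`). When `l_i - l_j` is not in `ℤ_{≤ 0}` for `i < j < n`, this is a strict linear order on
each class of indices `{1, …, n}` modulo the relation `l_i - l_j ∈ ℤ`. -/
def Precedes {n : ℕ} (lam : Fin n → ℂ) (i j : ℕ) : Prop :=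
  (∃ m : ℤ, 0 < m ∧ shifted lam i - shifted lam j = m) ∨
    (i = n ∧ j < n ∧ shifted lam i = shifted lam j)

/-- `j` is the immediate successor of `i` among the indices `1, …, m`. -/
def Next {n : ℕ} (lam : Fin n → ℂ) (m i j : ℕ) : Prop :=
  Precedes lam i j ∧ ¬∃ p : ℕ, 1 ≤ p ∧ p ≤ m ∧ Precedes lam i p ∧ Precedes lam p j

/-- The set of relations attached to `lam`:
* `(k + 1, i) ≥ (k, i)` for `1 ≤ i ≤ k ≤ n - 1`;
* `(k, i) > (k + 1, j)` for `1 ≤ i ≤ k ≤ n - 1`, where `j` is the immediate successor of `i` among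
  `1, …, k + 1`;
* `(n, i) ≥ (n, j)`, where `j` is the immediate successor of `i` among `1, …, n`. -/
def hwRelations {n : ℕ} (lam : Fin n → ℂ) : Set (Rel n) :=
  {r | ∃ p q : Pos n, p.row = q.row + 1 ∧ p.col = q.col ∧ r = .ge p q} ∪
  {r | ∃ p q : Pos n, q.row = p.row + 1 ∧ Next lam q.row p.col q.col ∧ r = .gt p q} ∪
  {r | ∃ p q : Pos n, p.row = n ∧ q.row = n ∧ Next lam n p.col q.col ∧ r = .ge p q}

end

end GelfandTsetlin

namespace GelfandTsetlin

noncomputable section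

attribute [local instance 100] LieRing.ofAssociativeRing

/-! ## The Chevalley–Serre presentation of `𝔤𝔩ₙ` -/

section Presentation

set_option linter.unusedSectionVars false

variable {L : Type*} [LieRing L] [LieAlgebra ℂ L]

/-! Let X_k, Y_k, H_k be the operators that the formulas prescribe for E_{k,k+1}, E_{k+1,k}, E_{kk}.
By the presentation of gl_n (`exists_lieHom_of_chevalley`) admissibility comes down to the
Chevalley–Serre relations between them, for an arbitrary realization T(L).

Everything rests on replacing the relations by their closure `Interlaces`
(`satisfies_iff_interlaces`). The brackets with H_k only count row sums. For [X_k, Y_l] the terms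
that step at two different positions cancel: if the tableau reached is admitted, so are both
intermediate ones (`mem_of_add_sub_mem`). The remaining terms of [X_k, Y_k] are residues of one
rational function in the entries of rows k-1, k, k+1, and their sum is read off from its expansion
at infinity (`sum_diagonal`). A step that leaves the set of tableaux is always matched by a zero of
the numerator, so the missing terms do no harm.

The Serre relations are not computed. A Serre element in the X's commutes with every Y_m by the
relations already known (`WeakChevalley.lie_serre`, `WeakChevalley.lie_far`), kills the top tableau,
and the Y's generate the space from the top tableau (`eq_top_of_lowerOp_stable`); hence it is zero.
Dually, a Serre element in the Y's commutes with every X_m and never reaches the top tableau, so it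
is zero provided that the only singular vectors are multiples of the top tableau. That holds when
columns in different classes modulo ℤ stay nonintegrally apart (`Unmerged`). A general realization
may violate this; its top row is then perturbed by a parameter t that moves each class rigidly. The
relations hold for a dense set of t and pass to t = 0 by continuity (`serre_lowerOp`). Generation by
the Y's and uniqueness of singular vectors both come from one support argument,
`eq_topTableau_of_support`.

For the tableau of λ itself the condition `Unmerged` is automatic. The top tableau is then a highest
weight vector of weight λ that generates the module, and every nonzero vector can be raised to it. A
polynomial in a grading element isolates the highest weight component, which identifies the module
with L(λ) (`mem_maxIdeal_iff`, `exists_irrHW_equiv`).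

Finally Γ commutes with the grading element, whose eigenvalue on a tableau is a constant minus its
height, the number of lowering steps from the top. Only finitely many tableaux have bounded height,
so every vector lies in a finite-dimensional Γ-stable subspace (`exists_ideal_annihilating`), and
primary decomposition over Artinian quotients of Γ gives the Gelfand–Tsetlin property. -/

/-- The weight of `E_{l,l+1}` with respect to `E_{kk}`. -/
def rootWeight (k l : ℕ) : ℂ := (if k = l then 1 else 0) - (if k = l + 1 then 1 else 0)

/-- The relations of `𝔤𝔩ₙ` among `X k = E_{k,k+1}`, `Y k = E_{k+1,k}`, `H k = E_{kk}`, without the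
Serre relations. -/
structure WeakChevalley (n : ℕ) (X Y H : ℕ → L) : Prop where
  HH : ∀ k l, 1 ≤ k → k ≤ n → 1 ≤ l → l ≤ n → ⁅H k, H l⁆ = 0
  HX : ∀ k l, 1 ≤ k → k ≤ n → 1 ≤ l → l < n → ⁅H k, X l⁆ = rootWeight k l • X l
  HY : ∀ k l, 1 ≤ k → k ≤ n → 1 ≤ l → l < n → ⁅H k, Y l⁆ = -rootWeight k l • Y l
  XY : ∀ k l, 1 ≤ k → k < n → 1 ≤ l → l < n →
    ⁅X k, Y l⁆ = if k = l then H k - H (k + 1) else 0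

/-- The Serre relations of type `A`. -/
structure Serre (n : ℕ) (X : ℕ → L) : Prop where
  far : ∀ k l, 1 ≤ k → k + 1 < l → l < n → ⁅X k, X l⁆ = 0
  up : ∀ k, 1 ≤ k → k + 1 < n → ⁅X k, ⁅X k, X (k + 1)⁆⁆ = 0
  down : ∀ k, 1 ≤ k → k + 1 < n → ⁅X (k + 1), ⁅X (k + 1), X k⁆⁆ = 0

/-- This is the Chevalley involution; it halves the work, since statements about the Y's follow from
those about the X's. -/
theorem WeakChevalley.flip {n : ℕ} {X Y H : ℕ → L} (h : WeakChevalley n X Y H) :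
    WeakChevalley n (fun k => -Y k) (fun k => -X k) (fun k => -H k) where
  HH k l h1 h2 h3 h4 := by simp [h.HH k l h1 h2 h3 h4]
  HX k l h1 h2 h3 h4 := by simp [h.HY k l h1 h2 h3 h4]
  HY k l h1 h2 h3 h4 := by simp [h.HX k l h1 h2 h3 h4]
  XY k l h1 h2 h3 h4 := by
    rw [neg_lie, lie_neg, neg_neg, ← lie_skew, h.XY l k h3 h4 h1 h2]
    rcases eq_or_ne k l with rfl | hkl
    · simp only [if_true]
      abel
    · simp [hkl, hkl.symm]

theorem Serre.neg {n : ℕ} {X : ℕ → L} (h : Serre n X) : Serre n (fun k => -X k) where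
  far k l h1 h2 h3 := by simp [h.far k l h1 h2 h3]
  up k h1 h2 := by simp [h.up k h1 h2]
  down k h1 h2 := by simp [h.down k h1 h2]

/-! ### Root vectors and their brackets with the generators. -/

/-- The iterated bracket that corresponds to `E_{i,i+d+1}`. -/
def rootVector (X : ℕ → L) (i : ℕ) : ℕ → L
  | 0 => X i
  | d + 1 => ⁅rootVector X i d, X (i + d + 1)⁆

theorem rootVector_lie_eq_zero {X : ℕ → L} {i d : ℕ} {z : L}
    (h : ∀ m, i ≤ m → m ≤ i + d → ⁅X m, z⁆ = 0) : ⁅rootVector X i d, z⁆ = 0 := by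
  induction d with
  | zero => exact h i le_rfl le_rfl
  | succ d ih =>
    rw [rootVector, lie_lie, ih fun m h1 h2 => h m h1 (by omega), h (i + d + 1) (by omega) le_rfl]
    simp

theorem rootVector_lie_far {n : ℕ} {X : ℕ → L} (hX : Serre n X) {i d k : ℕ} (hi : 1 ≤ i)
    (hd : i + d < n) (hk : 1 ≤ k) (hkn : k < n) (h : k + 1 < i ∨ i + d + 1 < k) :
    ⁅rootVector X i d, X k⁆ = 0 := by
  refine rootVector_lie_eq_zero fun m h1 h2 => ?_
  rcases h with h | h
  · rw [← lie_skew, hX.far k m hk (by omega) (by omega), neg_zero]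
  · exact hX.far m k (by omega) (by omega) hkn

/-- Root vectors are defined by bracketing on the right. The Jacobi identity and the far relations
let a generator be added on the left as well, so a root vector can be shortened from either end. -/
theorem lie_rootVector {n : ℕ} {X : ℕ → L} (hX : Serre n X) {i d : ℕ} (hi : 1 ≤ i)
    (hd : i + 1 + d < n) : ⁅X i, rootVector X (i + 1) d⁆ = rootVector X i (d + 1) := by
  induction d with
  | zero => rfl
  | succ d ih =>
    rw [rootVector, leibniz_lie, ih (by omega), hX.far i (i + 1 + d + 1) hi (by omega) (by omega),
      lie_zero, add_zero, rootVector.eq_2 X i (d + 1)]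
    congr 2
    omega

theorem rootVector_lie_first {n : ℕ} {X : ℕ → L} (hX : Serre n X) {i d : ℕ} (hi : 1 ≤ i)
    (hd : i + d < n) : ⁅rootVector X i d, X i⁆ = 0 := by
  induction d with
  | zero => exact lie_self _
  | succ d ih =>
    rcases d with _ | d
    · rw [← lie_skew]
      exact neg_eq_zero.2 (hX.up i hi (by omega))
    · rw [rootVector, lie_lie, ih (by omega), ← lie_skew _ (X i),
        hX.far i _ hi (by omega) (by omega)]
      simp

theorem rootVector_lie_last {n : ℕ} {X : ℕ → L} (hX : Serre n X) {i d : ℕ} (hi : 1 ≤ i)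
    (hd : i + d < n) : ⁅rootVector X i d, X (i + d)⁆ = 0 := by
  induction d generalizing i with
  | zero => exact lie_self _
  | succ d ih =>
    rcases d with _ | d
    · have := hX.down i hi (by omega)
      rw [← lie_skew (X (i + 1)) (X i), lie_neg, neg_eq_zero] at this
      rw [← lie_skew]
      exact neg_eq_zero.2 this
    · have h1 := ih (i := i + 1) (by omega) (by omega)
      rw [show i + 1 + (d + 1) = i + (d + 1 + 1) by omega] at h1
      rw [← lie_rootVector hX hi (by omega), lie_lie, h1,
        hX.far i _ hi (by omega) (by omega)]
      simp

theorem rootVector_lie_inner {n : ℕ} {X : ℕ → L} (hX : Serre n X) {i d k : ℕ} (hi : 1 ≤ i)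
    (hd : i + d < n) (h1 : i ≤ k) (h2 : k ≤ i + d) : ⁅rootVector X i d, X k⁆ = 0 := by
  rcases h1.eq_or_lt with rfl | h1
  · exact rootVector_lie_first hX hi hd
  induction d with
  | zero => omega
  | succ d ih =>
    rcases h2.eq_or_lt with rfl | h2
    · exact rootVector_lie_last hX hi hd
    rcases (show k ≤ i + d by omega).eq_or_lt with rfl | h3
    · obtain ⟨d, rfl⟩ : ∃ e, d = e + 1 := ⟨d - 1, by omega⟩
      -- The critical case: the generator is the last but one in the chain, and the root vector is
      -- ⁅⁅a, x⁆, z⁆ = ⁅a, ⁅x, z⁆⁆. Bracketing the two forms with x gives opposite values, so twice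
      -- the result vanishes.
      set a := rootVector X i d
      set x := X (i + (d + 1))
      set z := X (i + (d + 1) + 1)
      have haz : ⁅a, z⁆ = 0 :=
        rootVector_lie_far hX hi (by omega) (by omega) (by omega) (by omega)
      have hax : ⁅⁅a, x⁆, x⁆ = 0 := rootVector_lie_last (d := d + 1) hX hi (by omega)
      have hxz : ⁅x, ⁅x, z⁆⁆ = 0 := hX.up (i + (d + 1)) (by omega) (by omega)
      have e1 : ⁅⁅a, x⁆, z⁆ = ⁅a, ⁅x, z⁆⁆ := by rw [lie_lie, haz, lie_zero, sub_zero]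
      have e2 : ⁅⁅⁅a, x⁆, z⁆, x⁆ = -⁅⁅a, x⁆, ⁅x, z⁆⁆ := by
        rw [lie_lie, ← lie_skew z x, lie_neg, ← lie_skew z ⁅⁅a, x⁆, x⁆, hax]
        simp
      have e3 : ⁅⁅a, ⁅x, z⁆⁆, x⁆ = ⁅⁅a, x⁆, ⁅x, z⁆⁆ := by
        rw [lie_lie, ← lie_skew ⁅x, z⁆ x, hxz, neg_zero, lie_zero, zero_sub, lie_skew]
      have e4 : ⁅⁅⁅a, x⁆, z⁆, x⁆ = -⁅⁅⁅a, x⁆, z⁆, x⁆ := by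
        conv_lhs => rw [e2, ← e3, ← e1]
      have e5 : (2 : ℂ) • ⁅⁅⁅a, x⁆, z⁆, x⁆ = 0 := by
        rw [two_smul]
        nth_rewrite 1 [e4]
        exact neg_add_cancel _
      exact (smul_eq_zero.1 e5).resolve_left two_ne_zero
    · rw [rootVector, lie_lie, ih (by omega) (by omega), ← lie_skew (X (i + d + 1)) (X k),
        hX.far k _ (by omega) (by omega) (by omega)]
      simp

theorem WeakChevalley.lie_rootVector_weight {n : ℕ} {X Y H : ℕ → L} (h : WeakChevalley n X Y H)
    {i d k : ℕ} (hi : 1 ≤ i) (hd : i + d < n) (hk : 1 ≤ k) (hkn : k ≤ n) :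
    ⁅H k, rootVector X i d⁆ =
      ((if k = i then 1 else 0) - (if k = i + d + 1 then 1 else 0) : ℂ) • rootVector X i d := by
  induction d with
  | zero => exact h.HX k i hk hkn hi hd
  | succ d ih =>
    rw [rootVector, leibniz_lie, ih (by omega), h.HX k _ hk hkn (by omega) (by omega), smul_lie,
      lie_smul, ← add_smul, rootWeight]
    congr 1
    rw [show i + (d + 1) + 1 = i + d + 1 + 1 by omega]
    ring

theorem rootVector_lie_Y_outer {n : ℕ} {X Y H : ℕ → L} (h : WeakChevalley n X Y H)
    {i d k : ℕ} (hi : 1 ≤ i) (hd : i + d < n) (hk : 1 ≤ k) (hkn : k < n)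
    (hki : k < i ∨ i + d < k) : ⁅rootVector X i d, Y k⁆ = 0 := by
  refine rootVector_lie_eq_zero fun m h1 h2 => ?_
  rw [h.XY m k (by omega) (by omega) hk hkn, if_neg (by omega)]

theorem rootVector_lie_Y_last {n : ℕ} {X Y H : ℕ → L} (h : WeakChevalley n X Y H)
    {i d : ℕ} (hi : 1 ≤ i) (hd : i + d + 1 < n) :
    ⁅rootVector X i (d + 1), Y (i + d + 1)⁆ = rootVector X i d := by
  rw [rootVector, lie_lie, h.XY _ _ (by omega) (by omega) (by omega) (by omega), if_pos rfl,
    rootVector_lie_Y_outer h hi (by omega) (by omega) (by omega) (by omega), lie_zero, sub_zero,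
    lie_sub, ← lie_skew, h.lie_rootVector_weight hi (by omega) (by omega) (by omega),
    ← lie_skew, h.lie_rootVector_weight hi (by omega) (by omega) (by omega)]
  simp [show ¬ i + d + 1 = i by omega, show ¬ i + d + 1 + 1 = i by omega]

theorem rootVector_lie_Y_first {n : ℕ} {X Y H : ℕ → L} (h : WeakChevalley n X Y H)
    (hX : Serre n X) {i d : ℕ} (hi : 1 ≤ i) (hd : i + d + 1 < n) :
    ⁅rootVector X i (d + 1), Y i⁆ = -rootVector X (i + 1) d := by
  rw [← lie_rootVector hX hi (by omega), lie_lie,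
    rootVector_lie_Y_outer h (by omega) (by omega) (by omega) (by omega) (by omega), lie_zero,
    zero_sub, h.XY _ _ (by omega) (by omega) (by omega) (by omega), if_pos rfl, lie_sub,
    ← lie_skew, h.lie_rootVector_weight (by omega) (by omega) (by omega) (by omega),
    ← lie_skew _ (H (i + 1)), h.lie_rootVector_weight (by omega) (by omega) (by omega) (by omega)]
  simp [show ¬ i = i + 1 + d + 1 by omega, show ¬ i = i + 1 + d by omega]

theorem rootVector_lie_Y_inner {n : ℕ} {X Y H : ℕ → L} (h : WeakChevalley n X Y H)
    (hX : Serre n X) {i d k : ℕ} (hi : 1 ≤ i) (hd : i + d < n) (h1 : i < k) (h2 : k < i + d) :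
    ⁅rootVector X i d, Y k⁆ = 0 := by
  induction d with
  | zero => omega
  | succ d ih =>
    rw [rootVector, lie_lie, h.XY _ k (by omega) (by omega) (by omega) (by omega),
      if_neg (by omega), lie_zero, zero_sub, neg_eq_zero]
    rcases (show k ≤ i + d by omega).eq_or_lt with rfl | h3
    · obtain ⟨d, rfl⟩ : ∃ e, d = e + 1 := ⟨d - 1, by omega⟩
      have := rootVector_lie_Y_last h (i := i) (d := d) hi (by omega)
      rw [show i + d + 1 = i + (d + 1) by omega] at this
      rw [this, ← lie_skew,
        rootVector_lie_far hX hi (by omega) (by omega) (by omega) (by omega), neg_zero]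
    · rw [ih (by omega) h3, lie_zero]

/-! ### Root elements and their brackets with the generators. -/

/-- The image of `E_{ij}` in a Lie algebra with Chevalley generators. -/
def rootElement (X Y H : ℕ → L) (i j : ℕ) : L :=
  if i < j then rootVector X i (j - i - 1)
  else if j < i then -rootVector (fun k => -Y k) j (i - j - 1) else H i

/-- The signs for j < i are chosen to model the automorphism x ↦ -xᵀ of gl_n; with them the flip
exchanges the two indices and changes the sign. -/
theorem rootElement_flip (X Y H : ℕ → L) (i j : ℕ) :
    rootElement (fun k => -Y k) (fun k => -X k) (fun k => -H k) i j = -rootElement X Y H j i := by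
  unfold rootElement
  rcases lt_trichotomy i j with h | rfl | h
  · simp [h, h.not_gt]
  · simp
  · simp [h, h.not_gt]

theorem rootElement_add (X Y H : ℕ → L) (i d : ℕ) :
    rootElement X Y H i (i + d + 1) = rootVector X i d := by
  rw [rootElement, if_pos (by omega), show i + d + 1 - i - 1 = d by omega]

theorem rootElement_self (X Y H : ℕ → L) (i : ℕ) : rootElement X Y H i i = H i := by
  simp [rootElement]

theorem rootElement_lie_X {n : ℕ} {X Y H : ℕ → L} (h : WeakChevalley n X Y H) (hX : Serre n X)
    (hY : Serre n Y) {i j k : ℕ} (hi : 1 ≤ i) (hin : i ≤ n) (hj : 1 ≤ j) (hjn : j ≤ n)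
    (hk : 1 ≤ k) (hkn : k < n) :
    ⁅rootElement X Y H i j, X k⁆ = (if j = k then rootElement X Y H i (k + 1) else 0) -
      (if k + 1 = i then rootElement X Y H k j else 0) := by
  rcases lt_trichotomy i j with hij | rfl | hij
  · obtain ⟨d, rfl⟩ : ∃ d, j = i + d + 1 := ⟨j - i - 1, by omega⟩
    rw [rootElement_add]
    by_cases h1 : i + d + 1 = k
    · subst h1
      rw [if_pos rfl, if_neg (by omega), sub_zero]
      exact (rootElement_add X Y H i (d + 1)).symm
    · rw [if_neg h1]
      by_cases h2 : k + 1 = i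
      · subst h2
        rw [if_pos rfl, ← lie_skew, lie_rootVector hX hk (by omega), zero_sub,
          show k + 1 + d + 1 = k + (d + 1) + 1 by omega, rootElement_add]
      · rw [if_neg h2, sub_zero]
        by_cases h3 : k + 1 < i ∨ i + d + 1 < k
        · exact rootVector_lie_far hX hi (by omega) hk hkn h3
        · exact rootVector_lie_inner hX hi (by omega) (by omega) (by omega)
  · rw [rootElement_self, h.HX i k hi hin hk hkn, rootWeight]
    have e1 : rootElement X Y H k (k + 1) = X k := rootElement_add X Y H k 0
    by_cases h1 : i = k
    · subst h1
      simp [e1]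
    · by_cases h2 : i = k + 1
      · subst h2
        simp [e1]
      · simp [h1, h2, Ne.symm h2]
  · obtain ⟨d, rfl⟩ : ∃ d, i = j + d + 1 := ⟨i - j - 1, by omega⟩
    -- A lower root element is minus an upper root vector of the flipped family, so its bracket with
    -- X_k becomes that of an upper root vector with a Y.
    have key : ∀ a b, rootElement X Y H a b =
        -rootElement (fun k => -Y k) (fun k => -X k) (fun k => -H k) b a := fun a b => by
      rw [rootElement_flip, neg_neg]
    have hf := h.flip
    have hX' := hY.neg
    rw [key, rootElement_add, neg_lie, ← lie_neg]
    set X' : ℕ → L := fun k => -Y k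
    set Y' : ℕ → L := fun k => -X k
    change ⁅rootVector X' j d, Y' k⁆ = _
    by_cases h1 : k < j ∨ j + d < k
    · rw [rootVector_lie_Y_outer hf hj (by omega) hk hkn h1, if_neg (by omega),
        if_neg (by omega), sub_zero]
    rcases d with _ | d
    · obtain rfl : j = k := by omega
      rw [if_pos rfl, if_pos rfl, rootElement_self, rootElement_self]
      change ⁅X' j, Y' j⁆ = _
      rw [hf.XY j j hk hkn hk hkn, if_pos rfl]
      simp [sub_eq_add_neg, add_comm]
    · by_cases h2 : k = j + d + 1
      · subst h2
        rw [rootVector_lie_Y_last hf hj (by omega), if_neg (by omega), if_pos (by omega),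
          key, rootElement_add, zero_sub, neg_neg]
      · rw [if_neg (by omega : ¬ k + 1 = _), sub_zero]
        by_cases h3 : k = j
        · subst h3
          rw [rootVector_lie_Y_first hf hX' hj (by omega), if_pos rfl, key,
            show k + (d + 1) + 1 = k + 1 + d + 1 by omega, rootElement_add]
        · rw [if_neg (Ne.symm h3),
            rootVector_lie_Y_inner hf hX' hj (by omega) (by omega) (by omega)]

theorem rootElement_lie_Y {n : ℕ} {X Y H : ℕ → L} (h : WeakChevalley n X Y H) (hX : Serre n X)
    (hY : Serre n Y) {i j k : ℕ} (hi : 1 ≤ i) (hin : i ≤ n) (hj : 1 ≤ j) (hjn : j ≤ n)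
    (hk : 1 ≤ k) (hkn : k < n) :
    ⁅rootElement X Y H i j, Y k⁆ = (if j = k + 1 then rootElement X Y H i k else 0) -
      (if k = i then rootElement X Y H (k + 1) j else 0) := by
  have key := rootElement_lie_X h.flip hY.neg hX.neg hj hjn hi hin hk hkn
  simp only [rootElement_flip, lie_neg, neg_lie, neg_neg] at key
  rw [key]
  simp only [eq_comm (a := k + 1) (b := j), eq_comm (a := i) (b := k)]
  split_ifs <;> simp [sub_eq_add_neg, add_comm]

theorem rootElement_lie_H {n : ℕ} {X Y H : ℕ → L} (h : WeakChevalley n X Y H)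
    {i j k : ℕ} (hi : 1 ≤ i) (hin : i ≤ n) (hj : 1 ≤ j) (hjn : j ≤ n)
    (hk : 1 ≤ k) (hkn : k ≤ n) :
    ⁅rootElement X Y H i j, H k⁆ = (if j = k then rootElement X Y H i k else 0) -
      (if k = i then rootElement X Y H k j else 0) := by
  have aux : ∀ {X Y H : ℕ → L}, WeakChevalley n X Y H → ∀ {i j : ℕ}, 1 ≤ i → i < j → j ≤ n →
      ⁅rootElement X Y H i j, H k⁆ = (if j = k then rootElement X Y H i k else 0) -
      (if k = i then rootElement X Y H k j else 0) := by
    intro X Y H h i j hi hij hjn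
    obtain ⟨d, rfl⟩ : ∃ d, j = i + d + 1 := ⟨j - i - 1, by omega⟩
    rw [rootElement_add, ← lie_skew, h.lie_rootVector_weight hi (by omega) hk hkn]
    by_cases h1 : k = i
    · subst h1
      simp [rootElement_add, show ¬ k = k + d + 1 by omega, show ¬ k + d + 1 = k by omega]
    · by_cases h2 : k = i + d + 1
      · subst h2
        simp [rootElement_add, show ¬ i + d + 1 = i by omega]
      · simp [h1, h2, Ne.symm h2]
  rcases lt_trichotomy i j with hij | rfl | hij
  · exact aux h hi hij hjn
  · rw [rootElement_self, h.HH i k hi hin hk hkn]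
    by_cases h1 : i = k
    · simp [h1]
    · simp [h1, Ne.symm h1]
  · have key := aux h.flip hj hij hin
    simp only [rootElement_flip, lie_neg, neg_lie, neg_neg] at key
    rw [key]
    simp only [eq_comm (a := k) (b := j), eq_comm (a := i) (b := k)]
    split_ifs <;> simp [sub_eq_add_neg, add_comm]

/-! ### Elementary matrices and the generation of gl_n. -/

theorem E_mul_E {n i j k l : ℕ} (hj : 1 ≤ j) (hjn : j ≤ n) :
    E n i j * E n k l = if j = k then E n i l else 0 := by
  ext a b
  rw [Matrix.mul_apply, Finset.sum_eq_single ⟨j - 1, by omega⟩]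
  · have : j - 1 + 1 = j := by omega
    by_cases h : j = k
    · subst h
      by_cases h1 : a.val + 1 = i <;> by_cases h2 : b.val + 1 = l <;> simp [E, this, h1, h2]
    · simp [E, this, h]
  · intro c _ hc
    have : c.val + 1 ≠ j := fun h => hc (Fin.ext (by simp; omega))
    simp [E, this]
  · simp

theorem lie_E_E {n i j k l : ℕ} (hj : 1 ≤ j) (hjn : j ≤ n) (hl : 1 ≤ l) (hln : l ≤ n) :
    ⁅E n i j, E n k l⁆ = (if j = k then E n i l else 0) - (if l = i then E n k j else 0) := by
  rw [Ring.lie_def, E_mul_E hj hjn, E_mul_E hl hln]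

theorem E_eq_single {n : ℕ} (a b : Fin n) :
    E n (a.val + 1) (b.val + 1) = Matrix.single a b 1 := by
  ext c d
  simp only [E, Matrix.of_apply, Matrix.single, add_left_inj, Fin.val_inj, eq_comm]

theorem gl_eq_sum {n : ℕ} (x : gl n) : x = ∑ a, ∑ b, x a b • E n (a.val + 1) (b.val + 1) := by
  conv_lhs => rw [Matrix.matrix_eq_sum_single x]
  refine Finset.sum_congr rfl fun a _ => Finset.sum_congr rfl fun b _ => ?_
  rw [E_eq_single, Matrix.smul_single, smul_eq_mul, mul_one]

theorem E_mem_of_simple {n : ℕ} (K : LieSubalgebra ℂ (gl n))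
    (hX : ∀ k, 1 ≤ k → k < n → E n k (k + 1) ∈ K) {i j : ℕ} (hi : 1 ≤ i) (hij : i < j)
    (hj : j ≤ n) : E n i j ∈ K := by
  induction j, hij using Nat.le_induction with
  | base => exact hX i hi hj
  | succ j hij ih =>
    have : E n i (j + 1) = ⁅E n i j, E n j (j + 1)⁆ := by
      rw [lie_E_E (by omega) (by omega) (by omega) hj, if_pos rfl, if_neg (by omega), sub_zero]
    rw [this]
    exact K.lie_mem (ih (by omega)) (hX j (by omega) (by omega))

/-- `𝔤𝔩ₙ` is generated by the `E_{k,k+1}`, `E_{k+1,k}` and `E_{kk}`. -/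
theorem lieSubalgebra_eq_top {n : ℕ} (K : LieSubalgebra ℂ (gl n))
    (hX : ∀ k, 1 ≤ k → k < n → E n k (k + 1) ∈ K)
    (hY : ∀ k, 1 ≤ k → k < n → E n (k + 1) k ∈ K)
    (hH : ∀ k, 1 ≤ k → k ≤ n → E n k k ∈ K) (x : gl n) : x ∈ K := by
  have hE : ∀ i j, 1 ≤ i → i ≤ n → 1 ≤ j → j ≤ n → E n i j ∈ K := by
    intro i j hi hin hj hjn
    rcases lt_trichotomy i j with h | rfl | h
    · exact E_mem_of_simple K hX hi h hjn
    · exact hH i hi hin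
    · induction i, h using Nat.le_induction with
      | base => exact hY j hj hin
      | succ i hij ih =>
        have : E n (i + 1) j = ⁅E n (i + 1) i, E n i j⁆ := by
          rw [lie_E_E (by omega) (by omega) (by omega) hjn, if_pos rfl, if_neg (by omega),
            sub_zero]
        rw [this]
        exact K.lie_mem (hY i (by omega) (by omega)) (ih (by omega) (by omega))
  rw [gl_eq_sum x]
  exact sum_mem fun a _ => sum_mem fun b _ =>
    K.smul_mem _ (hE _ _ (by omega) (by omega) (by omega) (by omega))

/-- A family satisfying the Chevalley–Serre relations defines a homomorphism from `𝔤𝔩ₙ`. -/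
theorem exists_lieHom_of_chevalley {n : ℕ} {X Y H : ℕ → L} (h : WeakChevalley n X Y H)
    (hX : Serre n X) (hY : Serre n Y) :
    ∃ ρ : gl n →ₗ⁅ℂ⁆ L, (∀ k, 1 ≤ k → k < n → ρ (E n k (k + 1)) = X k) ∧
      (∀ k, 1 ≤ k → k < n → ρ (E n (k + 1) k) = Y k) ∧
      (∀ k, 1 ≤ k → k ≤ n → ρ (E n k k) = H k) := by
  let G := rootElement X Y H
  let r : gl n →ₗ[ℂ] L :=
    { toFun := fun x => ∑ a, ∑ b, x a b • G (a.val + 1) (b.val + 1)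
      map_add' := fun x y => by simp [add_smul, Finset.sum_add_distrib]
      map_smul' := fun c x => by simp [mul_smul, Finset.smul_sum] }
  have hrE : ∀ i j, 1 ≤ i → i ≤ n → 1 ≤ j → j ≤ n → r (E n i j) = G i j := by
    intro i j hi hin hj hjn
    change ∑ a : Fin n, ∑ b : Fin n, E n i j a b • G (a.val + 1) (b.val + 1) = _
    rw [Finset.sum_eq_single ⟨i - 1, by omega⟩, Finset.sum_eq_single ⟨j - 1, by omega⟩]
    · simp [E, show i - 1 + 1 = i by omega, show j - 1 + 1 = j by omega]
    · intro b _ hb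
      have : b.val + 1 ≠ j := fun h => hb (Fin.ext (by simp; omega))
      simp [E, this]
    · simp
    · intro a _ ha
      have : a.val + 1 ≠ i := fun h => ha (Fin.ext (by simp; omega))
      simp [E, this]
    · simp
  have hGX : ∀ k, 1 ≤ k → k < n → G k (k + 1) = X k := fun k _ _ => rootElement_add X Y H k 0
  have hGY : ∀ k, 1 ≤ k → k < n → G (k + 1) k = Y k := fun k _ _ => by
    simp [G, rootElement, rootVector]
  have hGH : ∀ k, G k k = H k := rootElement_self X Y H
  have hlin : ∀ g : gl n, (∀ i j, 1 ≤ i → i ≤ n → 1 ≤ j → j ≤ n →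
      r ⁅E n i j, g⁆ = ⁅G i j, r g⁆) → ∀ x, r ⁅x, g⁆ = ⁅r x, r g⁆ := by
    intro g hg x
    rw [gl_eq_sum x]
    simp only [sum_lie, smul_lie, map_sum, map_smul]
    refine Finset.sum_congr rfl fun a _ => Finset.sum_congr rfl fun b _ => ?_
    rw [hg _ _ (by omega) (by omega) (by omega) (by omega),
      hrE _ _ (by omega) (by omega) (by omega) (by omega)]
  -- By the Jacobi identity the g for which r respects every bracket ⁅x, g⁆ form a Lie subalgebra.
  -- Hence root elements have to be bracketed with the generators only, never with each other.
  let K : LieSubalgebra ℂ (gl n) :=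
    { carrier := {g | ∀ x, r ⁅x, g⁆ = ⁅r x, r g⁆}
      add_mem' := fun {a b} ha hb x => by rw [lie_add, map_add, map_add, lie_add, ha, hb]
      zero_mem' := fun x => by simp
      smul_mem' := fun c g hg x => by rw [lie_smul, map_smul, map_smul, lie_smul, hg]
      lie_mem' := fun {a b} ha hb x => by
        rw [leibniz_lie, map_add, hb ⁅x, a⁆, ha x, ← lie_skew a ⁅x, b⁆, map_neg, ha ⁅x, b⁆, hb x,
          lie_skew, ← leibniz_lie, hb a] }
  have hK : ∀ g : gl n, g ∈ K := by
    refine lieSubalgebra_eq_top K (fun k h1 h2 => hlin _ ?_) (fun k h1 h2 => hlin _ ?_)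
      (fun k h1 h2 => hlin _ ?_)
    · intro i j hi hin hj hjn
      rw [hrE k (k + 1) h1 (by omega) (by omega) h2, hGX k h1 h2,
        rootElement_lie_X h hX hY hi hin hj hjn h1 h2, lie_E_E hj hjn (by omega) h2, map_sub,
        apply_ite r, apply_ite r, map_zero]
      rw [hrE _ _ hi hin (by omega) h2, hrE _ _ h1 (by omega) hj hjn]
    · intro i j hi hin hj hjn
      rw [hrE (k + 1) k (by omega) h2 h1 (by omega), hGY k h1 h2,
        rootElement_lie_Y h hX hY hi hin hj hjn h1 h2, lie_E_E hj hjn h1 (by omega), map_sub,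
        apply_ite r, apply_ite r, map_zero]
      rw [hrE _ _ hi hin h1 (by omega), hrE _ _ (by omega) h2 hj hjn]
    · intro i j hi hin hj hjn
      rw [hrE k k h1 h2 h1 h2, hGH k, rootElement_lie_H h hi hin hj hjn h1 h2,
        lie_E_E hj hjn h1 h2, map_sub, apply_ite r, apply_ite r, map_zero]
      rw [hrE _ _ hi hin h1 h2, hrE _ _ h1 h2 hj hjn]
  refine ⟨{ r with map_lie' := fun {x y} => hK y x }, fun k h1 h2 => ?_, fun k h1 h2 => ?_,
    fun k h1 h2 => ?_⟩
  · exact (hrE _ _ h1 (by omega) (by omega) h2).trans (hGX k h1 h2)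
  · exact (hrE _ _ (by omega) h2 h1 (by omega)).trans (hGY k h1 h2)
  · exact (hrE _ _ h1 h2 h1 h2).trans (hGH k)

/-! ### Serre elements commute with the opposite generators. -/

/-- The Serre elements in the `X k` commute with the `Y l`. -/
theorem WeakChevalley.lie_serre {n : ℕ} {X Y H : ℕ → L} (h : WeakChevalley n X Y H)
    {k l m : ℕ} (hk : 1 ≤ k) (hkn : k < n) (hl : 1 ≤ l) (hln : l < n) (hm : 1 ≤ m) (hmn : m < n)
    (hkl : k = l + 1 ∨ l = k + 1) : ⁅Y m, ⁅X k, ⁅X k, X l⁆⁆⁆ = 0 := by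
  have e : ∀ a, 1 ≤ a → a < n → ⁅Y m, X a⁆ = if a = m then H (a + 1) - H a else 0 := by
    intro a h1 h2
    rw [← lie_skew, h.XY a m h1 h2 hm hmn]
    split_ifs <;> simp
  rw [leibniz_lie, leibniz_lie (Y m), e k hk hkn, e l hl hln]
  by_cases h1 : k = m
  -- With h = H_{k+1} - H_k the bracket is ⁅h, ⁅X_k, X_l⁆⁆ + ⁅X_k, ⁅h, X_l⁆⁆. As h has weight -2 on
  -- X_k and 1 on X_l, the coefficients add up to (-2 + 1) + 1 = 0.
  · rw [if_pos h1, if_neg (by omega), lie_zero, add_zero]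
    simp only [sub_lie, leibniz_lie (H _), h.HX _ _ (show 1 ≤ k + 1 by omega) hkn hk hkn,
      h.HX _ _ (show 1 ≤ k + 1 by omega) hkn hl hln, h.HX _ _ hk hkn.le hk hkn,
      h.HX _ _ hk hkn.le hl hln, lie_sub, lie_smul, smul_lie, rootWeight]
    rcases hkl with rfl | rfl
    · simp only [← add_smul, ← sub_smul]
      convert zero_smul ℂ _
      simp [show ¬ l + 1 + 1 = l by omega]
    · simp only [← add_smul, ← sub_smul]
      convert zero_smul ℂ _
      simp [show ¬ k = k + 1 + 1 by omega]
  · rw [if_neg h1]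
    by_cases h2 : l = m
    · rw [if_pos h2]
      simp only [lie_sub, ← lie_skew (X k) (H _), h.HX _ _ (show 1 ≤ l + 1 by omega) hln hk hkn,
        h.HX _ _ hl hln.le hk hkn]
      simp
    · rw [if_neg h2]
      simp

theorem WeakChevalley.lie_far {n : ℕ} {X Y H : ℕ → L} (h : WeakChevalley n X Y H)
    {k l m : ℕ} (hk : 1 ≤ k) (hkl : k + 1 < l) (hln : l < n) (hm : 1 ≤ m) (hmn : m < n) :
    ⁅Y m, ⁅X k, X l⁆⁆ = 0 := by
  have e : ∀ a, 1 ≤ a → a < n → ⁅Y m, X a⁆ = if a = m then H (a + 1) - H a else 0 := by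
    intro a h1 h2
    rw [← lie_skew, h.XY a m h1 h2 hm hmn]
    split_ifs <;> simp
  rw [leibniz_lie, e k hk (by omega), e l (by omega) hln]
  have h0 : ∀ a b, 1 ≤ a → a ≤ n → 1 ≤ b → b < n → a ≠ b → a ≠ b + 1 → ⁅H a, X b⁆ = 0 := by
    intro a b h1 h2 h3 h4 h5 h6
    rw [h.HX a b h1 h2 h3 h4, rootWeight, if_neg h5, if_neg h6, sub_zero, zero_smul]
  by_cases h1 : k = m
  · rw [if_pos h1, if_neg (by omega), lie_zero, add_zero, sub_lie, h0 _ l, h0 _ l, sub_zero] <;>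
      omega
  · rw [if_neg h1]
    by_cases h2 : l = m
    · rw [if_pos h2, lie_sub, ← lie_skew (X k) (H (l + 1)), ← lie_skew (X k) (H l), h0 _ k, h0 _ k] <;>
        first | omega | simp
    · rw [if_neg h2]
      simp

theorem WeakChevalley.lie_serre_lower {n : ℕ} {X Y H : ℕ → L} (h : WeakChevalley n X Y H)
    {k l m : ℕ} (hk : 1 ≤ k) (hkn : k < n) (hl : 1 ≤ l) (hln : l < n) (hm : 1 ≤ m) (hmn : m < n)
    (hkl : k = l + 1 ∨ l = k + 1) : ⁅X m, ⁅Y k, ⁅Y k, Y l⁆⁆⁆ = 0 := by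
  simpa only [neg_lie, lie_neg, neg_neg, neg_eq_zero] using h.flip.lie_serre hk hkn hl hln hm hmn hkl

theorem WeakChevalley.lie_far_lower {n : ℕ} {X Y H : ℕ → L} (h : WeakChevalley n X Y H)
    {k l m : ℕ} (hk : 1 ≤ k) (hkl : k + 1 < l) (hln : l < n) (hm : 1 ≤ m) (hmn : m < n) :
    ⁅X m, ⁅Y k, Y l⁆⁆ = 0 := by
  simpa only [neg_lie, lie_neg, neg_neg, neg_eq_zero] using h.flip.lie_far hk hkl hln hm hmn

end Presentation

end

end GelfandTsetlin

namespace GelfandTsetlin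

noncomputable section

/-! ## Partial fractions -/

open Polynomial in
/-- The sum of the residues of a quotient of two monic polynomials of the same degree. The nodes
outside `g` are cancelled by zeros of the numerator. -/
theorem sum_residues {ι κ : Type*} [DecidableEq ι] [DecidableEq κ] {s g : Finset ι} {t : Finset κ}
    (hgs : g ⊆ s) (hcard : s.card = t.card) (y : ι → ℂ) (c : κ → ℂ) (φ : ι → κ)
    (hφt : ∀ i ∈ s \ g, φ i ∈ t) (hφy : ∀ i ∈ s \ g, c (φ i) = y i)
    (hφ : Set.InjOn φ (s \ g : Finset ι))
    (hy : ∀ i ∈ g, ∀ j ∈ s, j ≠ i → y i ≠ y j) :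
    ∑ i ∈ g, (∏ r ∈ t, (y i - c r)) / ∏ j ∈ s.erase i, (y i - y j) =
      ∑ i ∈ s, y i - ∑ r ∈ t, c r := by
  -- Since φ is injective, each node outside g cancels a zero of its own. What remains is a quotient
  -- with simple nodes g and as many zeros t'.
  set u := (s \ g).image φ with hu
  have hut : u ⊆ t := Finset.image_subset_iff.2 hφt
  set t' := t \ u with ht'
  have hcu : u.card = (s \ g).card := Finset.card_image_of_injOn hφ
  have hct : t'.card = g.card := by
    have h1 := Finset.card_sdiff_add_card_eq_card hut
    have h2 := Finset.card_sdiff_add_card_eq_card hgs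
    rw [← ht'] at h1
    omega
  have hsum : ∑ i ∈ s, y i - ∑ r ∈ t, c r = ∑ i ∈ g, y i - ∑ r ∈ t', c r := by
    rw [← Finset.sum_sdiff hgs, ← Finset.sum_sdiff hut, Finset.sum_image hφ,
      Finset.sum_congr rfl hφy]
    ring
  have hprod : ∀ x, ∏ r ∈ t, (x - c r) = (∏ r ∈ t', (x - c r)) * ∏ j ∈ s \ g, (x - y j) := by
    intro x
    rw [← Finset.prod_sdiff hut, Finset.prod_image hφ]
    congr 1
    exact Finset.prod_congr rfl fun i hi => by rw [hφy i hi]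
  have hterm : ∀ i ∈ g, (∏ r ∈ t, (y i - c r)) / ∏ j ∈ s.erase i, (y i - y j) =
      (∏ r ∈ t', (y i - c r)) / ∏ j ∈ g.erase i, (y i - y j) := by
    intro i hi
    have h1 : s.erase i = g.erase i ∪ s \ g := by
      ext j
      simp only [Finset.mem_erase, Finset.mem_union, Finset.mem_sdiff]
      by_cases hj : j ∈ g
      · simp [hj, hgs hj]
      · simp only [hj, and_false, not_false_eq_true, and_true, false_or, and_iff_right_iff_imp]
        rintro - rfl
        exact hj hi
    have h2 : Disjoint (g.erase i) (s \ g) := by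
      rw [Finset.disjoint_left]
      intro j hj hj'
      exact (Finset.mem_sdiff.1 hj').2 (Finset.mem_of_mem_erase hj)
    rw [h1, Finset.prod_union h2, hprod, mul_div_mul_right]
    refine Finset.prod_ne_zero_iff.2 fun j hj => sub_ne_zero.2 (hy i hi j ?_ ?_)
    · exact (Finset.mem_sdiff.1 hj).1
    · rintro rfl
      exact (Finset.mem_sdiff.1 hj).2 hi
  rw [Finset.sum_congr rfl hterm, hsum]
  rcases g.eq_empty_or_nonempty with rfl | hg
  · have : t' = ∅ := Finset.card_eq_zero.1 (by simpa using hct)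
    simp [this]
  have hyg : Set.InjOn y g := fun i hi j hj h => by
    by_contra hij
    exact hy i hi j (hgs hj) (Ne.symm hij) h
  -- P - N has degree less than |g| and agrees with P at the nodes. Its coefficient of degree |g| -
  -- 1 is the sum of residues by Lagrange interpolation, and the difference of the sums of roots by
  -- Vieta.
  set P : ℂ[X] := ∏ r ∈ t', (X - C (c r))
  set N : ℂ[X] := ∏ i ∈ g, (X - C (y i))
  have hPm : P.Monic := monic_prod_of_monic _ _ fun _ _ => monic_X_sub_C _
  have hNm : N.Monic := monic_prod_of_monic _ _ fun _ _ => monic_X_sub_C _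
  have hPd : P.degree = g.card := by
    rw [degree_prod, Finset.sum_congr rfl fun _ _ => degree_X_sub_C _]
    simp [hct]
  have hNd : N.degree = g.card := by
    rw [degree_prod, Finset.sum_congr rfl fun _ _ => degree_X_sub_C _]
    simp
  have hd : (P - N).degree < g.card := by
    rw [← hPd]
    exact degree_sub_lt_left (hPd.trans hNd.symm) hPm.ne_zero
      (by rw [hPm.leadingCoeff, hNm.leadingCoeff])
  have hpos : 0 < g.card := hg.card_pos
  have key := Lagrange.coeff_eq_sum hyg hd
  rw [coeff_sub] at key
  have hP1 : P.coeff (g.card - 1) = -∑ r ∈ t', c r := by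
    rw [← hct]
    exact prod_X_sub_C_coeff_card_pred t' c (hct ▸ hpos)
  have hN1 : N.coeff (g.card - 1) = -∑ i ∈ g, y i := prod_X_sub_C_coeff_card_pred g y hpos
  rw [hP1, hN1] at key
  rw [show ∑ i ∈ g, y i - ∑ r ∈ t', c r = -∑ r ∈ t', c r - -∑ i ∈ g, y i by ring, key]
  refine Finset.sum_congr rfl fun i hi => ?_
  have : N.eval (y i) = 0 := by
    rw [eval_prod]
    exact Finset.prod_eq_zero hi (by simp)
  rw [eval_sub, this, sub_zero, eval_prod]
  simp

/-! ## Integral differences -/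

/-- `a - b` is a nonnegative integer. -/
def IntGe (a b : ℂ) : Prop := ∃ m : ℤ, 0 ≤ m ∧ a - b = m

/-- `a - b` is a positive integer. -/
def IntGt (a b : ℂ) : Prop := ∃ m : ℤ, 0 < m ∧ a - b = m

theorem IntGe.trans {a b c : ℂ} : IntGe a b → IntGe b c → IntGe a c := by
  rintro ⟨m, hm, h⟩ ⟨m', hm', h'⟩
  exact ⟨m + m', by omega, by push_cast; rw [← h, ← h']; ring⟩

theorem IntGt.trans_ge {a b c : ℂ} : IntGt a b → IntGe b c → IntGt a c := by
  rintro ⟨m, hm, h⟩ ⟨m', hm', h'⟩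
  exact ⟨m + m', by omega, by push_cast; rw [← h, ← h']; ring⟩

theorem IntGe.trans_gt {a b c : ℂ} : IntGe a b → IntGt b c → IntGt a c := by
  rintro ⟨m, hm, h⟩ ⟨m', hm', h'⟩
  exact ⟨m + m', by omega, by push_cast; rw [← h, ← h']; ring⟩

theorem IntGt.ge {a b : ℂ} : IntGt a b → IntGe a b := fun ⟨m, hm, h⟩ => ⟨m, hm.le, h⟩

theorem IntGt.trans {a b c : ℂ} (h : IntGt a b) (h' : IntGt b c) : IntGt a c := h.trans_ge h'.ge

theorem IntGe.refl (a : ℂ) : IntGe a a := ⟨0, le_rfl, by simp⟩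

theorem IntGt.irrefl (a : ℂ) : ¬IntGt a a := by
  rintro ⟨m, hm, h⟩
  rw [sub_self] at h
  have : m = 0 := by exact_mod_cast h.symm
  omega

theorem IntGt.ne {a b : ℂ} (h : IntGt a b) : a ≠ b := by
  rintro rfl
  exact IntGt.irrefl _ h

theorem IntGe.eq_or_gt {a b : ℂ} : IntGe a b → a = b ∨ IntGt a b := by
  rintro ⟨m, hm, h⟩
  rcases hm.eq_or_lt with rfl | hm
  · exact .inl (by simpa [sub_eq_zero] using h)
  · exact .inr ⟨m, hm, h⟩

theorem intGe_add_one {a b : ℂ} : IntGe a (b + 1) ↔ IntGt a b := by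
  constructor
  · rintro ⟨m, hm, h⟩
    exact ⟨m + 1, by omega, by push_cast; rw [← h]; ring⟩
  · rintro ⟨m, hm, h⟩
    exact ⟨m - 1, by omega, by push_cast; rw [← h]; ring⟩

theorem intGt_add_one (a : ℂ) : IntGt (a + 1) a := ⟨1, one_pos, by simp⟩

theorem intGe_sub_one {a b : ℂ} : IntGe (a - 1) b ↔ IntGt a b := by
  rw [← intGe_add_one]
  unfold IntGe
  simp only [show a - 1 - b = a - (b + 1) by ring]

theorem IntGe.antisymm {a b : ℂ} (h : IntGe a b) (h' : IntGe b a) : a = b :=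
  h.eq_or_gt.resolve_right fun h1 => IntGt.irrefl _ (h1.trans_ge h')

/-- If `a + 1 ≥ b > a` then `b = a + 1`. -/
theorem IntGt.eq_add_one {a b : ℂ} (h : IntGt b a) (h' : IntGe (a + 1) b) : b = a + 1 :=
  (intGe_add_one.2 h).antisymm h'

/-! ## Entries of tableaux -/

variable {n : ℕ}

theorem entry_apply (R : Tableau n) {k i : ℕ} (h : 1 ≤ i ∧ i ≤ k ∧ k ≤ n) :
    entry R k i = R ⟨(k, i), h⟩ := dif_pos h

theorem apply_eq_entry (R : Tableau n) (p : Pos n) : R p = entry R p.row p.col :=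
  (entry_apply R p.2).symm

theorem tableau_ext {R S : Tableau n}
    (h : ∀ k i, 1 ≤ i → i ≤ k → k ≤ n → entry R k i = entry S k i) : R = S := by
  funext p
  rw [apply_eq_entry R, apply_eq_entry S]
  exact h _ _ p.2.1 p.2.2.1 p.2.2.2

theorem entry_add (R S : Tableau n) (k i : ℕ) : entry (R + S) k i = entry R k i + entry S k i := by
  by_cases h : 1 ≤ i ∧ i ≤ k ∧ k ≤ n
  · rw [entry_apply _ h, entry_apply _ h, entry_apply _ h]
    rfl
  · simp [entry, h]

theorem entry_sub (R S : Tableau n) (k i : ℕ) : entry (R - S) k i = entry R k i - entry S k i := by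
  by_cases h : 1 ≤ i ∧ i ≤ k ∧ k ≤ n
  · rw [entry_apply _ h, entry_apply _ h, entry_apply _ h]
    rfl
  · simp [entry, h]

theorem entry_delta {k i : ℕ} (h : 1 ≤ i ∧ i ≤ k ∧ k ≤ n) (k' i' : ℕ) :
    entry (delta n k i) k' i' = if k' = k ∧ i' = i then 1 else 0 := by
  by_cases h' : 1 ≤ i' ∧ i' ≤ k' ∧ k' ≤ n
  · rw [entry_apply _ h']
    rfl
  · rw [entry, dif_neg h', if_neg]
    rintro ⟨rfl, rfl⟩
    exact h' h

theorem entry_add_delta (R : Tableau n) {k i : ℕ} (h : 1 ≤ i ∧ i ≤ k ∧ k ≤ n) (k' i' : ℕ) :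
    entry (R + delta n k i) k' i' = entry R k' i' + if k' = k ∧ i' = i then 1 else 0 := by
  rw [entry_add, entry_delta h]

theorem entry_sub_delta (R : Tableau n) {k i : ℕ} (h : 1 ≤ i ∧ i ≤ k ∧ k ≤ n) (k' i' : ℕ) :
    entry (R - delta n k i) k' i' = entry R k' i' - if k' = k ∧ i' = i then 1 else 0 := by
  rw [entry_sub, entry_delta h]

/-! ## The order of the indices -/

theorem Precedes.trans {lam : Fin n → ℂ} {i p j : ℕ} (h : Precedes lam i p)
    (h' : Precedes lam p j) : Precedes lam i j := by
  rcases h with h | ⟨rfl, h1, h2⟩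
  · rcases h' with h' | ⟨rfl, h3, h4⟩
    · exact .inl (IntGt.trans h h')
    · exact .inl (by rwa [← h4])
  · rcases h' with h' | ⟨rfl, h3, h4⟩
    · exact .inl (by rwa [h2])
    · omega

theorem Precedes.irrefl {lam : Fin n → ℂ} (i : ℕ) : ¬Precedes lam i i := by
  rintro (h | ⟨rfl, h, -⟩)
  · exact IntGt.irrefl _ h
  · omega

/-- The condition on the weight. -/
def Standard (lam : Fin n → ℂ) : Prop :=
  ∀ i j : Fin n, i < j → j.val + 1 ≤ n - 1 →
    (¬∃ m : ℤ, lam i - lam j = m) ∨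
      ∃ m : ℤ, lam i - lam j = m ∧ (i.val : ℤ) - (j.val : ℤ) < m

/-- The class relation: `l_i - l_j` is an integer. -/
def Linked (lam : Fin n → ℂ) (i j : ℕ) : Prop := ∃ m : ℤ, shifted lam i - shifted lam j = m

theorem Linked.symm {lam : Fin n → ℂ} {i j : ℕ} : Linked lam i j → Linked lam j i := by
  rintro ⟨m, h⟩
  exact ⟨-m, by push_cast; rw [← h]; ring⟩

theorem Precedes.linked {lam : Fin n → ℂ} {i j : ℕ} : Precedes lam i j → Linked lam i j := by
  rintro (⟨m, -, h⟩ | ⟨-, -, h⟩)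
  · exact ⟨m, h⟩
  · exact ⟨0, by simp [h]⟩

/-- The shift in l_i = λ_i - i + 1 turns the condition λ_i - λ_j > i - j into positivity of l_i -
l_j. -/
theorem Standard.intGt {lam : Fin n → ℂ} (hlam : Standard lam) {i j : ℕ} (hi : 1 ≤ i)
    (hij : i < j) (hj : j < n) (h : Linked lam i j) : IntGt (shifted lam i) (shifted lam j) := by
  obtain ⟨m, hm⟩ := h
  refine ⟨m, ?_, hm⟩
  rw [shifted, shifted, dif_pos ⟨hi, by omega⟩, dif_pos ⟨by omega, by omega⟩] at hm
  have hd : lam ⟨i - 1, by omega⟩ - lam ⟨j - 1, by omega⟩ = ((m + i - j : ℤ) : ℂ) := by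
    push_cast
    rw [← hm]
    ring
  rcases hlam ⟨i - 1, by omega⟩ ⟨j - 1, by omega⟩ (by simp; omega) (by simp; omega) with h | ⟨m', h, h'⟩
  · exact absurd ⟨_, hd⟩ h
  · have : m' = m + i - j := by exact_mod_cast h.symm.trans hd
    simp only at h'
    omega

theorem Standard.lt_of_precedes {lam : Fin n → ℂ} (hlam : Standard lam) {i j : ℕ}
    (hj : 1 ≤ j) (hin : i < n) (hjn : j < n) (h : Precedes lam i j) : i < j := by
  rcases lt_trichotomy i j with hij | rfl | hij
  · exact hij
  · exact absurd h (Precedes.irrefl i)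
  · exact absurd (h.trans (.inl (hlam.intGt hj hij hin h.linked.symm))) (Precedes.irrefl i)

/-- The weight condition says nothing about the index n, so l_i = l_n can occur; the convention that
n comes first breaks this tie. -/
theorem Standard.precedes_or {lam : Fin n → ℂ} (hlam : Standard lam) {i j : ℕ} (hi : 1 ≤ i)
    (hj : 1 ≤ j) (hin : i ≤ n) (hjn : j ≤ n) (hij : i ≠ j) (h : Linked lam i j) :
    Precedes lam i j ∨ Precedes lam j i := by
  wlog hlt : i < j generalizing i j
  · exact (this hj hi hjn hin hij.symm h.symm (by omega)).symm
  rcases hjn.eq_or_lt with rfl | hjn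
  · obtain ⟨m, hm⟩ := h
    rcases lt_trichotomy 0 m with h0 | rfl | h0
    · exact .inl (.inl ⟨m, h0, hm⟩)
    · exact .inr (.inr ⟨rfl, hlt, by simpa [sub_eq_zero, eq_comm] using hm⟩)
    · exact .inr (.inl ⟨-m, by omega, by push_cast; rw [← hm]; ring⟩)
  · exact .inl (.inl (hlam.intGt hi hlt hjn h))

open Classical in
/-- Induction along chains of immediate successors. -/
theorem precedes_induction {lam : Fin n → ℂ} (m : ℕ) {P : ℕ → ℕ → Prop}
    (base : ∀ i j, 1 ≤ i → i ≤ m → 1 ≤ j → j ≤ m → Next lam m i j → P i j)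
    (step : ∀ i p j, 1 ≤ i → i ≤ m → 1 ≤ p → p ≤ m → 1 ≤ j → j ≤ m → Precedes lam i p →
      Precedes lam p j → P i p → P p j → P i j) :
    ∀ i j, 1 ≤ i → i ≤ m → 1 ≤ j → j ≤ m → Precedes lam i j → P i j := by
  have key : ∀ d i j, 1 ≤ i → i ≤ m → 1 ≤ j → j ≤ m → Precedes lam i j →
      ((Finset.Icc 1 m).filter fun p => Precedes lam i p ∧ Precedes lam p j).card = d →
      P i j := by
    intro d
    induction d using Nat.strong_induction_on with
    | _ d ih =>
      intro i j hi him hj hjm hij hd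
      by_cases hN : Next lam m i j
      · exact base i j hi him hj hjm hN
      · obtain ⟨p, hp, hpm, hip, hpj⟩ : ∃ p, 1 ≤ p ∧ p ≤ m ∧ Precedes lam i p ∧ Precedes lam p j := by
          by_contra h
          exact hN ⟨hij, h⟩
        have hmem : p ∈ (Finset.Icc 1 m).filter fun p => Precedes lam i p ∧ Precedes lam p j := by
          simp [hp, hpm, hip, hpj]
        refine step i p j hi him hp hpm hj hjm hip hpj
          (ih _ ?_ i p hi him hp hpm hip rfl) (ih _ ?_ p j hp hpm hj hjm hpj rfl)
        · rw [← hd]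
          refine Finset.card_lt_card (Finset.ssubset_iff_of_subset ?_ |>.2 ⟨p, hmem, ?_⟩)
          · intro q hq
            simp only [Finset.mem_filter] at hq ⊢
            exact ⟨hq.1, hq.2.1, hq.2.2.trans hpj⟩
          · simp [Precedes.irrefl]
        · rw [← hd]
          refine Finset.card_lt_card (Finset.ssubset_iff_of_subset ?_ |>.2 ⟨p, hmem, ?_⟩)
          · intro q hq
            simp only [Finset.mem_filter] at hq ⊢
            exact ⟨hq.1, hip.trans hq.2.1, hq.2.2⟩
          · simp [Precedes.irrefl]
  intro i j hi him hj hjm hij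
  exact key _ i j hi him hj hjm hij rfl

/-! ### Interlacing. -/

/-- The closure of the relations `hwRelations lam` under transitivity. -/
structure Interlaces (lam : Fin n → ℂ) (R : Tableau n) : Prop where
  up : ∀ k i, 1 ≤ i → i ≤ k → k < n → IntGe (entry R (k + 1) i) (entry R k i)
  down : ∀ k i j, 1 ≤ i → i ≤ k → k < n → 1 ≤ j → j ≤ k + 1 → Precedes lam i j →
    IntGt (entry R k i) (entry R (k + 1) j)
  top : ∀ i j, 1 ≤ i → i ≤ n → 1 ≤ j → j ≤ n → Precedes lam i j →
    IntGe (entry R n i) (entry R n j)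

/-- The given relations concern immediate successors only. Chaining makes row n monotone. If row k +
1 is monotone, the strict relations from row k to row k + 1 extend to all pairs, and together with
the relations of type (1) they make row k monotone; so the induction runs downward from row n. -/
theorem satisfies_iff_interlaces {lam : Fin n → ℂ} {R : Tableau n} :
    Satisfies (hwRelations lam) R ↔ Interlaces lam R := by
  constructor
  · intro h
    have hup : ∀ k i, 1 ≤ i → i ≤ k → k < n → IntGe (entry R (k + 1) i) (entry R k i) := by
      intro k i hi hik hk
      have : IntGe (R _) (R _) := h _ (.inl (.inl ⟨⟨(k + 1, i), hi, by omega, by omega⟩,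
        ⟨(k, i), hi, hik, hk.le⟩, rfl, rfl, rfl⟩))
      rwa [← entry_apply R, ← entry_apply R] at this
    have hnext : ∀ k i j, 1 ≤ i → i ≤ k → k < n → 1 ≤ j → j ≤ k + 1 → Next lam (k + 1) i j →
        IntGt (entry R k i) (entry R (k + 1) j) := by
      intro k i j hi hik hk hj hjk hN
      have : IntGt (R _) (R _) := h _ (.inl (.inr ⟨⟨(k, i), hi, hik, hk.le⟩, ⟨(k + 1, j), hj, hjk, hk⟩, rfl, hN, rfl⟩))
      rwa [← entry_apply R, ← entry_apply R] at this
    have htop : ∀ i j, 1 ≤ i → i ≤ n → 1 ≤ j → j ≤ n → Precedes lam i j →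
        IntGe (entry R n i) (entry R n j) := by
      refine precedes_induction n ?_ fun i p j _ _ _ _ _ _ _ _ h1 h2 => h1.trans h2
      intro i j hi hin hj hjn hN
      have : IntGe (R _) (R _) := h _ (.inr ⟨⟨(n, i), hi, hin, le_rfl⟩, ⟨(n, j), hj, hjn, le_rfl⟩, rfl, rfl, hN, rfl⟩)
      rwa [← entry_apply R, ← entry_apply R] at this
    have hdown : ∀ k, (∀ i j, 1 ≤ i → i ≤ k + 1 → 1 ≤ j → j ≤ k + 1 → Precedes lam i j →
        IntGe (entry R (k + 1) i) (entry R (k + 1) j)) → ∀ i j, 1 ≤ i → i ≤ k → k < n → 1 ≤ j →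
        j ≤ k + 1 → Precedes lam i j → IntGt (entry R k i) (entry R (k + 1) j) := by
      intro k hk i j hi hik hkn hj hjk hij
      refine precedes_induction (lam := lam) (k + 1)
        (P := fun i j => i ≤ k → IntGt (entry R k i) (entry R (k + 1) j)) ?_ ?_ i j hi (by omega)
        hj hjk hij hik
      · intro i j hi _ hj hjk hN hik
        exact hnext k i j hi hik hkn hj hjk hN
      · intro i p j _ _ hp hpk hj hjk _ hpj h1 _ hik
        exact (h1 hik).trans_ge (hk p j hp hpk hj hjk hpj)
    have hmono : ∀ k, k ≤ n → ∀ i j, 1 ≤ i → i ≤ k → 1 ≤ j → j ≤ k → Precedes lam i j →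
        IntGe (entry R k i) (entry R k j) := by
      intro k hk
      induction hk using Nat.decreasingInduction with
      | self => exact htop
      | of_succ k hk ih =>
        intro i j hi hik hj hjk hij
        exact ((hdown k ih i j hi hik hk hj (by omega) hij).trans_ge (hup k j hj hjk hk)).ge
    exact ⟨hup, fun k i j hi hik hk => hdown k (hmono (k + 1) hk) i j hi hik hk, htop⟩
  · rintro h r ((⟨p, q, h1, h2, rfl⟩ | ⟨p, q, h1, h2, rfl⟩) | ⟨p, q, h1, h2, h3, rfl⟩)
    · have e := apply_eq_entry R p
      rw [h1, h2] at e
      change IntGe (R p) (R q)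
      rw [e, apply_eq_entry R q]
      have := p.2.2.2
      change p.row ≤ n at this
      exact h.up q.row q.col q.2.1 q.2.2.1 (by omega)
    · have e := apply_eq_entry R q
      rw [h1] at e
      change IntGt (R p) (R q)
      rw [e, apply_eq_entry R p]
      have hq := q.2.2.2
      have hq' := q.2.2.1
      change q.row ≤ n at hq
      change q.col ≤ q.row at hq'
      rw [h1] at h2
      exact h.down p.row p.col q.col p.2.1 p.2.2.1 (by omega) q.2.1 (by omega) h2.1
    · have e1 := apply_eq_entry R p
      have e2 := apply_eq_entry R q
      have hp := p.2.2.1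
      have hq := q.2.2.1
      change p.col ≤ p.row at hp
      change q.col ≤ q.row at hq
      rw [h1] at e1 hp
      rw [h2] at e2 hq
      change IntGe (R p) (R q)
      rw [e1, e2]
      exact h.top p.col q.col p.2.1 hp q.2.1 hq h3.1

theorem Interlaces.mono {lam : Fin n → ℂ} {R : Tableau n} (h : Interlaces lam R) {k i j : ℕ}
    (hk : k ≤ n) (hi : 1 ≤ i) (hik : i ≤ k) (hin : i < n) (hj : 1 ≤ j) (hjk : j ≤ k)
    (hij : Precedes lam i j) : IntGt (entry R k i) (entry R k j) := by
  rcases hk.eq_or_lt with rfl | hk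
  · obtain ⟨m, rfl⟩ : ∃ m, k = m + 1 := ⟨k - 1, by omega⟩
    exact (h.up m i hi (by omega) (by omega)).trans_gt
      (h.down m i j hi (by omega) (by omega) hj hjk hij)
  · exact (h.down k i j hi hik hk hj (by omega) hij).trans_ge (h.up k j hj hjk hk)

/-- A raising step that leaves the set of tableaux. -/
theorem Interlaces.of_add_delta {lam : Fin n → ℂ} {R : Tableau n} (h : Interlaces lam R) {k i : ℕ}
    (hi : 1 ≤ i) (hik : i ≤ k) (hk : k < n) (h1 : entry R k i ≠ entry R (k + 1) i)
    (h2 : ∀ j, 1 ≤ j → j + 1 ≤ k → Precedes lam j i → entry R (k - 1) j ≠ entry R k i + 1) :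
    Interlaces lam (R + delta n k i) := by
  have hki : 1 ≤ i ∧ i ≤ k ∧ k ≤ n := ⟨hi, hik, hk.le⟩
  constructor
  · intro k' i' hi' hik' hk'
    rw [entry_add_delta R hki, entry_add_delta R hki]
    have h0 := h.up k' i' hi' hik' hk'
    by_cases h3 : k' = k ∧ i' = i
    · obtain ⟨rfl, rfl⟩ := h3
      rw [if_neg (by omega), if_pos ⟨rfl, rfl⟩, add_zero]
      exact intGe_add_one.2 (h0.eq_or_gt.resolve_left h1.symm)
    · rw [if_neg h3, add_zero]
      split_ifs
      · exact (intGt_add_one _).ge.trans h0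
      · rwa [add_zero]
  · intro k' i' j hi' hik' hk' hj hjk hij
    rw [entry_add_delta R hki, entry_add_delta R hki]
    have h0 := h.down k' i' j hi' hik' hk' hj hjk hij
    by_cases h3 : k' + 1 = k ∧ j = i
    · obtain ⟨rfl, rfl⟩ := h3
      rw [if_neg (by omega), if_pos ⟨rfl, rfl⟩, add_zero]
      have h4 := h2 i' hi' (by omega) hij
      rw [Nat.add_sub_cancel] at h4
      exact (intGe_add_one.2 h0).eq_or_gt.resolve_left h4
    · rw [if_neg h3, add_zero]
      split_ifs
      · exact (intGt_add_one _).trans h0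
      · rwa [add_zero]
  · intro i' j hi' hin hj hjn hij
    rw [entry_add_delta R hki, entry_add_delta R hki, if_neg (by omega), if_neg (by omega),
      add_zero, add_zero]
    exact h.top i' j hi' hin hj hjn hij

/-- A lowering step that leaves the set of tableaux. -/
theorem Interlaces.of_sub_delta {lam : Fin n → ℂ} {R : Tableau n} (h : Interlaces lam R) {k i : ℕ}
    (hi : 1 ≤ i) (hik : i ≤ k) (hk : k < n)
    (h1 : i + 1 ≤ k → entry R (k - 1) i ≠ entry R k i)
    (h2 : ∀ j, 1 ≤ j → j ≤ k + 1 → Precedes lam i j → entry R (k + 1) j ≠ entry R k i - 1) :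
    Interlaces lam (R - delta n k i) := by
  have hki : 1 ≤ i ∧ i ≤ k ∧ k ≤ n := ⟨hi, hik, hk.le⟩
  have hsub : ∀ a b : ℂ, IntGe a b → IntGe a (b - 1) := fun a b h =>
    h.trans ⟨1, zero_le_one, by simp⟩
  have hsub' : ∀ a b : ℂ, IntGt a b → IntGt a (b - 1) := fun a b h =>
    h.trans_ge ⟨1, zero_le_one, by simp⟩
  constructor
  · intro k' i' hi' hik' hk'
    rw [entry_sub_delta R hki, entry_sub_delta R hki]
    have h0 := h.up k' i' hi' hik' hk'
    by_cases h3 : k' + 1 = k ∧ i' = i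
    · obtain ⟨rfl, rfl⟩ := h3
      rw [if_pos ⟨rfl, rfl⟩, if_neg (by omega), sub_zero]
      have h4 := h1 (by omega)
      rw [Nat.add_sub_cancel] at h4
      exact intGe_sub_one.2 (h0.eq_or_gt.resolve_left h4.symm)
    · rw [if_neg h3, sub_zero]
      split_ifs
      · exact hsub _ _ h0
      · rwa [sub_zero]
  · intro k' i' j hi' hik' hk' hj hjk hij
    rw [entry_sub_delta R hki, entry_sub_delta R hki]
    have h0 := h.down k' i' j hi' hik' hk' hj hjk hij
    by_cases h3 : k' = k ∧ i' = i
    · obtain ⟨rfl, rfl⟩ := h3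
      rw [if_pos ⟨rfl, rfl⟩, if_neg (by omega), sub_zero]
      exact (intGe_sub_one.2 h0).eq_or_gt.resolve_left (h2 j hj hjk hij).symm
    · rw [if_neg h3, sub_zero]
      split_ifs
      · exact hsub' _ _ h0
      · rwa [sub_zero]
  · intro i' j hi' hin hj hjn hij
    rw [entry_sub_delta R hki, entry_sub_delta R hki, if_neg (by omega), if_neg (by omega),
      sub_zero, sub_zero]
    exact h.top i' j hi' hin hj hjn hij

/-! ## The set of tableaux -/

theorem add_delta_mem {C : Set (Rel n)} {L R : Tableau n} (hR : R ∈ tableaux C L) {k : ℕ}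
    (i : ℕ) (hk : k < n) (h : Satisfies C (R + delta n k i)) : R + delta n k i ∈ tableaux C L := by
  obtain ⟨-, z, hz, hRz⟩ := hR
  refine ⟨h, fun p => z p + if p.row = k ∧ p.col = i then 1 else 0, fun p hp => ?_, fun p => ?_⟩
  · change z p + (if p.row = k ∧ p.col = i then 1 else 0) = 0
    rw [hz p hp, if_neg (by omega), zero_add]
  · rw [Pi.add_apply, hRz p, delta]
    push_cast
    ring

theorem sub_delta_mem {C : Set (Rel n)} {L R : Tableau n} (hR : R ∈ tableaux C L) {k : ℕ}
    (i : ℕ) (hk : k < n) (h : Satisfies C (R - delta n k i)) : R - delta n k i ∈ tableaux C L := by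
  obtain ⟨-, z, hz, hRz⟩ := hR
  refine ⟨h, fun p => z p - if p.row = k ∧ p.col = i then 1 else 0, fun p hp => ?_, fun p => ?_⟩
  · change z p - (if p.row = k ∧ p.col = i then 1 else 0) = 0
    rw [hz p hp, if_neg (by omega), sub_zero]
  · rw [Pi.sub_apply, hRz p, delta]
    push_cast
    ring

/-- If a raising step and a lowering step at different positions lead back into the set of
tableaux, then so does each of them. -/
theorem mem_of_add_sub_mem {C : Set (Rel n)} {L R : Tableau n} (hR : R ∈ tableaux C L)
    {k i l j : ℕ} (hk : k < n) (hl : l < n) (hne : ¬(k = l ∧ i = j))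
    (h : R + delta n k i - delta n l j ∈ tableaux C L) :
    R + delta n k i ∈ tableaux C L ∧ R - delta n l j ∈ tableaux C L := by
  have key : ∀ r ∈ C, r.Holds (R + delta n k i) ∧ r.Holds (R - delta n l j) := by
    intro r hr
    have h1 := hR.1 r hr
    have h2 := h.1 r hr
    -- Raising can break a lower bound for R p - R q only at q, lowering only at p. The other step,
    -- being at a different position, cannot repair the damage, so the bound would also fail after
    -- both steps. Strict relations are the case b = 1.
    have aux : ∀ p q : Pos n, ∀ b : ℤ, (∃ m : ℤ, b ≤ m ∧ R p - R q = m) →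
        (∃ m : ℤ, b ≤ m ∧ (R + delta n k i - delta n l j) p - (R + delta n k i - delta n l j) q = m) →
        (∃ m : ℤ, b ≤ m ∧ (R + delta n k i) p - (R + delta n k i) q = m) ∧
        (∃ m : ℤ, b ≤ m ∧ (R - delta n l j) p - (R - delta n l j) q = m) := by
      rintro p q b ⟨m, hm, hmR⟩ ⟨m', hm', hmS⟩
      simp only [Pi.add_apply, Pi.sub_apply, delta] at hmS ⊢
      have e : m' = m + (if p.row = k ∧ p.col = i then 1 else 0)
          - (if q.row = k ∧ q.col = i then 1 else 0) - (if p.row = l ∧ p.col = j then 1 else 0)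
          + (if q.row = l ∧ q.col = j then 1 else 0) := by
        have : (m' : ℂ) = ((m + (if p.row = k ∧ p.col = i then 1 else 0)
          - (if q.row = k ∧ q.col = i then 1 else 0) - (if p.row = l ∧ p.col = j then 1 else 0)
          + (if q.row = l ∧ q.col = j then 1 else 0) : ℤ) : ℂ) := by
          rw [← hmS]
          push_cast
          rw [← hmR]
          ring
        exact_mod_cast this
      refine ⟨⟨m + (if p.row = k ∧ p.col = i then 1 else 0)
          - (if q.row = k ∧ q.col = i then 1 else 0), ?_, by push_cast; rw [← hmR]; ring⟩,
        ⟨m - (if p.row = l ∧ p.col = j then 1 else 0)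
          + (if q.row = l ∧ q.col = j then 1 else 0), ?_, by push_cast; rw [← hmR]; ring⟩⟩ <;>
      split_ifs at e ⊢ <;> omega
    cases r with
    | ge p q => exact aux p q 0 h1 h2
    | gt p q => exact aux p q 1 h1 h2
  exact ⟨add_delta_mem hR i hk fun r hr => (key r hr).1,
    sub_delta_mem hR j hl fun r hr => (key r hr).2⟩

end

end GelfandTsetlin

namespace GelfandTsetlin

noncomputable section

attribute [local instance 100] LieRing.ofAssociativeRing

variable {n : ℕ}

/-! ## The Gelfand–Tsetlin operators -/

theorem end_lie_apply {V : Type*} [AddCommGroup V] [Module ℂ V] (f g : Module.End ℂ V) (v : V) :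
    ⁅f, g⁆ v = f (g v) - g (f v) := rfl

section Operators

variable (C : Set (Rel n)) (L : Tableau n)

theorem tab_of_mem {R : Tableau n} (h : R ∈ tableaux C L) : tab C L R = Finsupp.single ⟨R, h⟩ 1 :=
  dif_pos h

theorem tab_of_notMem {R : Tableau n} (h : R ∉ tableaux C L) : tab C L R = 0 := dif_neg h

/-- The operator of `E_{k,k+1}`. -/
def raiseOp (k : ℕ) : Module.End ℂ (TableauSpace C L) :=
  Finsupp.linearCombination ℂ fun R : tableaux C L =>
    ∑ i ∈ Finset.Icc 1 k, raiseCoeff R.1 k i • tab C L (R.1 + delta n k i)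

/-- The operator of `E_{k+1,k}`, with arbitrary coefficients `c`. -/
def lowerOp (c : Tableau n → ℕ → ℕ → ℂ) (k : ℕ) : Module.End ℂ (TableauSpace C L) :=
  Finsupp.linearCombination ℂ fun R : tableaux C L =>
    ∑ i ∈ Finset.Icc 1 k, c R.1 k i • tab C L (R.1 - delta n k i)

/-- The operator of `E_{kk}`. -/
def weightOp (k : ℕ) : Module.End ℂ (TableauSpace C L) :=
  Finsupp.linearCombination ℂ fun R : tableaux C L => weightCoeff R.1 k • tab C L R.1

open Classical in
theorem raiseOp_tab (k : ℕ) (R : Tableau n) : raiseOp C L k (tab C L R) =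
    if R ∈ tableaux C L then
      ∑ i ∈ Finset.Icc 1 k, raiseCoeff R k i • tab C L (R + delta n k i) else 0 := by
  split_ifs with h
  · rw [tab_of_mem C L h, raiseOp, Finsupp.linearCombination_single, one_smul]
  · rw [tab_of_notMem C L h, map_zero]

open Classical in
theorem lowerOp_tab (c : Tableau n → ℕ → ℕ → ℂ) (k : ℕ) (R : Tableau n) :
    lowerOp C L c k (tab C L R) = if R ∈ tableaux C L then
      ∑ i ∈ Finset.Icc 1 k, c R k i • tab C L (R - delta n k i) else 0 := by
  split_ifs with h
  · rw [tab_of_mem C L h, lowerOp, Finsupp.linearCombination_single, one_smul]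
  · rw [tab_of_notMem C L h, map_zero]

theorem weightOp_tab (k : ℕ) (R : Tableau n) :
    weightOp C L k (tab C L R) = weightCoeff R k • tab C L R := by
  by_cases h : R ∈ tableaux C L
  · rw [tab_of_mem C L h, weightOp, Finsupp.linearCombination_single, one_smul,
      tab_of_mem C L h]
  · rw [tab_of_notMem C L h, map_zero, smul_zero]

variable {C L}

theorem tableauSpace_hom_ext {M : Type*} [AddCommGroup M] [Module ℂ M]
    {f g : TableauSpace C L →ₗ[ℂ] M}
    (h : ∀ R ∈ tableaux C L, f (tab C L R) = g (tab C L R)) : f = g := by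
  refine Finsupp.lhom_ext' fun R => LinearMap.ext_ring ?_
  have := h R.1 R.2
  rwa [tab_of_mem C L R.2] at this

theorem tableauSpace_eq_sum (w : TableauSpace C L) :
    w = w.sum fun R a => a • tab C L R.1 := by
  conv_lhs => rw [← Finsupp.sum_single w]
  refine Finsupp.sum_congr fun R _ => ?_
  rw [tab_of_mem C L R.2, Finsupp.smul_single, smul_eq_mul, mul_one]

open Classical in
theorem tab_apply (R : Tableau n) (S : tableaux C L) :
    tab C L R S = if R = S.1 then 1 else 0 := by
  by_cases h : R ∈ tableaux C L
  · rw [tab_of_mem C L h, Finsupp.single_apply]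
    simp [Subtype.ext_iff]
  · rw [tab_of_notMem C L h, if_neg]
    · rfl
    · rintro rfl
      exact h S.2

end Operators

/-! ## Weights -/

theorem sum_entry_add_delta (R : Tableau n) {l i : ℕ} (h : 1 ≤ i ∧ i ≤ l ∧ l ≤ n) (k : ℕ) :
    ∑ j ∈ Finset.Icc 1 k, entry (R + delta n l i) k j =
      ∑ j ∈ Finset.Icc 1 k, entry R k j + if k = l then 1 else 0 := by
  simp only [entry_add_delta R h, Finset.sum_add_distrib]
  congr 1
  by_cases hk : k = l
  · subst hk
    simp [h.1, h.2.1]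
  · simp [hk]

theorem weightCoeff_add_delta (R : Tableau n) {l i : ℕ} (h : 1 ≤ i ∧ i ≤ l ∧ l ≤ n) {k : ℕ}
    (hk : 1 ≤ k) : weightCoeff (R + delta n l i) k = weightCoeff R k + rootWeight k l := by
  unfold weightCoeff rootWeight
  rw [sum_entry_add_delta R h, sum_entry_add_delta R h]
  have : (k - 1 = l) ↔ (k = l + 1) := by omega
  simp only [this]
  ring

theorem weightCoeff_sub_delta (R : Tableau n) {l i : ℕ} (h : 1 ≤ i ∧ i ≤ l ∧ l ≤ n) {k : ℕ}
    (hk : 1 ≤ k) : weightCoeff (R - delta n l i) k = weightCoeff R k - rootWeight k l := by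
  have := weightCoeff_add_delta (R - delta n l i) h hk
  rw [sub_add_cancel] at this
  rw [this]
  ring

section Relations

variable {C : Set (Rel n)} {L : Tableau n}

theorem weightOp_lie_weightOp (k l : ℕ) : ⁅weightOp C L k, weightOp C L l⁆ = 0 := by
  refine tableauSpace_hom_ext fun R hR => ?_
  simp only [end_lie_apply, weightOp_tab, map_smul,
    LinearMap.zero_apply]
  rw [smul_comm, sub_self]

theorem weightOp_lie_raiseOp {k l : ℕ} (hk : 1 ≤ k) (hln : l < n) :
    ⁅weightOp C L k, raiseOp C L l⁆ = rootWeight k l • raiseOp C L l := by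
  refine tableauSpace_hom_ext fun R hR => ?_
  simp only [end_lie_apply, weightOp_tab, map_smul,
    LinearMap.smul_apply, raiseOp_tab, if_pos hR, map_sum, Finset.smul_sum,
    ← Finset.sum_sub_distrib]
  refine Finset.sum_congr rfl fun i hi => ?_
  rw [Finset.mem_Icc] at hi
  rw [weightCoeff_add_delta R ⟨hi.1, hi.2, hln.le⟩ hk]
  module

theorem weightOp_lie_lowerOp (c : Tableau n → ℕ → ℕ → ℂ) {k l : ℕ} (hk : 1 ≤ k) (hln : l < n) :
    ⁅weightOp C L k, lowerOp C L c l⁆ = -rootWeight k l • lowerOp C L c l := by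
  refine tableauSpace_hom_ext fun R hR => ?_
  simp only [end_lie_apply, weightOp_tab, map_smul,
    LinearMap.smul_apply, lowerOp_tab, if_pos hR, map_sum, Finset.smul_sum,
    ← Finset.sum_sub_distrib]
  refine Finset.sum_congr rfl fun i hi => ?_
  rw [Finset.mem_Icc] at hi
  rw [weightCoeff_sub_delta R ⟨hi.1, hi.2, hln.le⟩ hk]
  module

/-- Raising and lowering at different positions commute at the level of coefficients. -/
theorem lowerCoeff_mul_raiseCoeff (R : Tableau n) {k i l j : ℕ} (hi : 1 ≤ i) (hik : i ≤ k)
    (hk : k < n) (hj : 1 ≤ j) (hjl : j ≤ l) (hl : l < n) (hne : ¬(k = l ∧ i = j)) :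
    lowerCoeff R l j * raiseCoeff (R - delta n l j) k i =
      raiseCoeff R k i * lowerCoeff (R + delta n k i) l j := by
  have hki : 1 ≤ i ∧ i ≤ k ∧ k ≤ n := ⟨hi, hik, hk.le⟩
  have hlj : 1 ≤ j ∧ j ≤ l ∧ l ≤ n := ⟨hj, hjl, hl.le⟩
  unfold lowerCoeff raiseCoeff
  simp only [entry_sub_delta R hlj, entry_add_delta R hki]
  by_cases hkl : k = l
  · subst hkl
    have hij : i ≠ j := fun h => hne ⟨rfl, h⟩
    simp only [true_and, hij, hij.symm, if_false, sub_zero, add_zero, Nat.add_eq_left, one_ne_zero,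
      false_and, show ¬ k - 1 = k by omega]
    have h1 : j ∈ (Finset.Icc 1 k).erase i := by simp [hij.symm, hj, hjl]
    have h2 : i ∈ (Finset.Icc 1 k).erase j := by simp [hij, hi, hik]
    rw [← Finset.mul_prod_erase _ _ h1, ← Finset.mul_prod_erase _ _ h2,
      ← Finset.mul_prod_erase _ (fun x => entry R k i - entry R k x) h1,
      ← Finset.mul_prod_erase _ (fun x => entry R k j - (entry R k x + _)) h2]
    have e1 : ∏ x ∈ ((Finset.Icc 1 k).erase i).erase j,
        (entry R k i - (entry R k x - if x = j then 1 else 0)) =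
        ∏ x ∈ ((Finset.Icc 1 k).erase i).erase j, (entry R k i - entry R k x) :=
      Finset.prod_congr rfl fun x hx => by rw [if_neg (Finset.ne_of_mem_erase hx), sub_zero]
    have e2 : ∏ x ∈ ((Finset.Icc 1 k).erase j).erase i,
        (entry R k j - (entry R k x + if x = i then 1 else 0)) =
        ∏ x ∈ ((Finset.Icc 1 k).erase j).erase i, (entry R k j - entry R k x) :=
      Finset.prod_congr rfl fun x hx => by rw [if_neg (Finset.ne_of_mem_erase hx), add_zero]
    rw [e1, e2, if_pos rfl, if_pos rfl, ← neg_div, ← neg_div, div_mul_div_comm, div_mul_div_comm]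
    congr 1 <;> ring
  · simp only [hkl, Ne.symm hkl, false_and, if_false, sub_zero, add_zero]
    by_cases hkl' : l = k + 1
    · subst hkl'
      simp only [true_and, Nat.add_sub_cancel]
      have h1 : j ∈ Finset.Icc 1 (k + 1) := by simp [hj, hjl]
      have h2 : i ∈ Finset.Icc 1 k := by simp [hi, hik]
      rw [← Finset.mul_prod_erase _ _ h1, ← Finset.mul_prod_erase _ _ h2,
        ← Finset.mul_prod_erase _ (fun x => entry R k i - entry R (k + 1) x) h1,
        ← Finset.mul_prod_erase _ (fun x => entry R (k + 1) j - (entry R k x + _)) h2]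
      have e1 : ∏ x ∈ (Finset.Icc 1 (k + 1)).erase j,
          (entry R k i - (entry R (k + 1) x - if x = j then 1 else 0)) =
          ∏ x ∈ (Finset.Icc 1 (k + 1)).erase j, (entry R k i - entry R (k + 1) x) :=
        Finset.prod_congr rfl fun x hx => by rw [if_neg (Finset.ne_of_mem_erase hx), sub_zero]
      have e2 : ∏ x ∈ (Finset.Icc 1 k).erase i,
          (entry R (k + 1) j - (entry R k x + if x = i then 1 else 0)) =
          ∏ x ∈ (Finset.Icc 1 k).erase i, (entry R (k + 1) j - entry R k x) :=
        Finset.prod_congr rfl fun x hx => by rw [if_neg (Finset.ne_of_mem_erase hx), add_zero]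
      rw [e1, e2, if_pos rfl, if_pos rfl]
      ring
    · simp only [show ¬ k + 1 = l by omega, show ¬ l - 1 = k by omega, false_and, if_false,
        sub_zero, add_zero]
      ring

-- Both orders end at the same tableau. If it is admitted, so are both intermediate ones, and the
-- coefficients agree; otherwise both sides vanish.
open Classical in
theorem lower_raise_term {R : Tableau n} (hR : R ∈ tableaux C L) {k i l j : ℕ} (hi : 1 ≤ i)
    (hik : i ≤ k) (hk : k < n) (hj : 1 ≤ j) (hjl : j ≤ l) (hl : l < n) (hne : ¬(k = l ∧ i = j)) :
    lowerCoeff R l j • (if R - delta n l j ∈ tableaux C L then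
        raiseCoeff (R - delta n l j) k i • tab C L (R - delta n l j + delta n k i) else 0) =
      raiseCoeff R k i • (if R + delta n k i ∈ tableaux C L then
        lowerCoeff (R + delta n k i) l j • tab C L (R + delta n k i - delta n l j) else 0) := by
  rw [show R - delta n l j + delta n k i = R + delta n k i - delta n l j by abel]
  by_cases hS : R + delta n k i - delta n l j ∈ tableaux C L
  · obtain ⟨h1, h2⟩ := mem_of_add_sub_mem hR hk hl hne hS
    rw [if_pos h1, if_pos h2, smul_smul, smul_smul,
      lowerCoeff_mul_raiseCoeff R hi hik hk hj hjl hl hne]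
  · rw [tab_of_notMem C L hS]
    simp

open Classical in
theorem raiseOp_lowerOp_tab {R : Tableau n} (hR : R ∈ tableaux C L) (k l : ℕ) :
    raiseOp C L k (lowerOp C L lowerCoeff l (tab C L R)) =
      ∑ j ∈ Finset.Icc 1 l, ∑ i ∈ Finset.Icc 1 k, lowerCoeff R l j •
        (if R - delta n l j ∈ tableaux C L then
          raiseCoeff (R - delta n l j) k i • tab C L (R - delta n l j + delta n k i) else 0) := by
  rw [lowerOp_tab, if_pos hR, map_sum]
  refine Finset.sum_congr rfl fun j _ => ?_
  rw [map_smul, raiseOp_tab, ← Finset.smul_sum]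
  split_ifs <;> simp

open Classical in
theorem lowerOp_raiseOp_tab {R : Tableau n} (hR : R ∈ tableaux C L) (k l : ℕ) :
    lowerOp C L lowerCoeff l (raiseOp C L k (tab C L R)) =
      ∑ j ∈ Finset.Icc 1 l, ∑ i ∈ Finset.Icc 1 k, raiseCoeff R k i •
        (if R + delta n k i ∈ tableaux C L then
          lowerCoeff (R + delta n k i) l j • tab C L (R + delta n k i - delta n l j) else 0) := by
  rw [raiseOp_tab, if_pos hR, map_sum, Finset.sum_comm]
  refine Finset.sum_congr rfl fun j _ => ?_
  rw [map_smul, lowerOp_tab, ← Finset.smul_sum]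
  split_ifs <;> simp

theorem raiseOp_lie_lowerOp_ne {k l : ℕ} (hk : k < n) (hl : l < n) (hkl : k ≠ l) :
    ⁅raiseOp C L k, lowerOp C L lowerCoeff l⁆ = 0 := by
  refine tableauSpace_hom_ext fun R hR => ?_
  rw [end_lie_apply,
    raiseOp_lowerOp_tab hR, lowerOp_raiseOp_tab hR, LinearMap.zero_apply, sub_eq_zero]
  refine Finset.sum_congr rfl fun j hj => Finset.sum_congr rfl fun i hi => ?_
  rw [Finset.mem_Icc] at hi hj
  exact lower_raise_term hR hi.1 hi.2 hk hj.1 hj.2 hl fun h => hkl h.1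

end Relations

/-! ## The diagonal relation -/

theorem Noncritical.inj {R : Tableau n} (h : Noncritical R) {k i j : ℕ} (hi : 1 ≤ i) (hik : i ≤ k)
    (hj : 1 ≤ j) (hjk : j ≤ k) (hk : k < n) (he : entry R k i = entry R k j) : i = j := by
  rcases lt_trichotomy i j with hij | rfl | hij
  · exact absurd he (h k i j hi hij hjk hk)
  · rfl
  · exact absurd he.symm (h k j i hj hij hik hk)

/-- Written through the entries of R alone, the product becomes minus the residue at the node r_{ki}
used in `sum_diagonal`. -/
theorem raise_mul_lower (R : Tableau n) {k i : ℕ} (hi : 1 ≤ i) (hik : i ≤ k) (hk : k < n) :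
    raiseCoeff R k i * lowerCoeff (R + delta n k i) k i =
      -(((∏ j ∈ Finset.Icc 1 (k + 1), (entry R k i - entry R (k + 1) j)) *
        ∏ j ∈ Finset.Icc 1 (k - 1), (entry R k i + 1 - entry R (k - 1) j)) /
      ((∏ j ∈ (Finset.Icc 1 k).erase i, (entry R k i - entry R k j)) *
        ∏ j ∈ (Finset.Icc 1 k).erase i, (entry R k i + 1 - entry R k j))) := by
  have hki : 1 ≤ i ∧ i ≤ k ∧ k ≤ n := ⟨hi, hik, hk.le⟩
  unfold raiseCoeff lowerCoeff
  simp only [entry_add_delta R hki, true_and, if_true, show ¬ k - 1 = k by omega, false_and,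
    if_false, add_zero]
  have e : ∏ j ∈ (Finset.Icc 1 k).erase i,
      (entry R k i + 1 - (entry R k j + if j = i then 1 else 0)) =
      ∏ j ∈ (Finset.Icc 1 k).erase i, (entry R k i + 1 - entry R k j) :=
    Finset.prod_congr rfl fun x hx => by rw [if_neg (Finset.ne_of_mem_erase hx), add_zero]
  rw [e, neg_mul, div_mul_div_comm]

theorem lower_mul_raise (R : Tableau n) {k i : ℕ} (hi : 1 ≤ i) (hik : i ≤ k) (hk : k < n) :
    lowerCoeff R k i * raiseCoeff (R - delta n k i) k i =
      -(((∏ j ∈ Finset.Icc 1 (k + 1), (entry R k i - 1 - entry R (k + 1) j)) *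
        ∏ j ∈ Finset.Icc 1 (k - 1), (entry R k i - entry R (k - 1) j)) /
      ((∏ j ∈ (Finset.Icc 1 k).erase i, (entry R k i - 1 - entry R k j)) *
        ∏ j ∈ (Finset.Icc 1 k).erase i, (entry R k i - entry R k j))) := by
  have hki : 1 ≤ i ∧ i ≤ k ∧ k ≤ n := ⟨hi, hik, hk.le⟩
  have key := raise_mul_lower (R - delta n k i) hi hik hk
  rw [sub_add_cancel] at key
  rw [mul_comm, key]
  simp only [entry_sub_delta R hki, true_and, if_true, show ¬ k - 1 = k by omega, false_and,
    if_false, sub_zero, sub_add_cancel, show ¬ k + 1 = k by omega]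
  have e1 : ∏ j ∈ (Finset.Icc 1 k).erase i,
      (entry R k i - 1 - (entry R k j - if j = i then 1 else 0)) =
      ∏ j ∈ (Finset.Icc 1 k).erase i, (entry R k i - 1 - entry R k j) :=
    Finset.prod_congr rfl fun x hx => by rw [if_neg (Finset.ne_of_mem_erase hx), sub_zero]
  have e2 : ∏ j ∈ (Finset.Icc 1 k).erase i,
      (entry R k i - (entry R k j - if j = i then 1 else 0)) =
      ∏ j ∈ (Finset.Icc 1 k).erase i, (entry R k i - entry R k j) :=
    Finset.prod_congr rfl fun x hx => by rw [if_neg (Finset.ne_of_mem_erase hx), sub_zero]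
  rw [e1, e2]

theorem disjSum_erase_inl {α β : Type*} [DecidableEq α] [DecidableEq β] (s : Finset α)
    (t : Finset β) (a : α) : (s.disjSum t).erase (Sum.inl a) = (s.erase a).disjSum t := by
  ext (x | x) <;> simp

theorem disjSum_erase_inr {α β : Type*} [DecidableEq α] [DecidableEq β] (s : Finset α)
    (t : Finset β) (b : β) : (s.disjSum t).erase (Sum.inr b) = s.disjSum (t.erase b) := by
  ext (x | x) <;> simp

variable {lam : Fin n → ℂ} {L : Tableau n}

-- With x, a, b the rows k, k + 1, k - 1, take the rational function with poles x_i and x_i - 1 and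
-- zeros a_j and b_j - 1; there are 2k of each. Its residue at x_i is minus the product for raising
-- and lowering back, its residue at x_i - 1 the product for lowering and raising back. By
-- `sum_residues` they add up to the sum of the poles minus that of the zeros, which is the right
-- side. Poles that belong to steps out of the set of tableaux are cancelled by zeros.
open Classical in
theorem sum_diagonal (hlam : Standard lam) (hL : IsRealization (hwRelations lam) L) {R : Tableau n}
    (hR : R ∈ tableaux (hwRelations lam) L) {k : ℕ} (hk : 1 ≤ k) (hkn : k < n) :
    ∑ i ∈ Finset.Icc 1 k, (if R - delta n k i ∈ tableaux (hwRelations lam) L then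
        lowerCoeff R k i * raiseCoeff (R - delta n k i) k i else 0) -
      ∑ i ∈ Finset.Icc 1 k, (if R + delta n k i ∈ tableaux (hwRelations lam) L then
        raiseCoeff R k i * lowerCoeff (R + delta n k i) k i else 0) =
      weightCoeff R k - weightCoeff R (k + 1) := by
  set B := tableaux (hwRelations lam) L with hB
  have hI : Interlaces lam R := satisfies_iff_interlaces.1 hR.1
  have hinj : ∀ S ∈ B, ∀ i j, 1 ≤ i → i ≤ k → 1 ≤ j → j ≤ k → entry S k i = entry S k j → i = j :=
    fun S hS i j hi hik hj hjk h => (hL.2 S hS).inj hi hik hj hjk hkn h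
  set x : ℕ → ℂ := entry R k with hx
  set a : ℕ → ℂ := entry R (k + 1) with ha
  set b : ℕ → ℂ := entry R (k - 1) with hb
  -- A forbidden raising step is blocked either from above, x_i = a_i, or from below by some b_j =
  -- x_i + 1; either equation supplies a zero at the pole x_i. The hypotheses stand inside the
  -- existential so that the choice of j is a total function.
  have hup : ∀ i, ∃ j, 1 ≤ i → i ≤ k → R + delta n k i ∉ B → x i ≠ a i →
      1 ≤ j ∧ j + 1 ≤ k ∧ Precedes lam j i ∧ b j = x i + 1 := by
    intro i
    by_contra! hcon
    obtain ⟨hi, hik, hi1, hi2, -⟩ := hcon 0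
    refine hi1 (add_delta_mem hR i hkn (satisfies_iff_interlaces.2
      (hI.of_add_delta hi hik hkn hi2 fun j hj hjk hji => ?_)))
    exact (hcon j).2.2.2.2 hj hjk hji
  have hdown : ∀ i, ∃ j, 1 ≤ i → i ≤ k → R - delta n k i ∉ B → ¬(i + 1 ≤ k ∧ b i = x i) →
      1 ≤ j ∧ j ≤ k + 1 ∧ Precedes lam i j ∧ a j = x i - 1 := by
    intro i
    by_contra! hcon
    obtain ⟨hi, hik, hi1, hi2, -⟩ := hcon 0
    refine hi1 (sub_delta_mem hR i hkn (satisfies_iff_interlaces.2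
      (hI.of_sub_delta hi hik hkn hi2 fun j hj hjk hji => ?_)))
    exact (hcon j).2.2.2.2 hj hjk hji
  choose J hJ using hup
  choose K hK using hdown
  let s : Finset (ℕ ⊕ ℕ) := (Finset.Icc 1 k).disjSum (Finset.Icc 1 k)
  let t : Finset (ℕ ⊕ ℕ) := (Finset.Icc 1 (k + 1)).disjSum (Finset.Icc 1 (k - 1))
  let g : Finset (ℕ ⊕ ℕ) := ((Finset.Icc 1 k).filter fun i => R + delta n k i ∈ B).disjSum
    ((Finset.Icc 1 k).filter fun i => R - delta n k i ∈ B)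
  let y : ℕ ⊕ ℕ → ℂ := Sum.elim x fun i => x i - 1
  let c : ℕ ⊕ ℕ → ℂ := Sum.elim a fun j => b j - 1
  let φ : ℕ ⊕ ℕ → ℕ ⊕ ℕ := Sum.elim (fun i => if x i = a i then .inl i else .inr (J i))
    fun i => if i + 1 ≤ k ∧ b i = x i then .inr i else .inl (K i)
  have hmem : ∀ u ∈ s \ g, Sum.elim (fun i => 1 ≤ i ∧ i ≤ k ∧ R + delta n k i ∉ B)
      (fun i => 1 ≤ i ∧ i ≤ k ∧ R - delta n k i ∉ B) u := by
    rintro (i | i) hu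
    · simp only [s, g, Finset.mem_sdiff, Finset.inl_mem_disjSum, Finset.mem_filter,
        Finset.mem_Icc] at hu
      exact ⟨hu.1.1, hu.1.2, fun h => hu.2 ⟨hu.1, h⟩⟩
    · simp only [s, g, Finset.mem_sdiff, Finset.inr_mem_disjSum, Finset.mem_filter,
        Finset.mem_Icc] at hu
      exact ⟨hu.1.1, hu.1.2, fun h => hu.2 ⟨hu.1, h⟩⟩
  have hφt : ∀ u ∈ s \ g, φ u ∈ t := by
    rintro (i | i) hu <;> obtain ⟨h1, h2, h3⟩ := hmem _ hu <;>
      simp only [φ, Sum.elim_inl, Sum.elim_inr, t] <;> split_ifs with h4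
    · simp; omega
    · have := hJ i h1 h2 h3 h4
      simp; omega
    · simp; omega
    · have := hK i h1 h2 h3 h4
      simp; omega
  have hφy : ∀ u ∈ s \ g, c (φ u) = y u := by
    rintro (i | i) hu <;> obtain ⟨h1, h2, h3⟩ := hmem _ hu <;>
      simp only [φ, Sum.elim_inl, Sum.elim_inr, y] <;> split_ifs with h4
    · exact h4.symm
    · simp only [c, Sum.elim_inr, (hJ i h1 h2 h3 h4).2.2.2, add_sub_cancel_right]
    · simp only [c, Sum.elim_inr, h4.2]
    · exact (hK i h1 h2 h3 h4).2.2.2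
  -- Two forbidden steps may share a pole, x_i = x_{i'} - 1. Interlacing forces the zeros assigned
  -- to them to be different, so a double pole meets a double zero.
  have hcross : ∀ i i', 1 ≤ i → i ≤ k → R + delta n k i ∉ B → 1 ≤ i' → i' ≤ k →
      R - delta n k i' ∉ B → x i = x i' - 1 → φ (.inl i) ≠ φ (.inr i') := by
    intro i i' hi hik hiB hi' hik' hiB' hxx
    have hxx' : x i' = x i + 1 := by rw [hxx]; ring
    simp only [φ, Sum.elim_inl, Sum.elim_inr]
    split_ifs with h1 h2 h2
    · simp
    · obtain ⟨h3, h4, h5, h6⟩ := hK i' hi' hik' hiB' h2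
      intro h
      rw [← Sum.inl.inj h] at h5 h6
      have hlt := hlam.lt_of_precedes hi (by omega) (by omega) h5
      refine h2 ⟨by omega, ?_⟩
      have e1 := hI.down (k - 1) i' i hi' (by omega) (by omega) hi (by omega) h5
      have e2 := hI.up (k - 1) i' hi' (by omega) (by omega)
      rw [Nat.sub_add_cancel hk] at e1 e2
      exact (IntGt.eq_add_one e1 (hxx' ▸ e2)).trans hxx'.symm
    · obtain ⟨h3, h4, h5, h6⟩ := hJ i hi hik hiB h1
      intro h
      rw [Sum.inr.inj h] at h5 h6
      have e1 : IntGt (x i') (a i) := hI.down k i' i hi' hik' hkn hi (by omega) h5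
      have e2 : IntGe (a i) (x i) := hI.up k i hi hik hkn
      have e3 := e2.eq_or_gt.resolve_left (Ne.symm h1)
      exact IntGt.irrefl _ (e1.trans_ge (hxx' ▸ intGe_add_one.2 e3))
    · simp
  have hφ : Set.InjOn φ (s \ g : Finset (ℕ ⊕ ℕ)) := by
    intro u hu v hv huv
    have hyy : y u = y v := by rw [← hφy u hu, ← hφy v hv, huv]
    rcases u with i | i <;> rcases v with i' | i' <;> obtain ⟨h1, h2, h3⟩ := hmem _ hu <;>
      obtain ⟨h1', h2', h3'⟩ := hmem _ hv
    · rw [hinj R hR i i' h1 h2 h1' h2' hyy]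
    · exact absurd huv (hcross i i' h1 h2 h3 h1' h2' h3' hyy)
    · exact absurd huv.symm (hcross i' i h1' h2' h3' h1 h2 h3 hyy.symm)
    · rw [hinj R hR i i' h1 h2 h1' h2' (by simpa [y] using hyy)]
  -- Poles of permitted steps are simple: x_i + 1 = x_j would give two equal entries in row k of the
  -- raised tableau, against the realization property.
  have hne1 : ∀ i j, 1 ≤ i → i ≤ k → R + delta n k i ∈ B → 1 ≤ j → j ≤ k → x i ≠ x j - 1 := by
    intro i j hi hik hiB hj hjk h
    have hki : 1 ≤ i ∧ i ≤ k ∧ k ≤ n := ⟨hi, hik, hkn.le⟩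
    by_cases hij : j = i
    · subst hij
      exact one_ne_zero (sub_eq_self.1 h.symm)
    · refine hij (hinj _ hiB j i hj hjk hi hik ?_)
      rw [entry_add_delta R hki, entry_add_delta R hki, if_neg (by simp [hij]), if_pos ⟨rfl, rfl⟩,
        add_zero]
      change x j = x i + 1
      rw [h]
      ring
  have hne2 : ∀ i j, 1 ≤ i → i ≤ k → R - delta n k i ∈ B → 1 ≤ j → j ≤ k → x i - 1 ≠ x j := by
    intro i j hi hik hiB hj hjk h
    have hki : 1 ≤ i ∧ i ≤ k ∧ k ≤ n := ⟨hi, hik, hkn.le⟩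
    by_cases hij : j = i
    · subst hij
      exact one_ne_zero (sub_eq_self.1 h)
    · refine hij (hinj _ hiB j i hj hjk hi hik ?_)
      rw [entry_sub_delta R hki, entry_sub_delta R hki, if_neg (by simp [hij]), if_pos ⟨rfl, rfl⟩,
        sub_zero]
      exact h.symm
  have hy : ∀ u ∈ g, ∀ v ∈ s, v ≠ u → y u ≠ y v := by
    rintro (i | i) hu (j | j) hv huv <;>
      simp only [s, g, Finset.inl_mem_disjSum, Finset.inr_mem_disjSum, Finset.mem_filter,
        Finset.mem_Icc] at hu hv
    · exact fun h => huv (by rw [hinj R hR i j hu.1.1 hu.1.2 hv.1 hv.2 h])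
    · exact hne1 i j hu.1.1 hu.1.2 hu.2 hv.1 hv.2
    · exact hne2 i j hu.1.1 hu.1.2 hu.2 hv.1 hv.2
    · exact fun h => huv (by rw [hinj R hR i j hu.1.1 hu.1.2 hv.1 hv.2 (by simpa [y] using h)])
  have hgs : g ⊆ s := Finset.disjSum_mono (Finset.filter_subset _ _) (Finset.filter_subset _ _)
  have hcard : s.card = t.card := by
    simp only [s, t, Finset.card_disjSum, Nat.card_Icc]
    omega
  have key := sum_residues hgs hcard y c φ hφt hφy hφ hy
  have hinl : ∀ i ∈ Finset.Icc 1 k, (∏ r ∈ t, (y (.inl i) - c r)) /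
      ∏ v ∈ s.erase (.inl i), (y (.inl i) - y v) =
      -(raiseCoeff R k i * lowerCoeff (R + delta n k i) k i) := by
    intro i hi
    have hi' := Finset.mem_Icc.1 hi
    rw [raise_mul_lower R hi'.1 hi'.2 hkn, neg_neg]
    simp only [s, t, disjSum_erase_inl, Finset.prod_disjSum, y, c, Sum.elim_inl, Sum.elim_inr]
    rw [← Finset.mul_prod_erase (Finset.Icc 1 k) _ hi, sub_sub_cancel, one_mul]
    simp only [hx, ha, hb, sub_sub_eq_add_sub]
  have hinr : ∀ i ∈ Finset.Icc 1 k, (∏ r ∈ t, (y (.inr i) - c r)) /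
      ∏ v ∈ s.erase (.inr i), (y (.inr i) - y v) =
      lowerCoeff R k i * raiseCoeff (R - delta n k i) k i := by
    intro i hi
    have hi' := Finset.mem_Icc.1 hi
    rw [lower_mul_raise R hi'.1 hi'.2 hkn]
    simp only [s, t, disjSum_erase_inr, Finset.prod_disjSum, y, c, Sum.elim_inl, Sum.elim_inr]
    rw [← Finset.mul_prod_erase (Finset.Icc 1 k) (fun j => x i - 1 - x j) hi,
      show x i - 1 - x i = -1 by ring, neg_one_mul, neg_mul, div_neg]
    simp only [hx, ha, hb, sub_sub_sub_cancel_right]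
  have hleft : ∑ u ∈ g, (∏ r ∈ t, (y u - c r)) / ∏ v ∈ s.erase u, (y u - y v) =
      ∑ i ∈ Finset.Icc 1 k, (if R - delta n k i ∈ B then
        lowerCoeff R k i * raiseCoeff (R - delta n k i) k i else 0) -
      ∑ i ∈ Finset.Icc 1 k, (if R + delta n k i ∈ B then
        raiseCoeff R k i * lowerCoeff (R + delta n k i) k i else 0) := by
    rw [Finset.sum_disjSum, Finset.sum_filter, Finset.sum_filter, add_comm, sub_eq_add_neg,
      ← Finset.sum_neg_distrib]
    congr 1
    · refine Finset.sum_congr rfl fun i hi => ?_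
      split_ifs
      · exact hinr i hi
      · rfl
    · refine Finset.sum_congr rfl fun i hi => ?_
      split_ifs
      · exact hinl i hi
      · simp
  rw [← hleft, key]
  simp only [s, t, Finset.sum_disjSum, y, c, Sum.elim_inl, Sum.elim_inr, Finset.sum_sub_distrib,
    Finset.sum_const, Nat.card_Icc, weightCoeff, Nat.add_sub_cancel, nsmul_eq_mul, mul_one,
    Nat.cast_add, Nat.cast_one, Nat.cast_sub hk, hx, ha, hb]
  ring

theorem raiseOp_lie_lowerOp_self (hlam : Standard lam) (hL : IsRealization (hwRelations lam) L)
    {k : ℕ} (hk : 1 ≤ k) (hkn : k < n) :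
    ⁅raiseOp (hwRelations lam) L k, lowerOp (hwRelations lam) L lowerCoeff k⁆ =
      weightOp (hwRelations lam) L k - weightOp (hwRelations lam) L (k + 1) := by
  classical
  refine tableauSpace_hom_ext fun R hR => ?_
  rw [end_lie_apply,
    raiseOp_lowerOp_tab hR, lowerOp_raiseOp_tab hR, LinearMap.sub_apply, weightOp_tab,
    weightOp_tab, ← sub_smul, ← sum_diagonal hlam hL hR hk hkn, ← Finset.sum_sub_distrib,
    ← Finset.sum_sub_distrib, Finset.sum_smul]
  refine Finset.sum_congr rfl fun j hj => ?_
  -- Raising at i and lowering at j ≠ i cancels in the commutator; only i = j contributes.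
  rw [← Finset.sum_sub_distrib, Finset.sum_eq_single j]
  · rw [sub_add_cancel, add_sub_cancel_right]
    split_ifs <;> simp [sub_smul, smul_smul]
  · intro i hi hij
    rw [Finset.mem_Icc] at hi hj
    rw [sub_eq_zero]
    exact lower_raise_term hR hi.1 hi.2 hkn hj.1 hj.2 hkn fun h => hij h.2
  · exact fun h => absurd hj h

theorem weakChevalley (hlam : Standard lam) (hL : IsRealization (hwRelations lam) L) :
    WeakChevalley n (raiseOp (hwRelations lam) L) (lowerOp (hwRelations lam) L lowerCoeff)
      (weightOp (hwRelations lam) L) where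
  HH k l _ _ _ _ := weightOp_lie_weightOp k l
  HX k l hk _ _ hl := weightOp_lie_raiseOp hk hl
  HY k l hk _ _ hl := weightOp_lie_lowerOp _ hk hl
  XY k l hk hkn _ hln := by
    split_ifs with h
    · subst h
      exact raiseOp_lie_lowerOp_self hlam hL hk hkn
    · exact raiseOp_lie_lowerOp_ne hkn hln h

end

end GelfandTsetlin

namespace GelfandTsetlin

noncomputable section

attribute [local instance 100] LieRing.ofAssociativeRing

variable {n : ℕ} {lam : Fin n → ℂ} {L : Tableau n}

/-! ## The top tableau and the height -/

/-- The tableau all of whose rows are initial segments of the top row of `L`. -/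
def topTableau (L : Tableau n) : Tableau n := fun p => entry L n p.col

theorem entry_topTableau (L : Tableau n) {k i : ℕ} (hi : 1 ≤ i) (hik : i ≤ k) (hk : k ≤ n) :
    entry (topTableau L) k i = entry L n i := entry_apply _ ⟨hi, hik, hk⟩

theorem entry_top_row {C : Set (Rel n)} {R : Tableau n} (hR : R ∈ tableaux C L) {i : ℕ}
    (hi : 1 ≤ i) (hin : i ≤ n) : entry R n i = entry L n i := by
  obtain ⟨-, z, hz, hRz⟩ := hR
  have key : ∀ p : Pos n, p.row = n → R p = L p := fun p hp => by
    rw [hRz, hz p hp, Int.cast_zero, add_zero]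
  rw [entry_apply _ ⟨hi, hin, le_rfl⟩, entry_apply _ ⟨hi, hin, le_rfl⟩]
  exact key _ rfl

theorem Interlaces.le_top {R : Tableau n} (h : Interlaces lam R) {k i : ℕ} (hi : 1 ≤ i)
    (hik : i ≤ k) (hk : k ≤ n) : IntGe (entry R n i) (entry R k i) := by
  induction hk using Nat.decreasingInduction with
  | self => exact IntGe.refl _
  | of_succ k hk ih => exact (ih (by omega)).trans (h.up k i hi hik hk)

theorem le_top_of_mem {R : Tableau n} (hR : R ∈ tableaux (hwRelations lam) L) {k i : ℕ}
    (hi : 1 ≤ i) (hik : i ≤ k) (hk : k ≤ n) : IntGe (entry L n i) (entry R k i) := by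
  rw [← entry_top_row hR hi (hik.trans hk)]
  exact (satisfies_iff_interlaces.1 hR.1).le_top hi hik hk

theorem topTableau_mem (hL : Satisfies (hwRelations lam) L) :
    topTableau L ∈ tableaux (hwRelations lam) L := by
  have hI := satisfies_iff_interlaces.1 hL
  have hz : ∀ p : Pos n, ∃ m : ℤ, topTableau L p = L p + m := by
    intro p
    obtain ⟨m, -, hm⟩ := hI.le_top p.2.1 p.2.2.1 p.2.2.2
    refine ⟨m, ?_⟩
    rw [← hm, apply_eq_entry L p]
    exact (add_sub_cancel _ _).symm
  choose z hz using hz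
  refine ⟨satisfies_iff_interlaces.2 ⟨fun k i hi hik hk => ?_, fun k i j hi hik hk hj hjk hij => ?_,
    fun i j hi hin hj hjn hij => ?_⟩, z, fun p hp => ?_, hz⟩
  · rw [entry_topTableau L hi (by omega) hk, entry_topTableau L hi hik hk.le]
    exact IntGe.refl _
  · rw [entry_topTableau L hi hik hk.le, entry_topTableau L hj hjk hk]
    exact hI.mono le_rfl hi (by omega) (by omega) hj (by omega) hij
  · rw [entry_topTableau L hi hin le_rfl, entry_topTableau L hj hjn le_rfl]
    exact hI.top i j hi hin hj hjn hij
  · have h1 := hz p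
    have h2 : topTableau L p = L p := by
      rw [apply_eq_entry L p, hp]
      rfl
    rw [h2, left_eq_add] at h1
    exact_mod_cast h1

theorem Interlaces.mono_ge {R : Tableau n} (h : Interlaces lam R) {k i j : ℕ}
    (hk : k ≤ n) (hi : 1 ≤ i) (hik : i ≤ k) (hj : 1 ≤ j) (hjk : j ≤ k)
    (hij : Precedes lam i j) : IntGe (entry R k i) (entry R k j) := by
  by_cases hin : i < n
  · exact (h.mono hk hi hik hin hj hjk hij).ge
  · obtain rfl : k = n := by omega
    exact h.top i j hi hik hj hjk hij

/-- The sum of the differences between the entries of the top tableau and those of `R`. -/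
def heightSum (L R : Tableau n) : ℂ :=
  ∑ k ∈ Finset.Icc 1 (n - 1), ∑ i ∈ Finset.Icc 1 k, (entry L n i - entry R k i)

/-- The number of lowering steps from the top tableau to `R`. -/
def height (L R : Tableau n) : ℕ := ⌊(heightSum L R).re⌋₊

theorem IntGe.exists_nat {a b : ℂ} : IntGe a b → ∃ m : ℕ, a - b = m := by
  rintro ⟨m, hm, h⟩
  lift m to ℕ using hm
  exact ⟨m, by simpa using h⟩

theorem exists_nat_sum {ι : Type*} (s : Finset ι) (f : ι → ℂ) (h : ∀ i ∈ s, ∃ m : ℕ, f i = m) :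
    ∃ m : ℕ, ∑ i ∈ s, f i = m := by
  choose! g hg using h
  exact ⟨∑ i ∈ s, g i, by rw [Nat.cast_sum]; exact Finset.sum_congr rfl hg⟩

/-- No entry exceeds the top entry of its column, and the differences are integers; so the sum is a
natural number and the floor loses nothing. -/
theorem height_cast {R : Tableau n} (hR : R ∈ tableaux (hwRelations lam) L) :
    (height L R : ℂ) = heightSum L R := by
  obtain ⟨m, hm⟩ : ∃ m : ℕ, heightSum L R = m := by
    refine exists_nat_sum _ _ fun k hk => exists_nat_sum _ _ fun i hi => ?_
    rw [Finset.mem_Icc] at hk hi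
    exact (le_top_of_mem hR hi.1 hi.2 (by omega)).exists_nat
  rw [height, hm, Complex.natCast_re, Nat.floor_natCast]

theorem heightSum_add_delta (R : Tableau n) {k i : ℕ} (hi : 1 ≤ i) (hik : i ≤ k) (hk : k < n) :
    heightSum L (R + delta n k i) + 1 = heightSum L R := by
  unfold heightSum
  simp only [Finset.sum_sub_distrib, sum_entry_add_delta R ⟨hi, hik, hk.le⟩,
    Finset.sum_add_distrib]
  have : k ∈ Finset.Icc 1 (n - 1) := Finset.mem_Icc.2 (by omega)
  rw [Finset.sum_ite_eq' _ k, if_pos this]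
  ring

theorem height_add_delta {R : Tableau n} (hR : R ∈ tableaux (hwRelations lam) L) {k i : ℕ}
    (hi : 1 ≤ i) (hik : i ≤ k) (hk : k < n)
    (hR' : R + delta n k i ∈ tableaux (hwRelations lam) L) :
    height L (R + delta n k i) + 1 = height L R := by
  have := heightSum_add_delta (L := L) R hi hik hk
  rw [← height_cast hR, ← height_cast hR'] at this
  exact_mod_cast this

theorem height_sub_delta {R : Tableau n} (hR : R ∈ tableaux (hwRelations lam) L) {k i : ℕ}
    (hi : 1 ≤ i) (hik : i ≤ k) (hk : k < n)
    (hR' : R - delta n k i ∈ tableaux (hwRelations lam) L) :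
    height L (R - delta n k i) = height L R + 1 := by
  have := height_add_delta hR' hi hik hk (by rwa [sub_add_cancel])
  rw [← this, sub_add_cancel]

/-! ## Coordinates of the operators -/

section Coordinates

variable {C : Set (Rel n)}

open Classical in
theorem raiseOp_apply (k : ℕ) (w : TableauSpace C L) (S : tableaux C L) :
    raiseOp C L k w S = ∑ i ∈ Finset.Icc 1 k, if h : S.1 - delta n k i ∈ tableaux C L then
      raiseCoeff (S.1 - delta n k i) k i * w ⟨_, h⟩ else 0 := by
  induction w using Finsupp.induction_linear with
  | zero => simp
  | add v w hv hw =>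
    rw [map_add, Finsupp.add_apply, hv, hw, ← Finset.sum_add_distrib]
    refine Finset.sum_congr rfl fun i _ => ?_
    split_ifs
    · rw [Finsupp.add_apply, mul_add]
    · simp
  | single R a =>
    rw [raiseOp, Finsupp.linearCombination_single, Finsupp.smul_apply, Finsupp.finsetSum_apply,
      Finset.smul_sum]
    refine Finset.sum_congr rfl fun i _ => ?_
    rw [Finsupp.smul_apply, tab_apply]
    split_ifs with h1 h2 h2
    · have : R.1 = S.1 - delta n k i := eq_sub_of_add_eq h1
      simp only [← this, Subtype.coe_eta, Finsupp.single_eq_same, smul_eq_mul]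
      ring
    · rw [← h1, add_sub_cancel_right] at h2
      exact absurd R.2 h2
    · rw [Finsupp.single_eq_of_ne]
      · simp
      · rintro rfl
        exact h1 (sub_add_cancel _ _)
    · simp

open Classical in
theorem lowerOp_apply (c : Tableau n → ℕ → ℕ → ℂ) (k : ℕ) (w : TableauSpace C L)
    (S : tableaux C L) :
    lowerOp C L c k w S = ∑ i ∈ Finset.Icc 1 k, if h : S.1 + delta n k i ∈ tableaux C L then
      c (S.1 + delta n k i) k i * w ⟨_, h⟩ else 0 := by
  induction w using Finsupp.induction_linear with
  | zero => simp
  | add v w hv hw =>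
    rw [map_add, Finsupp.add_apply, hv, hw, ← Finset.sum_add_distrib]
    refine Finset.sum_congr rfl fun i _ => ?_
    split_ifs
    · rw [Finsupp.add_apply, mul_add]
    · simp
  | single R a =>
    rw [lowerOp, Finsupp.linearCombination_single, Finsupp.smul_apply, Finsupp.finsetSum_apply,
      Finset.smul_sum]
    refine Finset.sum_congr rfl fun i _ => ?_
    rw [Finsupp.smul_apply, tab_apply]
    split_ifs with h1 h2 h2
    · have : R.1 = S.1 + delta n k i := eq_add_of_sub_eq h1
      simp only [← this, Subtype.coe_eta, Finsupp.single_eq_same, smul_eq_mul]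
      ring
    · rw [← h1, sub_add_cancel] at h2
      exact absurd R.2 h2
    · rw [Finsupp.single_eq_of_ne]
      · simp
      · rintro rfl
        exact h1 (add_sub_cancel_right _ _)
    · simp

end Coordinates

/-! ## Functions annihilated by all steps -/

open Classical in
/-- A function on the tableaux that is annihilated by all the weighted steps is supported on the
top tableau. -/
theorem eq_topTableau_of_support {c : Tableau n → ℕ → ℕ → ℂ} {f : Tableau n → ℂ}
    (hsum : ∀ k, 1 ≤ k → k < n → ∀ S ∈ tableaux (hwRelations lam) L,
      ∑ i ∈ Finset.Icc 1 k, (if S - delta n k i ∈ tableaux (hwRelations lam) L then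
        c (S - delta n k i) k i * f (S - delta n k i) else 0) = 0)
    (hc : ∀ R ∈ tableaux (hwRelations lam) L, ∀ k i, 1 ≤ i → i ≤ k → k < n →
      R + delta n k i ∈ tableaux (hwRelations lam) L →
      (∀ j, 1 ≤ j → j + 1 ≤ k → entry R (k - 1) j = entry R k j) → c R k i ≠ 0)
    {R : Tableau n} (hR : R ∈ tableaux (hwRelations lam) L) (hf : f R ≠ 0) :
    R = topTableau L := by
  set B := tableaux (hwRelations lam) L
  -- By induction on k, every tableau in the support of f has its rows up to k equal to initial
  -- segments of row k. For k = n this is the top tableau.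
  have key : ∀ k, k ≤ n → ∀ R ∈ B, f R ≠ 0 → ∀ i j, 1 ≤ j → j ≤ i → i ≤ k →
      entry R i j = entry R k j := by
    intro k
    induction k with
    | zero =>
      intro _ R _ _ i j h1 h2 h3
      omega
    | succ k ih =>
      intro hk R hR hf
      have ih := ih (by omega)
      have hI := satisfies_iff_interlaces.1 hR.1
      -- If R can be raised at (k, i), the equation at S = R + δ^{ki} contains no other term than
      -- that of R. A second support tableau S - δ^{ki'} would have the same row k - 1 as R but a
      -- row k that differs from it at i and i', one of which is at most k - 1, whereas for both
      -- tableaux row k - 1 is a copy of the first entries of row k.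
      have hout : ∀ i, 1 ≤ i → i ≤ k → R + delta n k i ∉ B := by
        intro i hi hik hS
        have hki : 1 ≤ i ∧ i ≤ k ∧ k ≤ n := ⟨hi, hik, by omega⟩
        have h0 := hsum k (by omega) hk _ hS
        rw [Finset.sum_eq_single i] at h0
        · rw [add_sub_cancel_right, if_pos hR] at h0
          rcases mul_eq_zero.1 h0 with h0 | h0
          · exact hc R hR k i hi hik hk hS
              (fun j hj hjk => ih R hR hf (k - 1) j hj (by omega) (by omega)) h0
          · exact hf h0
        · intro i' hi' hne
          split_ifs with hR'
          · rw [Finset.mem_Icc] at hi'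
            have hki' : 1 ≤ i' ∧ i' ≤ k ∧ k ≤ n := ⟨hi'.1, hi'.2, by omega⟩
            by_contra hcf
            have hf' := right_ne_zero_of_mul hcf
            have h1 : ∀ j, 1 ≤ j → j + 1 ≤ k → entry R (k - 1) j = entry R k j := fun j hj hjk =>
              ih R hR hf (k - 1) j hj (by omega) (by omega)
            have h2 : ∀ j, 1 ≤ j → j + 1 ≤ k → entry (R + delta n k i - delta n k i') (k - 1) j =
                entry (R + delta n k i - delta n k i') k j := fun j hj hjk =>
              ih _ hR' hf' (k - 1) j hj (by omega) (by omega)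
            simp only [entry_sub_delta _ hki', entry_add_delta _ hki, true_and] at h2
            rcases (show i + 1 ≤ k ∨ i' + 1 ≤ k by omega) with h3 | h3
            · have := h2 i hi h3
              rw [h1 i hi h3, if_neg (by omega), if_neg (by omega), if_pos rfl,
                if_neg (Ne.symm hne)] at this
              simp only [add_zero, sub_zero] at this
              exact one_ne_zero (left_eq_add.1 this)
            · have := h2 i' hi'.1 h3
              rw [h1 i' hi'.1 h3, if_neg (by omega), if_neg (by omega), if_neg hne,
                if_pos rfl] at this
              simp only [add_zero, sub_zero] at this
              exact one_ne_zero (sub_eq_self.1 this.symm)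
          · rfl
        · intro h
          exact absurd (Finset.mem_Icc.2 ⟨hi, hik⟩) h
      -- If r_{ki} lies below r_{k+1,i}, raising could be blocked only by r_{k-1,j} = r_{ki} + 1
      -- with j ≺ i. But r_{k-1,j} = r_{kj} > r_{k+1,i} ≥ r_{ki} + 1, so raising is possible,
      -- contrary to the previous step.
      have heq : ∀ i, 1 ≤ i → i ≤ k → entry R k i = entry R (k + 1) i := by
        intro i hi hik
        by_contra hne
        refine hout i hi hik (add_delta_mem hR i hk (satisfies_iff_interlaces.2
          (hI.of_add_delta hi hik hk hne fun j hj hjk hji h => ?_)))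
        rw [ih R hR hf (k - 1) j hj (by omega) (by omega)] at h
        have e1 := hI.down k j i hj (by omega) hk hi (by omega) hji
        have e2 := (hI.up k i hi hik hk).eq_or_gt.resolve_left (Ne.symm hne)
        rw [h] at e1
        exact IntGt.irrefl _ (e1.trans_ge (intGe_add_one.2 e2))
      intro i j hj hji hik
      rcases hik.eq_or_lt with rfl | hik
      · rfl
      · rw [ih R hR hf i j hj hji (by omega), heq j hj (by omega)]
  refine tableau_ext fun k i hi hik hk => ?_
  rw [entry_topTableau L hi hik hk, ← entry_top_row hR hi (by omega)]
  exact key n le_rfl R hR hf k i hi hik hk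

/-- Row k - 1 repeats row k, so the factors of the numerator are 1 or differences of entries in row
k of the raised tableau. Noncriticality therefore suffices, without any genericity of L. -/
theorem lowerCoeff_ne_zero {R : Tableau n} {k i : ℕ} (hi : 1 ≤ i) (hik : i ≤ k) (hk : k < n)
    (hR : Noncritical (R + delta n k i))
    (h : ∀ j, 1 ≤ j → j + 1 ≤ k → entry R (k - 1) j = entry R k j) :
    lowerCoeff (R + delta n k i) k i ≠ 0 := by
  have hki : 1 ≤ i ∧ i ≤ k ∧ k ≤ n := ⟨hi, hik, hk.le⟩
  have hne : ∀ j, 1 ≤ j → j ≤ k → j ≠ i →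
      entry (R + delta n k i) k i - entry (R + delta n k i) k j ≠ 0 := fun j hj hjk hji h0 =>
    hji (hR.inj hi hik hj hjk hk (sub_eq_zero.1 h0)).symm
  refine div_ne_zero (Finset.prod_ne_zero_iff.2 fun j hj => ?_)
    (Finset.prod_ne_zero_iff.2 fun j hj => ?_)
  · rw [Finset.mem_Icc] at hj
    by_cases hji : j = i
    · subst hji
      rw [entry_add_delta R hki, entry_add_delta R hki, h j hi (by omega), if_pos ⟨rfl, rfl⟩,
        if_neg (by omega)]
      simp
    · have := hne j hj.1 (by omega) hji
      rw [entry_add_delta R hki _ j, if_neg (by omega)] at this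
      rwa [entry_add_delta R hki _ j, if_neg (by omega), h j hj.1 (by omega)]
  · rw [Finset.mem_erase, Finset.mem_Icc] at hj
    exact hne j hj.2.1 hj.2.2 hj.1

/-- The operators of the `E_{k+1,k}` generate the whole space from the top tableau. -/
theorem eq_top_of_lowerOp_stable (hL : IsRealization (hwRelations lam) L)
    (W : Submodule ℂ (TableauSpace (hwRelations lam) L))
    (htop : tab (hwRelations lam) L (topTableau L) ∈ W)
    (hW : ∀ k, 1 ≤ k → k < n → ∀ w ∈ W, lowerOp (hwRelations lam) L lowerCoeff k w ∈ W) :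
    W = ⊤ := by
  classical
  have key : ∀ d, ∀ R ∈ tableaux (hwRelations lam) L, height L R = d → tab (hwRelations lam) L R ∈ W := by
    intro d
    induction d using Nat.strong_induction_on with
    | _ d ih =>
      intro R₀ hR₀ hd
      by_contra hnot
      -- Argue with a functional that vanishes on W but not on T(R₀). It is cut off to height d: by
      -- induction the tableaux of height d - 1 lie in W, so f annihilates their images under the
      -- lowering operators. This is the support condition, with the coefficient of each step
      -- indexed by its lower end.
      obtain ⟨f, hf, hfW⟩ := Submodule.exists_le_ker_of_notMem hnot
      have hR₀top : R₀ = topTableau L := by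
        refine eq_topTableau_of_support (lam := lam)
          (c := fun R k i => lowerCoeff (R + delta n k i) k i)
          (f := fun R => if height L R = d then f (tab (hwRelations lam) L R) else 0) ?_ ?_ hR₀ (by
            simpa only [hd, if_true] using hf)
        · intro k hk hkn S hS
          by_cases hSd : height L S + 1 = d
          · have h1 : f (lowerOp (hwRelations lam) L lowerCoeff k (tab (hwRelations lam) L S)) = 0 :=
              hfW (hW k hk hkn _ (ih (height L S) (by omega) S hS rfl))
            rw [lowerOp_tab, if_pos hS, map_sum] at h1
            refine Eq.trans (Finset.sum_congr rfl fun i hi => ?_) h1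
            rw [Finset.mem_Icc] at hi
            rw [map_smul, smul_eq_mul]
            split_ifs with h2 h3
            · rw [sub_add_cancel]
            · exact absurd (by rw [height_sub_delta hS hi.1 hi.2 hkn h2, hSd]) h3
            · rw [tab_of_notMem _ L h2, map_zero, mul_zero]
          · refine Finset.sum_eq_zero fun i hi => ?_
            rw [Finset.mem_Icc] at hi
            split_ifs with h2 h3
            · rw [height_sub_delta hS hi.1 hi.2 hkn h2] at h3
              exact absurd h3 hSd
            · rw [mul_zero]
            · rfl
        · intro R hR k i hi hik hk hS h
          exact lowerCoeff_ne_zero hi hik hk (hL.2 _ hS) h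
      exact hnot (hR₀top ▸ htop)
  rw [eq_top_iff]
  intro w _
  rw [tableauSpace_eq_sum w]
  exact W.sum_mem fun R _ => W.smul_mem _ (key _ R.1 R.2 rfl)

/-! ### Generic top rows. -/

/-- Indices that are not linked have nonintegral differences in the top row. -/
def Unmerged (lam : Fin n → ℂ) (L : Tableau n) : Prop :=
  ∀ i j, 1 ≤ i → i ≤ n → 1 ≤ j → j ≤ n → (∃ m : ℤ, entry L n i - entry L n j = m) → Linked lam i j

theorem Unmerged.linked (hU : Unmerged lam L) {R : Tableau n}
    (hR : R ∈ tableaux (hwRelations lam) L) {k i l j : ℕ} (hi : 1 ≤ i) (hik : i ≤ k) (hk : k ≤ n)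
    (hj : 1 ≤ j) (hjl : j ≤ l) (hl : l ≤ n) (h : entry R k i = entry R l j) : Linked lam i j := by
  obtain ⟨m, -, hm⟩ := le_top_of_mem hR hi hik hk
  obtain ⟨m', -, hm'⟩ := le_top_of_mem hR hj hjl hl
  refine hU i j hi (by omega) hj (by omega) ⟨m - m', ?_⟩
  push_cast
  rw [← hm, ← hm', h]
  ring

/-- Equal entries in a row can only occur in linked columns, and interlacing orders these strictly
below row n. -/
theorem Unmerged.isRealization (hlam : Standard lam) (hU : Unmerged lam L)
    (hL : Satisfies (hwRelations lam) L) : IsRealization (hwRelations lam) L := by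
  refine ⟨hL, fun R hR k i j hi hij hjk hk h => ?_⟩
  have hI := satisfies_iff_interlaces.1 hR.1
  rcases hlam.precedes_or hi (by omega) (by omega) (by omega) hij.ne
    (hU.linked hR hi (by omega) hk.le (by omega) hjk hk.le h) with h1 | h1
  · exact (hI.mono hk.le hi (by omega) (by omega) (by omega) hjk h1).ne h
  · exact (hI.mono hk.le (by omega) hjk (by omega) hi (by omega) h1).ne h.symm

/-- A vanishing factor r_{ki} - r_{k+1,j} would link i and j. For i ≺ j or j ≺ i interlacing
excludes it, and for j = i the permitted step does. Without genericity an unlinked column could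
produce such a zero; this is why the perturbation is needed. -/
theorem Unmerged.raiseCoeff_ne_zero (hlam : Standard lam) (hU : Unmerged lam L)
    (hL : IsRealization (hwRelations lam) L) {R : Tableau n}
    (hR : R ∈ tableaux (hwRelations lam) L) {k i : ℕ} (hi : 1 ≤ i) (hik : i ≤ k) (hk : k < n)
    (hS : R + delta n k i ∈ tableaux (hwRelations lam) L) : raiseCoeff R k i ≠ 0 := by
  have hki : 1 ≤ i ∧ i ≤ k ∧ k ≤ n := ⟨hi, hik, hk.le⟩
  have hI := satisfies_iff_interlaces.1 hR.1
  have hSI := satisfies_iff_interlaces.1 hS.1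
  refine neg_ne_zero.2 (div_ne_zero (Finset.prod_ne_zero_iff.2 fun j hj => sub_ne_zero.2 fun h => ?_)
    (Finset.prod_ne_zero_iff.2 fun j hj => sub_ne_zero.2 fun h => ?_))
  · rw [Finset.mem_Icc] at hj
    have h1 : IntGt (entry R (k + 1) i) (entry R k i) := by
      have := hSI.up k i hi hik hk
      rw [entry_add_delta R hki, entry_add_delta R hki, if_neg (by omega), if_pos ⟨rfl, rfl⟩,
        add_zero] at this
      exact intGe_add_one.1 this
    by_cases hji : j = i
    · subst hji
      exact h1.ne h.symm
    rcases hlam.precedes_or hi hj.1 (by omega) (by omega) (Ne.symm hji)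
      (hU.linked hR hi hik hk.le hj.1 hj.2 hk h) with h2 | h2
    · exact (hI.down k i j hi hik hk hj.1 hj.2 h2).ne h
    · exact ((hI.mono_ge hk hj.1 hj.2 hi (by omega) h2).trans_gt h1).ne h.symm
  · rw [Finset.mem_erase, Finset.mem_Icc] at hj
    exact hj.1 ((hL.2 R hR).inj hi hik hj.2.1 hj.2.2 hk h).symm

/-- Singular vectors are multiples of the top tableau. -/
theorem Unmerged.eq_smul_of_raiseOp_eq_zero (hlam : Standard lam) (hU : Unmerged lam L)
    (hL : IsRealization (hwRelations lam) L) {w : TableauSpace (hwRelations lam) L}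
    (hw : ∀ k, 1 ≤ k → k < n → raiseOp (hwRelations lam) L k w = 0) :
    w = w ⟨topTableau L, topTableau_mem hL.1⟩ • tab (hwRelations lam) L (topTableau L) := by
  classical
  have key : ∀ S : tableaux (hwRelations lam) L, w S ≠ 0 → S.1 = topTableau L := by
    intro S hS
    refine eq_topTableau_of_support (c := raiseCoeff)
      (f := fun R => if h : R ∈ tableaux (hwRelations lam) L then w ⟨R, h⟩ else 0) ?_ ?_ S.2
      (by simpa only [dif_pos S.2] using hS)
    · intro k hk hkn S hS
      have := raiseOp_apply k w ⟨S, hS⟩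
      rw [hw k hk hkn, Finsupp.zero_apply] at this
      refine Eq.trans (Finset.sum_congr rfl fun i _ => ?_) this.symm
      split_ifs <;> rfl
    · intro R hR k i hi hik hk hS _
      exact hU.raiseCoeff_ne_zero hlam hL hR hi hik hk hS
  ext S
  rw [Finsupp.smul_apply, tab_apply, smul_eq_mul]
  split_ifs with h
  · rw [mul_one]
    congr 1
    exact Subtype.ext h.symm
  · rw [mul_zero]
    by_contra h0
    exact h (key S h0).symm

/-! ## The Serre relations -/

theorem raiseOp_top (hL : Satisfies (hwRelations lam) L) {k : ℕ} (hk : k < n) :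
    raiseOp (hwRelations lam) L k (tab (hwRelations lam) L (topTableau L)) = 0 := by
  classical
  rw [raiseOp_tab, if_pos (topTableau_mem hL)]
  refine Finset.sum_eq_zero fun i hi => ?_
  have hi' := Finset.mem_Icc.1 hi
  have : raiseCoeff (topTableau L) k i = 0 := by
    rw [raiseCoeff, Finset.prod_eq_zero (Finset.mem_Icc.2 ⟨hi'.1, by omega⟩ : i ∈ _), zero_div,
      neg_zero]
    rw [entry_topTableau L hi'.1 hi'.2 hk.le, entry_topTableau L hi'.1 (by omega) hk, sub_self]
  rw [this, zero_smul]

theorem lowerOp_apply_top (hL : Satisfies (hwRelations lam) L) (c : Tableau n → ℕ → ℕ → ℂ) {k : ℕ}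
    (hk : k < n) (w : TableauSpace (hwRelations lam) L) :
    lowerOp (hwRelations lam) L c k w ⟨topTableau L, topTableau_mem hL⟩ = 0 := by
  classical
  rw [lowerOp_apply]
  refine Finset.sum_eq_zero fun i hi => dif_neg fun h => ?_
  rw [Finset.mem_Icc] at hi
  have := le_top_of_mem h hi.1 hi.2 hk.le
  rw [entry_add_delta _ ⟨hi.1, hi.2, hk.le⟩, if_pos ⟨rfl, rfl⟩, entry_topTableau L hi.1 hi.2 hk.le,
    intGe_add_one] at this
  exact IntGt.irrefl _ this

/-- The kernel of θ is stable under the lowering operators and contains the generating vector. -/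
theorem eq_zero_of_lie_lowerOp (hL : IsRealization (hwRelations lam) L)
    {θ : Module.End ℂ (TableauSpace (hwRelations lam) L)}
    (h : ∀ m, 1 ≤ m → m < n → ⁅lowerOp (hwRelations lam) L lowerCoeff m, θ⁆ = 0)
    (htop : θ (tab (hwRelations lam) L (topTableau L)) = 0) : θ = 0 := by
  have : LinearMap.ker θ = ⊤ := by
    refine eq_top_of_lowerOp_stable hL _ htop fun k hk hkn w hw => ?_
    have h1 := LinearMap.congr_fun (h k hk hkn) w
    rw [end_lie_apply, LinearMap.mem_ker.1 hw, map_zero, zero_sub, LinearMap.zero_apply,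
      neg_eq_zero] at h1
    exact h1
  exact LinearMap.ker_eq_top.1 this

/-- The Serre elements commute with the lowering operators by the weak relations alone, and they
kill the top tableau since every raising operator does. No genericity is used. -/
theorem serre_raiseOp (hlam : Standard lam) (hL : IsRealization (hwRelations lam) L) :
    Serre n (raiseOp (hwRelations lam) L) := by
  have hW := weakChevalley hlam hL
  have h3 : ∀ k l, k < n → l < n →
      ⁅raiseOp (hwRelations lam) L k, ⁅raiseOp (hwRelations lam) L k, raiseOp (hwRelations lam) L l⁆⁆
        (tab (hwRelations lam) L (topTableau L)) = 0 := by
    intro k l hk hl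
    simp only [end_lie_apply, raiseOp_top hL.1 hk, raiseOp_top hL.1 hl, map_zero, sub_zero]
  constructor
  · intro k l hk hkl hl
    refine eq_zero_of_lie_lowerOp hL (fun m hm hmn => hW.lie_far hk hkl hl hm hmn) ?_
    simp only [end_lie_apply, raiseOp_top hL.1 (show k < n by omega), raiseOp_top hL.1 hl, map_zero,
      sub_zero]
  · intro k hk hkn
    exact eq_zero_of_lie_lowerOp hL (fun m hm hmn => hW.lie_serre hk (by omega) (by omega) hkn hm hmn
      (.inr rfl)) (h3 k (k + 1) (by omega) hkn)
  · intro k hk hkn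
    exact eq_zero_of_lie_lowerOp hL (fun m hm hmn => hW.lie_serre (by omega) hkn hk (by omega) hm hmn
      (.inl rfl)) (h3 (k + 1) k hkn (by omega))

/-- By induction on the height, θ T(R) is killed by all raising operators: they move past θ and act
on T(R), giving tableaux of smaller height. So θ T(R) is a multiple of the top tableau, with
coefficient zero by assumption. -/
theorem Unmerged.eq_zero_of_lie_raiseOp (hlam : Standard lam) (hU : Unmerged lam L)
    (hL : IsRealization (hwRelations lam) L)
    {θ : Module.End ℂ (TableauSpace (hwRelations lam) L)}
    (h : ∀ m, 1 ≤ m → m < n → ⁅raiseOp (hwRelations lam) L m, θ⁆ = 0)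
    (htop : ∀ w, θ w ⟨topTableau L, topTableau_mem hL.1⟩ = 0) : θ = 0 := by
  classical
  have key : ∀ d, ∀ R ∈ tableaux (hwRelations lam) L, height L R = d →
      θ (tab (hwRelations lam) L R) = 0 := by
    intro d
    induction d using Nat.strong_induction_on with
    | _ d ih =>
      intro R hR hd
      rw [hU.eq_smul_of_raiseOp_eq_zero hlam hL (w := θ (tab (hwRelations lam) L R)), htop,
        zero_smul]
      intro k hk hkn
      have h1 := LinearMap.congr_fun (h k hk hkn) (tab (hwRelations lam) L R)
      rw [end_lie_apply, LinearMap.zero_apply, sub_eq_zero] at h1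
      rw [h1, raiseOp_tab, if_pos hR, map_sum]
      refine Finset.sum_eq_zero fun i hi => ?_
      rw [Finset.mem_Icc] at hi
      rw [map_smul]
      by_cases hS : R + delta n k i ∈ tableaux (hwRelations lam) L
      · have := height_add_delta hR hi.1 hi.2 hkn hS
        rw [ih _ (by omega) _ hS rfl, smul_zero]
      · rw [tab_of_notMem _ _ hS, map_zero, smul_zero]
  exact tableauSpace_hom_ext fun R hR => by rw [key _ R hR rfl, LinearMap.zero_apply]

theorem Unmerged.serre_lowerOp (hlam : Standard lam) (hU : Unmerged lam L)
    (hL : IsRealization (hwRelations lam) L) :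
    Serre n (lowerOp (hwRelations lam) L lowerCoeff) := by
  have hW := weakChevalley hlam hL
  have h3 : ∀ k l, k < n → l < n → ∀ w,
      ⁅lowerOp (hwRelations lam) L lowerCoeff k, ⁅lowerOp (hwRelations lam) L lowerCoeff k,
        lowerOp (hwRelations lam) L lowerCoeff l⁆⁆ w ⟨topTableau L, topTableau_mem hL.1⟩ = 0 := by
    intro k l hk hl w
    simp only [end_lie_apply, Finsupp.sub_apply, lowerOp_apply_top hL.1 _ hk,
      lowerOp_apply_top hL.1 _ hl, sub_zero]
  constructor
  · intro k l hk hkl hl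
    refine hU.eq_zero_of_lie_raiseOp hlam hL (fun m hm hmn => hW.lie_far_lower hk hkl hl hm hmn) fun w => ?_
    simp only [end_lie_apply, Finsupp.sub_apply, lowerOp_apply_top hL.1 _ (show k < n by omega),
      lowerOp_apply_top hL.1 _ hl, sub_zero]
  · intro k hk hkn
    exact hU.eq_zero_of_lie_raiseOp hlam hL (fun m hm hmn => hW.lie_serre_lower hk (by omega) (by omega) hkn hm hmn
      (.inr rfl)) (h3 k (k + 1) (by omega) hkn)
  · intro k hk hkn
    exact hU.eq_zero_of_lie_raiseOp hlam hL (fun m hm hmn => hW.lie_serre_lower (by omega) hkn hk (by omega) hm hmn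
      (.inl rfl)) (h3 (k + 1) k hkn (by omega))

end

end GelfandTsetlin

namespace GelfandTsetlin

noncomputable section

attribute [local instance 100] LieRing.ofAssociativeRing

variable {n : ℕ} {lam : Fin n → ℂ} {L : Tableau n}

/-! ## Perturbation of the top row -/

/-- A number that depends only on the class of `i`, and separates the classes. -/
def classNumber (lam : Fin n → ℂ) (i : ℕ) : ℂ :=
  Complex.exp (2 * Real.pi * Complex.I * shifted lam i)

theorem classNumber_eq_iff {i j : ℕ} : classNumber lam i = classNumber lam j ↔ Linked lam i j := by
  rw [classNumber, classNumber, Complex.exp_eq_exp_iff_exists_int]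
  refine exists_congr fun m => ?_
  have h : (2 * Real.pi * Complex.I : ℂ) ≠ 0 := Complex.two_pi_I_ne_zero
  rw [sub_eq_iff_eq_add]
  constructor
  · intro h1
    apply mul_left_cancel₀ h
    rw [h1]
    ring
  · intro h1
    rw [h1]
    ring

/-- The tableau with the class numbers of the columns as entries. -/
def classTableau (lam : Fin n → ℂ) : Tableau n := fun p => classNumber lam p.col

/-- The perturbed tableau. -/
def perturb (lam : Fin n → ℂ) (t : ℂ) (R : Tableau n) : Tableau n := R + t • classTableau lam

theorem entry_perturb (t : ℂ) (R : Tableau n) {k i : ℕ} (h : 1 ≤ i ∧ i ≤ k ∧ k ≤ n) :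
    entry (perturb lam t R) k i = entry R k i + t * classNumber lam i := by
  rw [perturb, entry_add, entry_apply (t • _) h]
  rfl

theorem perturb_zero (R : Tableau n) : perturb lam 0 R = R := by simp [perturb]

theorem perturb_neg_perturb (t : ℂ) (R : Tableau n) : perturb lam (-t) (perturb lam t R) = R := by
  simp [perturb]

/-- Relations compare only linked columns, and those are shifted by the same amount. -/
theorem Interlaces.perturb {R : Tableau n} (h : Interlaces lam R) (t : ℂ) :
    Interlaces lam (perturb lam t R) := by
  have key : ∀ a b c d : ℂ, c = d → (a + t * c) - (b + t * d) = a - b := by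
    rintro a b c d rfl
    ring
  constructor
  · intro k i hi hik hk
    rw [entry_perturb t R ⟨hi, by omega, hk⟩, entry_perturb t R ⟨hi, hik, hk.le⟩, IntGe,
      key _ _ _ _ rfl]
    exact h.up k i hi hik hk
  · intro k i j hi hik hk hj hjk hij
    rw [entry_perturb t R ⟨hi, hik, hk.le⟩, entry_perturb t R ⟨hj, hjk, hk⟩, IntGt,
      key _ _ _ _ (classNumber_eq_iff.2 hij.linked)]
    exact h.down k i j hi hik hk hj hjk hij
  · intro i j hi hin hj hjn hij
    rw [entry_perturb t R ⟨hi, hin, le_rfl⟩, entry_perturb t R ⟨hj, hjn, le_rfl⟩, IntGe,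
      key _ _ _ _ (classNumber_eq_iff.2 hij.linked)]
    exact h.top i j hi hin hj hjn hij

theorem perturb_mem {R : Tableau n} (hR : R ∈ tableaux (hwRelations lam) L) (t : ℂ) :
    perturb lam t R ∈ tableaux (hwRelations lam) (perturb lam t L) := by
  refine ⟨satisfies_iff_interlaces.2 ((satisfies_iff_interlaces.1 hR.1).perturb t), ?_⟩
  obtain ⟨z, hz, hRz⟩ := hR.2
  refine ⟨z, hz, fun p => ?_⟩
  simp only [perturb, Pi.add_apply, hRz p]
  ring

theorem perturb_mem_iff {R : Tableau n} (t : ℂ) :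
    perturb lam t R ∈ tableaux (hwRelations lam) (perturb lam t L) ↔
      R ∈ tableaux (hwRelations lam) L := by
  refine ⟨fun h => ?_, fun h => perturb_mem h t⟩
  have := perturb_mem h (-t)
  rwa [perturb_neg_perturb, perturb_neg_perturb] at this

/-- Each unlinked pair and each integer exclude a single t, so the exceptional set is countable. -/
theorem dense_unmerged (lam : Fin n → ℂ) (L : Tableau n) :
    Dense {t : ℂ | Unmerged lam (perturb lam t L)} := by
  have hc : (⋃ (i : ℕ) (j : ℕ), Set.range fun m : ℤ =>
      ((m : ℂ) - (entry L n i - entry L n j)) / (classNumber lam i - classNumber lam j)).Countable :=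
    Set.countable_iUnion fun i => Set.countable_iUnion fun j => Set.countable_range _
  refine (hc.dense_compl ℂ).mono fun t ht => ?_
  intro i j hi hin hj hjn
  rintro ⟨m, hm⟩
  by_contra hij
  refine ht (Set.mem_iUnion.2 ⟨i, Set.mem_iUnion.2 ⟨j, m, ?_⟩⟩)
  have h0 : classNumber lam i - classNumber lam j ≠ 0 :=
    sub_ne_zero.2 fun h => hij (classNumber_eq_iff.1 h)
  rw [entry_perturb t L ⟨hi, hin, le_rfl⟩, entry_perturb t L ⟨hj, hjn, le_rfl⟩] at hm
  simp only
  rw [div_eq_iff h0, ← hm]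
  ring

/-- The coefficients of `E_{k+1,k}` for the perturbed tableaux. -/
def perturbedCoeff (lam : Fin n → ℂ) (t : ℂ) (R : Tableau n) : ℕ → ℕ → ℂ :=
  lowerCoeff (perturb lam t R)

/-- The identification of the tableau space with that of the perturbed tableau. -/
def perturbMap (lam : Fin n → ℂ) (L : Tableau n) (t : ℂ) :
    TableauSpace (hwRelations lam) L →ₗ[ℂ] TableauSpace (hwRelations lam) (perturb lam t L) :=
  Finsupp.lmapDomain ℂ ℂ fun R => ⟨perturb lam t R.1, perturb_mem R.2 t⟩

theorem perturbMap_injective (t : ℂ) : Function.Injective (perturbMap lam L t) := by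
  refine Finsupp.mapDomain_injective fun R S h => Subtype.ext ?_
  have := congrArg (fun R => perturb lam (-t) R.1) h
  simpa only [perturb_neg_perturb] using this

theorem perturbMap_tab (t : ℂ) (R : Tableau n) :
    perturbMap lam L t (tab (hwRelations lam) L R) =
      tab (hwRelations lam) (perturb lam t L) (perturb lam t R) := by
  by_cases hR : R ∈ tableaux (hwRelations lam) L
  · rw [tab_of_mem _ _ hR, tab_of_mem _ _ (perturb_mem hR t), perturbMap, Finsupp.lmapDomain_apply,
      Finsupp.mapDomain_single]
  · rw [tab_of_notMem _ _ hR, tab_of_notMem _ _ fun h => hR ((perturb_mem_iff t).1 h), map_zero]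

theorem perturbMap_lowerOp (t : ℂ) (k : ℕ) (w : TableauSpace (hwRelations lam) L) :
    perturbMap lam L t (lowerOp (hwRelations lam) L (perturbedCoeff lam t) k w) =
      lowerOp (hwRelations lam) (perturb lam t L) lowerCoeff k (perturbMap lam L t w) := by
  classical
  have : perturbMap lam L t ∘ₗ lowerOp (hwRelations lam) L (perturbedCoeff lam t) k =
      lowerOp (hwRelations lam) (perturb lam t L) lowerCoeff k ∘ₗ perturbMap lam L t := by
    refine tableauSpace_hom_ext fun R hR => ?_
    rw [LinearMap.comp_apply, LinearMap.comp_apply, perturbMap_tab, lowerOp_tab, lowerOp_tab,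
      if_pos hR, if_pos (perturb_mem hR t), map_sum]
    refine Finset.sum_congr rfl fun i _ => ?_
    rw [map_smul, perturbMap_tab, perturbedCoeff]
    congr 2
    simp only [perturb]
    abel
  exact LinearMap.congr_fun this w

/-- The generic case, pulled back along the injective identification with the perturbed tableau
space. All perturbed operators now live on one space, where t can vary. -/
theorem serre_perturbed (hlam : Standard lam) (hL : Satisfies (hwRelations lam) L) {t : ℂ}
    (ht : Unmerged lam (perturb lam t L)) :
    Serre n (lowerOp (hwRelations lam) L (perturbedCoeff lam t)) := by
  have hL' : Satisfies (hwRelations lam) (perturb lam t L) :=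
    satisfies_iff_interlaces.2 ((satisfies_iff_interlaces.1 hL).perturb t)
  have hS := ht.serre_lowerOp hlam (ht.isRealization hlam hL')
  have key : ∀ {θ : Module.End ℂ (TableauSpace (hwRelations lam) L)}
      {θ' : Module.End ℂ (TableauSpace (hwRelations lam) (perturb lam t L))}, θ' = 0 →
      (∀ w, perturbMap lam L t (θ w) = θ' (perturbMap lam L t w)) → θ = 0 := by
    rintro θ θ' rfl h
    refine LinearMap.ext fun w => perturbMap_injective t ?_
    rw [h, LinearMap.zero_apply, LinearMap.zero_apply, map_zero]
  constructor
  · intro k l h1 h2 h3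
    refine key (hS.far k l h1 h2 h3) fun w => ?_
    simp only [end_lie_apply, map_sub, perturbMap_lowerOp]
  · intro k h1 h2
    refine key (hS.up k h1 h2) fun w => ?_
    simp only [end_lie_apply, map_sub, perturbMap_lowerOp]
  · intro k h1 h2
    refine key (hS.down k h1 h2) fun w => ?_
    simp only [end_lie_apply, map_sub, perturbMap_lowerOp]

/-! ### Continuity in the perturbation parameter. -/

/-- A family of operators is coordinatewise continuous at `0`. -/
def CoordContinuous {ι : Type*} (T : ℂ → Module.End ℂ (ι →₀ ℂ)) : Prop :=
  ∀ w : ℂ → ι →₀ ℂ, (∀ S, ContinuousAt (fun t => w t S) 0) →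
    ∀ S, ContinuousAt (fun t => T t (w t) S) 0

/-- Composites cause no trouble because the condition is tested on continuous families of vectors
rather than on fixed vectors. -/
theorem CoordContinuous.lie {ι : Type*} {T T' : ℂ → Module.End ℂ (ι →₀ ℂ)}
    (h : CoordContinuous T) (h' : CoordContinuous T') : CoordContinuous fun t => ⁅T t, T' t⁆ := by
  intro w hw S
  simp only [end_lie_apply, Finsupp.sub_apply]
  exact (h _ (h' w hw) S).sub (h' _ (h w hw) S)

theorem CoordContinuous.eq_zero {ι : Type*} {T : ℂ → Module.End ℂ (ι →₀ ℂ)}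
    (h : CoordContinuous T) {D : Set ℂ} (hD : Dense D) (hT : ∀ t ∈ D, T t = 0) : T 0 = 0 := by
  ext R S
  by_contra hne
  have hc := h (fun _ => Finsupp.single R 1) (fun _ => continuousAt_const) S
  obtain ⟨t, htD, ht⟩ := hD.inter_nhds_nonempty (hc.eventually_ne hne)
  exact ht (by simp [hT t htD])

theorem continuous_entry_perturb (R : Tableau n) (k i : ℕ) :
    Continuous fun t => entry (perturb lam t R) k i := by
  by_cases h : 1 ≤ i ∧ i ≤ k ∧ k ≤ n
  · simp only [entry_perturb _ R h]
    fun_prop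
  · simp only [entry, dif_neg h]
    fun_prop

/-- A coordinate of the image is a finite sum over the k possible predecessors, and the denominators
do not vanish at t = 0 because T(L) is a realization. -/
theorem coordContinuous_lowerOp (hL : IsRealization (hwRelations lam) L) {k : ℕ} (hk : k < n) :
    CoordContinuous fun t => lowerOp (hwRelations lam) L (perturbedCoeff lam t) k := by
  intro w hw S
  simp only [lowerOp_apply]
  refine tendsto_finsetSum _ fun i hi => ?_
  rw [Finset.mem_Icc] at hi
  split_ifs with h
  · refine ContinuousAt.mul ?_ (hw _)
    refine ContinuousAt.div ?_ ?_ ?_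
    · exact (continuous_finsetProd _ fun j _ =>
        (continuous_entry_perturb _ _ _).sub (continuous_entry_perturb _ _ _)).continuousAt
    · exact (continuous_finsetProd _ fun j _ =>
        (continuous_entry_perturb _ _ _).sub (continuous_entry_perturb _ _ _)).continuousAt
    · rw [perturb_zero]
      refine Finset.prod_ne_zero_iff.2 fun j hj => sub_ne_zero.2 fun h0 => ?_
      rw [Finset.mem_erase, Finset.mem_Icc] at hj
      exact hj.1 ((hL.2 _ h).inj hi.1 hi.2 hj.2.1 hj.2.2 hk h0).symm
  · exact tendsto_const_nhds

/-- The Serre elements of the perturbed operators are continuous at t = 0 in each coordinate and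
vanish for a dense set of t. -/
theorem serre_lowerOp (hlam : Standard lam) (hL : IsRealization (hwRelations lam) L) :
    Serre n (lowerOp (hwRelations lam) L lowerCoeff) := by
  have hD := dense_unmerged lam L
  have h0 : perturbedCoeff lam 0 = lowerCoeff := by
    funext R
    rw [perturbedCoeff, perturb_zero]
  have hc : ∀ k, k < n → CoordContinuous fun t =>
      lowerOp (hwRelations lam) L (perturbedCoeff lam t) k := fun k hk =>
    coordContinuous_lowerOp hL hk
  rw [← h0]
  constructor
  · intro k l h1 h2 h3
    exact ((hc k (by omega)).lie (hc l h3)).eq_zero hD fun t ht =>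
      (serre_perturbed hlam hL.1 ht).far k l h1 h2 h3
  · intro k h1 h2
    exact ((hc k (by omega)).lie ((hc k (by omega)).lie (hc (k + 1) h2))).eq_zero hD fun t ht =>
      (serre_perturbed hlam hL.1 ht).up k h1 h2
  · intro k h1 h2
    exact ((hc (k + 1) h2).lie ((hc (k + 1) h2).lie (hc k (by omega)))).eq_zero hD fun t ht =>
      (serre_perturbed hlam hL.1 ht).down k h1 h2

/-! ## Admissibility -/

/-- The Gelfand–Tsetlin formulas define a representation. -/
theorem exists_representation (hlam : Standard lam) (hL : IsRealization (hwRelations lam) L) :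
    ∃ ρ : gl n →ₗ⁅ℂ⁆ Module.End ℂ (TableauSpace (hwRelations lam) L),
      (∀ k, 1 ≤ k → k < n → ρ (E n k (k + 1)) = raiseOp (hwRelations lam) L k) ∧
      (∀ k, 1 ≤ k → k < n → ρ (E n (k + 1) k) = lowerOp (hwRelations lam) L lowerCoeff k) ∧
      (∀ k, 1 ≤ k → k ≤ n → ρ (E n k k) = weightOp (hwRelations lam) L k) :=
  exists_lieHom_of_chevalley (weakChevalley hlam hL) (serre_raiseOp hlam hL)
    (serre_lowerOp hlam hL)

theorem isGTAction_of_eq {C : Set (Rel n)} {ρ : gl n →ₗ⁅ℂ⁆ Module.End ℂ (TableauSpace C L)}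
    (hX : ∀ k, 1 ≤ k → k < n → ρ (E n k (k + 1)) = raiseOp C L k)
    (hY : ∀ k, 1 ≤ k → k < n → ρ (E n (k + 1) k) = lowerOp C L lowerCoeff k)
    (hH : ∀ k, 1 ≤ k → k ≤ n → ρ (E n k k) = weightOp C L k) : IsGTAction C L ρ := by
  intro R hR
  refine ⟨fun k h1 h2 => ?_, fun k h1 h2 => ?_, fun k h1 h2 => ?_⟩
  · rw [hX k h1 h2, raiseOp_tab, if_pos hR]
  · rw [hY k h1 h2, lowerOp_tab, if_pos hR]
  · rw [hH k h1 h2, weightOp_tab]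

theorem isAdmissible_hwRelations (hlam : Standard lam) : IsAdmissible (hwRelations lam) := by
  refine ⟨?_, fun L hL => ?_⟩
  · rintro r ((⟨p, q, h1, h2, rfl⟩ | ⟨p, q, h1, h2, rfl⟩) | ⟨p, q, h1, h2, h3, rfl⟩)
    · exact .inl ⟨p, q, h1, .inl rfl⟩
    · exact .inl ⟨q, p, h1, .inr rfl⟩
    · refine .inr ⟨p, q, h1, h2, ?_, rfl⟩
      rintro rfl
      exact Precedes.irrefl _ h3.1
  · obtain ⟨ρ, h1, h2, h3⟩ := exists_representation hlam hL
    exact ⟨ρ, isGTAction_of_eq h1 h2 h3⟩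

theorem entry_hwTableau {k i : ℕ} (hi : 1 ≤ i) (hik : i ≤ k) (hk : k ≤ n) :
    entry (hwTableau lam) k i = shifted lam i := entry_apply _ ⟨hi, hik, hk⟩

theorem unmerged_hwTableau : Unmerged lam (hwTableau lam) := by
  intro i j hi hin hj hjn h
  rwa [entry_hwTableau hi hin le_rfl, entry_hwTableau hj hjn le_rfl] at h

theorem isRealization_hwTableau (hlam : Standard lam) :
    IsRealization (hwRelations lam) (hwTableau lam) := by
  refine unmerged_hwTableau.isRealization hlam (satisfies_iff_interlaces.2
    ⟨fun k i hi hik hk => ?_, fun k i j hi hik hk hj hjk hij => ?_, fun i j hi hin hj hjn hij => ?_⟩)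
  · rw [entry_hwTableau hi (by omega) hk, entry_hwTableau hi hik hk.le]
    exact IntGe.refl _
  · rw [entry_hwTableau hi hik hk.le, entry_hwTableau hj hjk hk]
    rcases hij with h | ⟨rfl, -, -⟩
    · exact h
    · omega
  · rw [entry_hwTableau hi hin le_rfl, entry_hwTableau hj hjn le_rfl]
    rcases hij with h | ⟨-, -, h⟩
    · exact IntGt.ge h
    · exact h ▸ IntGe.refl _

theorem topTableau_hwTableau : topTableau (hwTableau lam) = hwTableau lam := by
  refine tableau_ext fun k i hi hik hk => ?_
  rw [entry_topTableau _ hi hik hk, entry_hwTableau hi hik hk, entry_hwTableau hi (by omega) le_rfl]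

end

end GelfandTsetlin

namespace GelfandTsetlin

noncomputable section

attribute [local instance 100] LieRing.ofAssociativeRing

open Polynomial

variable {n : ℕ}

/-! ## Verma modules -/

theorem e_mul_e (i j k l : ℕ) (hj : 1 ≤ j) (hjn : j ≤ n) (hl : 1 ≤ l) (hln : l ≤ n) :
    e n i j * e n k l = e n k l * e n i j +
      ((if j = k then e n i l else 0) - (if l = i then e n k j else 0)) := by
  have h : e n i j * e n k l - e n k l * e n i j =
      UniversalEnvelopingAlgebra.ι ℂ ⁅E n i j, E n k l⁆ := by
    rw [LieHom.map_lie, Ring.lie_def]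
    rfl
  rw [lie_E_E hj hjn hl hln, map_sub, apply_ite (UniversalEnvelopingAlgebra.ι ℂ),
    apply_ite (UniversalEnvelopingAlgebra.ι ℂ), map_zero] at h
  exact sub_eq_iff_eq_add'.1 h

/-- A product of the `E_{k+1,k}`. -/
def lowerMonomial (n : ℕ) (l : List ℕ) : U n := (l.map fun k => e n (k + 1) k).prod

theorem lowerMonomial_cons (k : ℕ) (l : List ℕ) :
    lowerMonomial n (k :: l) = e n (k + 1) k * lowerMonomial n l := by
  simp [lowerMonomial]

/-- An eigenvector of the adjoint action on the `E_{k+1,k}` acts by scalars on monomials. -/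
theorem mul_lowerMonomial_mem {J : Submodule (U n) (U n)} {x : U n} {c : ℂ} {s : ℕ → ℂ}
    (hx : x - algebraMap ℂ (U n) c ∈ J)
    (hs : ∀ k, 1 ≤ k → k < n → x * e n (k + 1) k = e n (k + 1) k * x + s k • e n (k + 1) k)
    (l : List ℕ) (hl : ∀ k ∈ l, 1 ≤ k ∧ k < n) :
    x * lowerMonomial n l - (c + (l.map s).sum) • lowerMonomial n l ∈ J := by
  induction l with
  | nil => simpa [lowerMonomial, Algebra.algebraMap_eq_smul_one] using hx
  | cons k l ih =>
    have hk := hl k (by simp)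
    have := J.smul_mem (e n (k + 1) k) (ih fun j hj => hl j (by simp [hj]))
    rw [lowerMonomial_cons, ← mul_assoc, hs k hk.1 hk.2, add_mul, List.map_cons, List.sum_cons]
    convert this using 1
    rw [smul_eq_mul, mul_sub, mul_smul_comm, smul_mul_assoc, mul_assoc]
    module

variable (lam : Fin n → ℂ)

/-- The span of the monomials in the `E_{k+1,k}` and the Verma ideal. -/
def monomialSpan : Submodule ℂ (U n) :=
  Submodule.span ℂ {x | ∃ l : List ℕ, (∀ k ∈ l, 1 ≤ k ∧ k < n) ∧ x = lowerMonomial n l} ⊔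
    (vermaIdeal lam).restrictScalars ℂ

variable {lam}

theorem lowerMonomial_mem {l : List ℕ} (hl : ∀ k ∈ l, 1 ≤ k ∧ k < n) :
    lowerMonomial n l ∈ monomialSpan lam :=
  Submodule.mem_sup_left (Submodule.subset_span ⟨l, hl, rfl⟩)

theorem mem_monomialSpan_of_mem {x : U n} (hx : x ∈ vermaIdeal lam) : x ∈ monomialSpan lam :=
  Submodule.mem_sup_right hx

theorem mul_mem_monomialSpan {x : U n}
    (hx : ∀ l : List ℕ, (∀ k ∈ l, 1 ≤ k ∧ k < n) → x * lowerMonomial n l ∈ monomialSpan lam)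
    {z : U n} (hz : z ∈ monomialSpan lam) : x * z ∈ monomialSpan lam := by
  obtain ⟨s, hs, j, hj, rfl⟩ := Submodule.mem_sup.1 hz
  rw [mul_add]
  refine add_mem ?_ (mem_monomialSpan_of_mem ((vermaIdeal lam).smul_mem x hj))
  refine (Submodule.span_le (p := (monomialSpan lam).comap (LinearMap.mulLeft ℂ x))).2 ?_ hs
  rintro _ ⟨l, hl, rfl⟩
  exact hx l hl

theorem lower_mul_mem {k : ℕ} (hk : 1 ≤ k) (hkn : k < n) {z : U n} (hz : z ∈ monomialSpan lam) :
    e n (k + 1) k * z ∈ monomialSpan lam := by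
  refine mul_mem_monomialSpan (fun l hl => ?_) hz
  rw [← lowerMonomial_cons]
  refine lowerMonomial_mem fun j hj => ?_
  rcases List.mem_cons.1 hj with rfl | hj
  · exact ⟨hk, hkn⟩
  · exact hl j hj

theorem cartan_sub_mem {k : ℕ} (hk : 1 ≤ k) (hkn : k ≤ n) :
    e n k k - algebraMap ℂ (U n) (lam ⟨k - 1, by omega⟩) ∈ vermaIdeal lam := by
  refine Submodule.subset_span (.inr ⟨⟨k - 1, by omega⟩, ?_⟩)
  simp only [show k - 1 + 1 = k by omega]

theorem cartan_mul_lower {k j : ℕ} (hk : 1 ≤ k) (hkn : k ≤ n) (hj : 1 ≤ j) (hjn : j < n) :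
    e n k k * e n (j + 1) j = e n (j + 1) j * e n k k + (-rootWeight k j) • e n (j + 1) j := by
  rw [e_mul_e k k (j + 1) j hk hkn hj hjn.le, rootWeight]
  congr 1
  by_cases h1 : k = j + 1
  · subst h1
    simp
  · by_cases h2 : k = j
    · subst h2
      simp
    · simp [h1, h2, Ne.symm h2]

theorem cartan_mul_mem {k : ℕ} (hk : 1 ≤ k) (hkn : k ≤ n) {z : U n} (hz : z ∈ monomialSpan lam) :
    e n k k * z ∈ monomialSpan lam := by
  refine mul_mem_monomialSpan (fun l hl => ?_) hz
  have h := mul_lowerMonomial_mem (cartan_sub_mem (lam := lam) hk hkn)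
    (fun j hj hjn => cartan_mul_lower hk hkn hj hjn) l hl
  exact ((monomialSpan lam).sub_mem_iff_left
    ((monomialSpan lam).smul_mem _ (lowerMonomial_mem hl))).1 (mem_monomialSpan_of_mem h)

theorem raise_mul_mem {k : ℕ} (hk : 1 ≤ k) (hkn : k < n) {z : U n} (hz : z ∈ monomialSpan lam) :
    e n k (k + 1) * z ∈ monomialSpan lam := by
  refine mul_mem_monomialSpan (fun l hl => ?_) hz
  induction l with
  | nil =>
    have : e n k (k + 1) ∈ vermaIdeal lam :=
      Submodule.subset_span (.inl ⟨k, k + 1, hk, by omega, hkn, rfl⟩)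
    simpa [lowerMonomial] using mem_monomialSpan_of_mem this
  | cons j l ih =>
    have hj := hl j (by simp)
    have hl' : ∀ k ∈ l, 1 ≤ k ∧ k < n := fun i hi => hl i (by simp [hi])
    rw [lowerMonomial_cons, ← mul_assoc, e_mul_e k (k + 1) (j + 1) j (by omega) hkn hj.1 hj.2.le,
      add_mul, mul_assoc]
    refine add_mem (lower_mul_mem hj.1 hj.2 (ih hl')) ?_
    by_cases h : j = k
    · subst h
      rw [if_pos rfl, if_pos rfl, sub_mul]
      exact sub_mem (cartan_mul_mem hk hkn.le (lowerMonomial_mem hl'))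
        (cartan_mul_mem (by omega) hkn (lowerMonomial_mem hl'))
    · rw [if_neg (by omega), if_neg h, sub_zero, zero_mul]
      exact zero_mem _

/-- A subalgebra of the enveloping algebra that contains the Chevalley generators is everything. -/
theorem subalgebra_eq_top (A : Subalgebra ℂ (U n))
    (hX : ∀ k, 1 ≤ k → k < n → e n k (k + 1) ∈ A) (hY : ∀ k, 1 ≤ k → k < n → e n (k + 1) k ∈ A)
    (hH : ∀ k, 1 ≤ k → k ≤ n → e n k k ∈ A) (x : U n) : x ∈ A := by
  let K : LieSubalgebra ℂ (gl n) :=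
    { carrier := {g | UniversalEnvelopingAlgebra.ι ℂ g ∈ A}
      add_mem' := fun {a b} ha hb => by
        rw [Set.mem_ofPred_eq, map_add]
        exact add_mem ha hb
      zero_mem' := by
        rw [Set.mem_ofPred_eq, map_zero]
        exact zero_mem _
      smul_mem' := fun c g hg => by
        rw [Set.mem_ofPred_eq, map_smul]
        exact A.smul_mem hg c
      lie_mem' := fun {a b} ha hb => by
        change UniversalEnvelopingAlgebra.ι ℂ ⁅a, b⁆ ∈ A
        rw [LieHom.map_lie, Ring.lie_def]
        exact sub_mem (mul_mem ha hb) (mul_mem hb ha) }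
  have hK : ∀ g : gl n, UniversalEnvelopingAlgebra.ι ℂ g ∈ A := lieSubalgebra_eq_top K hX hY hH
  let f : gl n →ₗ⁅ℂ⁆ A :=
    { toFun := fun g => ⟨UniversalEnvelopingAlgebra.ι ℂ g, hK g⟩
      map_add' := fun a b => Subtype.ext (map_add _ a b)
      map_smul' := fun c a => Subtype.ext (map_smul _ c a)
      map_lie' := fun {a b} => Subtype.ext (by
        change UniversalEnvelopingAlgebra.ι ℂ ⁅a, b⁆ = _
        rw [LieHom.map_lie, Ring.lie_def]
        rfl) }
  have h : A.val.comp (UniversalEnvelopingAlgebra.lift ℂ f) = AlgHom.id ℂ (U n) := by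
    apply UniversalEnvelopingAlgebra.hom_ext
    ext g
    simp [f]
  have := DFunLike.congr_fun h x
  rw [AlgHom.id_apply] at this
  rw [← this]
  exact (UniversalEnvelopingAlgebra.lift ℂ f x).2

/-- The elements that preserve the span under left multiplication form a subalgebra containing the
generators; apply it to 1. Only this spanning property of Verma modules is needed, not the
independence in the PBW theorem. -/
theorem monomialSpan_eq_top (z : U n) : z ∈ monomialSpan lam := by
  let A : Subalgebra ℂ (U n) :=
    { carrier := {x | ∀ s ∈ monomialSpan lam, x * s ∈ monomialSpan lam}
      mul_mem' := fun {a b} ha hb s hs => by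
        rw [mul_assoc]
        exact ha _ (hb s hs)
      add_mem' := fun {a b} ha hb s hs => by
        rw [add_mul]
        exact add_mem (ha s hs) (hb s hs)
      algebraMap_mem' := fun c s hs => by
        rw [← Algebra.smul_def]
        exact (monomialSpan lam).smul_mem c hs }
  have hA : z ∈ A := subalgebra_eq_top A (fun k h1 h2 _ hs => raise_mul_mem h1 h2 hs)
    (fun k h1 h2 _ hs => lower_mul_mem h1 h2 hs) (fun k h1 h2 _ hs => cartan_mul_mem h1 h2 hs) z
  have h1 : lowerMonomial n [] ∈ monomialSpan lam := lowerMonomial_mem (by simp)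
  have := hA _ h1
  simpa [lowerMonomial] using this

variable (n) in
/-- The grading element `-∑ k E_{kk}`. -/
def gradingElement : U n := ∑ k ∈ Finset.Icc 1 n, (-(k : ℂ)) • e n k k

theorem gradingElement_mul_lower {j : ℕ} (hj : 1 ≤ j) (hjn : j < n) :
    gradingElement n * e n (j + 1) j = e n (j + 1) j * gradingElement n + (-1 : ℂ) • e n (j + 1) j := by
  unfold gradingElement
  have h : ∀ k ∈ Finset.Icc 1 n, ((-(k : ℂ)) • e n k k) * e n (j + 1) j =
      e n (j + 1) j * ((-(k : ℂ)) • e n k k) + ((k : ℂ) * rootWeight k j) • e n (j + 1) j := by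
    intro k hk
    rw [Finset.mem_Icc] at hk
    rw [smul_mul_assoc, cartan_mul_lower hk.1 hk.2 hj hjn, mul_smul_comm]
    module
  rw [Finset.sum_mul, Finset.sum_congr rfl h, Finset.sum_add_distrib, Finset.mul_sum,
    ← Finset.sum_smul]
  congr 2
  simp only [rootWeight, mul_sub, mul_ite, mul_one, mul_zero, Finset.sum_sub_distrib]
  rw [Finset.sum_ite_eq' _ j, Finset.sum_ite_eq' _ (j + 1), if_pos (by simp; omega),
    if_pos (by simp; omega)]
  push_cast
  ring

theorem exists_gradingElement_sub_mem (lam : Fin n → ℂ) :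
    ∃ c : ℂ, gradingElement n - algebraMap ℂ (U n) c ∈ vermaIdeal lam := by
  have h : ∀ k, ∃ c : ℂ, k ∈ Finset.Icc 1 n →
      (-(k : ℂ)) • e n k k - algebraMap ℂ (U n) c ∈ vermaIdeal lam := by
    intro k
    by_cases hk : k ∈ Finset.Icc 1 n
    · have hk' := Finset.mem_Icc.1 hk
      refine ⟨-(k : ℂ) * lam ⟨k - 1, by omega⟩, fun _ => ?_⟩
      have := (vermaIdeal lam).smul_mem (algebraMap ℂ (U n) (-(k : ℂ)))
        (cartan_sub_mem (lam := lam) hk'.1 hk'.2)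
      rwa [smul_eq_mul, mul_sub, ← map_mul, ← Algebra.smul_def] at this
    · exact ⟨0, fun h => absurd h hk⟩
  choose c hc using h
  refine ⟨∑ k ∈ Finset.Icc 1 n, c k, ?_⟩
  rw [gradingElement, map_sum, ← Finset.sum_sub_distrib]
  exact sum_mem fun k hk => hc k hk

/-- Every element of a Verma module is a multiple of the highest weight vector plus a sum of
vectors of lower degree. -/
theorem exists_polynomial_mul_mem {c₀ : ℂ}
    (hc₀ : gradingElement n - algebraMap ℂ (U n) c₀ ∈ vermaIdeal lam) (z : U n) :
    ∃ (c : ℂ) (p : ℂ[X]), p.eval c₀ ≠ 0 ∧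
      aeval (gradingElement n) p * (z - algebraMap ℂ (U n) c) ∈ vermaIdeal lam := by
  obtain ⟨s, hs, j, hj, rfl⟩ := Submodule.mem_sup.1 (monomialSpan_eq_top (lam := lam) z)
  suffices h : ∃ (c : ℂ) (p : ℂ[X]), p.eval c₀ ≠ 0 ∧
      aeval (gradingElement n) p * (s - algebraMap ℂ (U n) c) ∈ vermaIdeal lam by
    obtain ⟨c, p, hp, h⟩ := h
    refine ⟨c, p, hp, ?_⟩
    rw [add_sub_right_comm, mul_add]
    exact add_mem h ((vermaIdeal lam).smul_mem _ hj)
  induction hs using Submodule.span_induction with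
  | mem x hx =>
    obtain ⟨l, hl, rfl⟩ := hx
    rcases l with _ | ⟨k, l⟩
    · refine ⟨1, 1, by simp, ?_⟩
      simp [lowerMonomial]
    · have h := mul_lowerMonomial_mem hc₀ (s := fun _ => (-1 : ℂ))
        (fun j hj hjn => gradingElement_mul_lower hj hjn) (k :: l) hl
      -- A monomial of length m has degree c₀ - m, so X - (c₀ - m) annihilates it modulo the ideal,
      -- while its value m at c₀ is nonzero.
      refine ⟨0, X - C (c₀ + ((k :: l).map fun _ => (-1 : ℂ)).sum), ?_, ?_⟩
      · simp only [List.map_const', List.sum_replicate, eval_sub, eval_X, eval_C, List.length_cons,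
          nsmul_eq_mul]
        push_cast
        have : ((l.length : ℂ) + 1) ≠ 0 := Nat.cast_add_one_ne_zero l.length
        intro h0
        apply this
        linear_combination h0
      · rw [map_zero, sub_zero, map_sub, aeval_X, aeval_C, sub_mul, ← Algebra.smul_def]
        exact h
  | zero => exact ⟨0, 1, by simp, by simp⟩
  | add x y _ _ hx hy =>
    obtain ⟨c, p, hp, h⟩ := hx
    obtain ⟨c', p', hp', h'⟩ := hy
    refine ⟨c + c', p * p', by simp [hp, hp'], ?_⟩
    have h1 := (vermaIdeal lam).smul_mem (aeval (gradingElement n) p') h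
    have h2 := (vermaIdeal lam).smul_mem (aeval (gradingElement n) p) h'
    rw [smul_eq_mul, ← mul_assoc, ← map_mul] at h1 h2
    rw [mul_comm p' p] at h1
    have := add_mem h1 h2
    rw [← mul_add] at this
    convert this using 2
    rw [map_add]
    abel
  | smul a x _ hx =>
    obtain ⟨c, p, hp, h⟩ := hx
    refine ⟨a * c, p, hp, ?_⟩
    have := (vermaIdeal lam).smul_mem (algebraMap ℂ (U n) a) h
    rw [smul_eq_mul, ← Algebra.smul_def, ← mul_smul_comm] at this
    convert this using 2
    rw [smul_sub, map_mul, Algebra.smul_def a (algebraMap ℂ (U n) c)]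

theorem aeval_sub_eval_mem {J : Submodule (U n) (U n)} {x : U n} {c : ℂ}
    (h : x - algebraMap ℂ (U n) c ∈ J) (p : ℂ[X]) :
    aeval x p - algebraMap ℂ (U n) (p.eval c) ∈ J := by
  obtain ⟨q, hq⟩ := X_sub_C_dvd_sub_C_eval (a := c) (p := p)
  have h1 := congrArg (aeval x) hq
  rw [map_sub, aeval_C, mul_comm, map_mul, map_sub, aeval_X, aeval_C] at h1
  rw [h1]
  exact J.smul_mem _ h

/-! ### Recognition of L(λ). -/

/-- The kernel of the map from the enveloping algebra onto an irreducible highest weight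
module. -/
theorem mem_maxIdeal_iff {V : Type*} [AddCommGroup V] [Module ℂ V]
    (Φ : U n →ₐ[ℂ] Module.End ℂ V) {v : V} (hv : v ≠ 0)
    (hJ : ∀ x ∈ vermaIdeal lam, Φ x v = 0) (hirr : ∀ w : V, w ≠ 0 → ∃ y, Φ y w = v) (x : U n) :
    x ∈ maxIdeal lam ↔ Φ x v = 0 := by
  let A : Submodule (U n) (U n) :=
    { carrier := {x | Φ x v = 0}
      add_mem' := fun {a b} ha hb => by
        rw [Set.mem_ofPred_eq] at *
        rw [map_add, LinearMap.add_apply, ha, hb, add_zero]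
      zero_mem' := by simp
      smul_mem' := fun c a ha => by
        rw [Set.mem_ofPred_eq] at *
        rw [smul_eq_mul, map_mul, Module.End.mul_apply, ha, map_zero] }
  constructor
  · have hle : maxIdeal lam ≤ A := by
      refine sSup_le ?_
      rintro I ⟨hJI, hI⟩ x hx
      by_contra hxv
      obtain ⟨y, hy⟩ := hirr _ hxv
      have hz : y * x ∈ I := I.smul_mem y hx
      have hzv : Φ (y * x) v = v := by rw [map_mul, Module.End.mul_apply, hy]
      -- Now z = y x lies in I and fixes v. A polynomial p in the grading element satisfies p z ≡ c
      -- p modulo the Verma ideal; evaluating at v gives c = 1, so p lies in I. Since p ≡ p(c₀) ≠ 0,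
      -- the ideal I contains 1.
      obtain ⟨c₀, hc₀⟩ := exists_gradingElement_sub_mem lam
      obtain ⟨c, p, hp, h⟩ := exists_polynomial_mul_mem hc₀ (y * x)
      have hp' := aeval_sub_eval_mem hc₀ p
      have hΦp : Φ (aeval (gradingElement n) p) v = p.eval c₀ • v := by
        have := hJ _ hp'
        rwa [map_sub, LinearMap.sub_apply, AlgHom.commutes, Module.algebraMap_end_apply,
          sub_eq_zero] at this
      have hc : c = 1 := by
        have h1 := hJ _ h
        rw [map_mul, Module.End.mul_apply, map_sub, LinearMap.sub_apply, hzv, AlgHom.commutes,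
          Module.algebraMap_end_apply, map_sub, map_smul, hΦp, ← one_smul ℂ (p.eval c₀ • v),
          smul_smul c, mul_one, ← sub_smul, smul_smul] at h1
        rcases smul_eq_zero.1 h1 with h2 | h2
        · rcases mul_eq_zero.1 h2 with h3 | h3
          · exact (sub_eq_zero.1 h3).symm
          · exact absurd h3 hp
        · exact absurd h2 hv
      rw [hc, map_one, mul_sub, mul_one] at h
      have h1 : aeval (gradingElement n) p ∈ I := by
        have := sub_mem (I.smul_mem (aeval (gradingElement n) p) hz) (hJI h)
        rwa [smul_eq_mul, sub_sub_cancel] at this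
      have h2 : algebraMap ℂ (U n) (p.eval c₀) ∈ I := by
        have := sub_mem h1 (hJI hp')
        rwa [sub_sub_cancel] at this
      have h3 : (1 : U n) ∈ I := by
        have := I.smul_mem (algebraMap ℂ (U n) (p.eval c₀)⁻¹) h2
        rwa [smul_eq_mul, ← map_mul, inv_mul_cancel₀ hp, map_one] at this
      refine hI (eq_top_iff.2 fun u _ => ?_)
      have := I.smul_mem u h3
      rwa [smul_eq_mul, mul_one] at this
    exact fun hx => hle hx
  · intro hx
    have hA : A ≤ maxIdeal lam := by
      refine le_sSup ⟨hJ, fun h => hv ?_⟩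
      have : (1 : U n) ∈ A := h ▸ Submodule.mem_top
      simpa [A] using this
    exact hA hx

/-- An irreducible highest weight module is `L(lam)`. -/
theorem exists_irrHW_equiv {V : Type*} [AddCommGroup V] [Module ℂ V]
    (Φ : U n →ₐ[ℂ] Module.End ℂ V) {v : V} (hv : v ≠ 0)
    (hJ : ∀ x ∈ vermaIdeal lam, Φ x v = 0) (hirr : ∀ w : V, w ≠ 0 → ∃ y, Φ y w = v)
    (hgen : ∀ w : V, ∃ y, Φ y v = w) :
    ∃ φ : IrrHW lam ≃ₗ[ℂ] V, ∀ (x : U n) (m : IrrHW lam), φ (x • m) = Φ x (φ m) := by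
  let f : U n →ₗ[ℂ] V := (LinearMap.applyₗ v).comp Φ.toLinearMap
  have hf : Function.Surjective f := hgen
  have hker : (maxIdeal lam).restrictScalars ℂ = LinearMap.ker f := by
    ext x
    exact mem_maxIdeal_iff Φ hv hJ hirr x
  let φ : IrrHW lam ≃ₗ[ℂ] V := (Submodule.Quotient.restrictScalarsEquiv ℂ (maxIdeal lam)).symm ≪≫ₗ
    Submodule.quotEquivOfEq _ _ hker ≪≫ₗ f.quotKerEquivOfSurjective hf
  have hφ : ∀ y : U n, φ (Submodule.Quotient.mk y) = Φ y v := fun y => rfl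
  refine ⟨φ, fun x m => ?_⟩
  obtain ⟨y, rfl⟩ := Submodule.Quotient.mk_surjective _ m
  rw [← Submodule.Quotient.mk_smul, hφ, hφ, smul_eq_mul, map_mul, Module.End.mul_apply]

/-! ## The tableau module is irreducible -/

theorem weightCoeff_hwTableau {k : ℕ} (hk : 1 ≤ k) (hkn : k ≤ n) :
    weightCoeff (hwTableau lam) k = lam ⟨k - 1, by omega⟩ := by
  obtain ⟨m, rfl⟩ : ∃ m, k = m + 1 := ⟨k - 1, by omega⟩
  have h : ∀ j, j ≤ n → ∑ i ∈ Finset.Icc 1 j, entry (hwTableau lam) j i =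
      ∑ i ∈ Finset.Icc 1 j, shifted lam i := fun j hj => Finset.sum_congr rfl fun i hi => by
    rw [Finset.mem_Icc] at hi
    exact entry_hwTableau hi.1 hi.2 hj
  have h' : weightCoeff (hwTableau lam) (m + 1) = ((m + 1 : ℕ) : ℂ) - 1 +
      ∑ i ∈ Finset.Icc 1 (m + 1), shifted lam i - ∑ i ∈ Finset.Icc 1 m, shifted lam i := by
    rw [← h _ hkn, ← h m (by omega)]
    rfl
  rw [h', Finset.sum_Icc_succ_top (by omega), shifted, dif_pos ⟨hk, hkn⟩]
  push_cast
  ring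

/-- A nonzero vector that is not singular has a nonzero image under some raising operator, and this
image is supported in smaller height. The process ends at a singular vector, a nonzero multiple of
the top tableau. -/
theorem exists_map_eq_top {ρ : gl n →ₗ⁅ℂ⁆ Module.End ℂ (TableauSpace (hwRelations lam) (hwTableau lam))}
    (hlam : Standard lam)
    (hX : ∀ k, 1 ≤ k → k < n → ρ (E n k (k + 1)) = raiseOp (hwRelations lam) (hwTableau lam) k)
    {w : TableauSpace (hwRelations lam) (hwTableau lam)} (hw : w ≠ 0) :
    ∃ y : U n, UniversalEnvelopingAlgebra.lift ℂ ρ y w =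
      tab (hwRelations lam) (hwTableau lam) (topTableau (hwTableau lam)) := by
  classical
  have hL := isRealization_hwTableau hlam
  have key : ∀ N, ∀ w : TableauSpace (hwRelations lam) (hwTableau lam), w ≠ 0 →
      (∀ S, w S ≠ 0 → height (hwTableau lam) S.1 < N) →
      ∃ y : U n, UniversalEnvelopingAlgebra.lift ℂ ρ y w =
        tab (hwRelations lam) (hwTableau lam) (topTableau (hwTableau lam)) := by
    intro N
    induction N with
    | zero =>
      intro w hw h
      refine absurd (Finsupp.ext fun S => ?_) hw
      by_contra h0
      exact absurd (h S h0) (Nat.not_lt_zero _)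
    | succ N ih =>
      intro w hw h
      by_cases hs : ∀ k, 1 ≤ k → k < n → raiseOp (hwRelations lam) (hwTableau lam) k w = 0
      · have h1 := unmerged_hwTableau.eq_smul_of_raiseOp_eq_zero hlam hL hs
        set c := w ⟨topTableau (hwTableau lam), topTableau_mem hL.1⟩
        have hc : c ≠ 0 := by
          intro h0
          rw [h0, zero_smul] at h1
          exact hw h1
        refine ⟨algebraMap ℂ (U n) c⁻¹, ?_⟩
        rw [AlgHom.commutes, Module.algebraMap_end_apply, h1, smul_smul, inv_mul_cancel₀ hc, one_smul]
      · push Not at hs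
        obtain ⟨k, hk, hkn, hkw⟩ := hs
        obtain ⟨y, hy⟩ := ih _ hkw fun S hS => by
          rw [raiseOp_apply] at hS
          obtain ⟨i, hi, hi0⟩ := Finset.exists_ne_zero_of_sum_ne_zero hS
          rw [Finset.mem_Icc] at hi
          split_ifs at hi0 with hR
          · have h1 := h _ (right_ne_zero_of_mul hi0)
            rw [height_sub_delta S.2 hi.1 hi.2 hkn hR] at h1
            omega
          · exact absurd rfl hi0
        refine ⟨y * e n k (k + 1), ?_⟩
        rw [map_mul, Module.End.mul_apply, e, UniversalEnvelopingAlgebra.lift_ι_apply, hX k hk hkn, hy]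
  refine key (w.support.sup (fun S => height (hwTableau lam) S.1) + 1) w hw fun S hS => ?_
  exact Nat.lt_succ_of_le (Finset.le_sup (f := fun S : tableaux (hwRelations lam) (hwTableau lam) =>
    height (hwTableau lam) S.1) (Finsupp.mem_support_iff.2 hS))

/-- The tableau module is isomorphic to `L(lam)`. -/
theorem exists_tableau_equiv (hlam : Standard lam) :
    ∃ ρ : gl n →ₗ⁅ℂ⁆ Module.End ℂ (TableauSpace (hwRelations lam) (hwTableau lam)),
      IsGTAction (hwRelations lam) (hwTableau lam) ρ ∧
      (∀ k, 1 ≤ k → k ≤ n → ρ (E n k k) = weightOp (hwRelations lam) (hwTableau lam) k) ∧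
      ∃ φ : IrrHW lam ≃ₗ[ℂ] TableauSpace (hwRelations lam) (hwTableau lam),
        ∀ (x : U n) (m : IrrHW lam), φ (x • m) = UniversalEnvelopingAlgebra.lift ℂ ρ x (φ m) := by
  have hL := isRealization_hwTableau hlam
  obtain ⟨ρ, hX, hY, hH⟩ := exists_representation hlam hL
  refine ⟨ρ, isGTAction_of_eq hX hY hH, hH, exists_irrHW_equiv _
    (v := tab (hwRelations lam) (hwTableau lam) (topTableau (hwTableau lam))) ?_ ?_
    (fun w hw => exists_map_eq_top hlam hX hw) ?_⟩
  · rw [tab_of_mem _ _ (topTableau_mem hL.1)]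
    exact Finsupp.single_ne_zero.2 one_ne_zero
  · intro x hx
    induction hx using Submodule.span_induction with
    | mem x hx =>
      rcases hx with ⟨i, j, hi, hij, hj, rfl⟩ | ⟨i, rfl⟩
      -- The annihilator of the top tableau is a Lie subalgebra, so the simple raising elements
      -- bring in all E_{ij} with i < j.
      · let K : LieSubalgebra ℂ (gl n) :=
          { carrier := {g | ρ g (tab (hwRelations lam) (hwTableau lam) (topTableau (hwTableau lam))) = 0}
            add_mem' := fun {a b} ha hb => by
              rw [Set.mem_ofPred_eq] at *
              rw [map_add, LinearMap.add_apply, ha, hb, add_zero]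
            zero_mem' := by simp
            smul_mem' := fun c g hg => by
              rw [Set.mem_ofPred_eq] at *
              rw [map_smul, LinearMap.smul_apply, hg, smul_zero]
            lie_mem' := fun {a b} ha hb => by
              change ρ ⁅a, b⁆ _ = 0
              rw [LieHom.map_lie, end_lie_apply, show ρ a _ = 0 from ha,
                show ρ b _ = 0 from hb, map_zero, map_zero, sub_zero] }
        rw [e, UniversalEnvelopingAlgebra.lift_ι_apply]
        exact E_mem_of_simple K (fun k h1 h2 => by
          change ρ _ _ = 0
          rw [hX k h1 h2, raiseOp_top hL.1 h2]) hi hij hj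
      · rw [map_sub, LinearMap.sub_apply, e, UniversalEnvelopingAlgebra.lift_ι_apply,
          hH _ (by omega) (by omega), weightOp_tab, topTableau_hwTableau,
          weightCoeff_hwTableau (by omega) (by omega), AlgHom.commutes, Module.algebraMap_end_apply]
        simp
    | zero => simp
    | add x y _ _ hx hy => rw [map_add, LinearMap.add_apply, hx, hy, add_zero]
    | smul a x _ hx => rw [smul_eq_mul, map_mul, Module.End.mul_apply, hx, map_zero]
  · let f : U n →ₗ[ℂ] TableauSpace (hwRelations lam) (hwTableau lam) :=
      (LinearMap.applyₗ (tab (hwRelations lam) (hwTableau lam) (topTableau (hwTableau lam)))).comp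
        (UniversalEnvelopingAlgebra.lift ℂ ρ).toLinearMap
    have hf : LinearMap.range f = ⊤ := by
      refine eq_top_of_lowerOp_stable hL _ ⟨1, ?_⟩ ?_
      · simp [f]
      · rintro k h1 h2 _ ⟨x, rfl⟩
        refine ⟨e n (k + 1) k * x, ?_⟩
        change UniversalEnvelopingAlgebra.lift ℂ ρ (e n (k + 1) k * x) _ = _
        rw [map_mul, Module.End.mul_apply, e, UniversalEnvelopingAlgebra.lift_ι_apply, hY k h1 h2]
        rfl
    exact LinearMap.range_eq_top.1 hf

end

end GelfandTsetlin

namespace GelfandTsetlin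

noncomputable section

attribute [local instance 100] LieRing.ofAssociativeRing

/-! ## Decomposition into primary components -/

section PrimaryComponents

variable {R M : Type*} [CommRing R] [AddCommGroup M] [Module R M]
  {G : MaximalSpectrum R → Submodule R M}

theorem exists_coprime_of_mem_iSup (hG : ∀ 𝔪 x, x ∈ G 𝔪 ↔ ∃ k : ℕ, ∀ a ∈ 𝔪.asIdeal ^ k, a • x = 0)
    (𝔪 : MaximalSpectrum R) {x : M} (hx : x ∈ ⨆ 𝔫 ≠ 𝔪, G 𝔫) :
    ∃ J : Ideal R, IsCoprime 𝔪.asIdeal J ∧ ∀ a ∈ J, a • x = 0 := by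
  induction hx using Submodule.iSup_induction' with
  | zero => exact ⟨1, isCoprime_one_right, fun a _ => smul_zero a⟩
  | add x y _ _ hx hy =>
    obtain ⟨J, hJ, h⟩ := hx
    obtain ⟨J', hJ', h'⟩ := hy
    refine ⟨J * J', hJ.mul_right hJ', fun a ha => ?_⟩
    rw [smul_add, h a (Ideal.mul_le_left ha), h' a (Ideal.mul_le_right ha), add_zero]
  | mem 𝔫 x hx =>
    by_cases hne : 𝔫 ≠ 𝔪
    · rw [iSup_pos hne, hG] at hx
      obtain ⟨k, hk⟩ := hx
      exact ⟨𝔫.asIdeal ^ k, (𝔪.isCoprime_of_ne hne.symm).pow_right, hk⟩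
    · rw [iSup_neg hne, Submodule.mem_bot] at hx
      exact ⟨1, isCoprime_one_right, fun a _ => by rw [hx, smul_zero]⟩

/-- A vector in G 𝔪 and in the sum of the others is killed by a power of 𝔪 and by an ideal coprime
to it, hence by 1. -/
theorem iSupIndep_primary (hG : ∀ 𝔪 x, x ∈ G 𝔪 ↔ ∃ k : ℕ, ∀ a ∈ 𝔪.asIdeal ^ k, a • x = 0) :
    iSupIndep G := by
  refine fun 𝔪 => Submodule.disjoint_def.2 fun x hx hx' => ?_
  obtain ⟨k, hk⟩ := (hG _ _).1 hx
  obtain ⟨J, hJ, h⟩ := exists_coprime_of_mem_iSup hG 𝔪 hx'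
  obtain ⟨a, ha, b, hb, hab⟩ := Ideal.isCoprime_iff_exists.1 (hJ.pow_left (m := k))
  rw [← one_smul R x, ← hab, add_smul, hk a ha, h b hb, add_zero]

/-- An Artinian quotient has finitely many maximal ideals and a nilpotent radical, so I contains the
intersection of k-th powers of finitely many maximal ideals. The Chinese remainder theorem splits x
accordingly; R itself need not be Noetherian. -/
theorem mem_iSup_primary (hG : ∀ 𝔪 x, x ∈ G 𝔪 ↔ ∃ k : ℕ, ∀ a ∈ 𝔪.asIdeal ^ k, a • x = 0)
    (I : Ideal R) [IsArtinianRing (R ⧸ I)] {x : M} (hx : ∀ a ∈ I, a • x = 0) : x ∈ ⨆ 𝔪, G 𝔪 := by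
  have : Fintype (MaximalSpectrum (R ⧸ I)) := Fintype.ofFinite _
  have hmk : Function.Surjective (Ideal.Quotient.mk I) := Ideal.Quotient.mk_surjective
  let P : MaximalSpectrum (R ⧸ I) → MaximalSpectrum R := fun 𝔫 =>
    ⟨𝔫.asIdeal.comap (Ideal.Quotient.mk I),
      have := 𝔫.isMaximal
      Ideal.comap_isMaximal_of_surjective _ hmk⟩
  have hP : Function.Injective P := fun 𝔫 𝔫' h => by
    have := congrArg MaximalSpectrum.asIdeal h
    exact MaximalSpectrum.ext (Ideal.comap_injective_of_surjective _ hmk this)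
  obtain ⟨k, hk⟩ := IsArtinianRing.isNilpotent_nilradical (R := R ⧸ I)
  have hc : ∀ 𝔫 𝔫', 𝔫 ≠ 𝔫' → IsCoprime (P 𝔫).asIdeal (P 𝔫').asIdeal :=
    fun 𝔫 𝔫' h => (P 𝔫).isCoprime_of_ne (hP.ne h)
  have hI : ⨅ 𝔫 ∈ Finset.univ, (P 𝔫).asIdeal ^ k ≤ I := by
    rw [← Ideal.prod_eq_iInf_of_pairwise_isCoprime fun 𝔫 _ 𝔫' _ h => (hc 𝔫 𝔫' h).pow,
      Finset.prod_pow,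
      Ideal.prod_eq_iInf_of_pairwise_isCoprime fun 𝔫 _ 𝔫' _ h => hc 𝔫 𝔫' h]
    have h1 : ⨅ 𝔫 ∈ Finset.univ, (P 𝔫).asIdeal = (nilradical (R ⧸ I)).comap (Ideal.Quotient.mk I) := by
      rw [IsArtinianRing.nilradical_eq_iInf, Ideal.comap_iInf]
      simp [P]
    rw [h1]
    refine (Ideal.le_comap_pow _ k).trans ?_
    rw [hk, Ideal.zero_eq_bot, ← RingHom.ker_eq_comap_bot, Ideal.mk_ker]
  have hx' : x ∈ Submodule.torsionBySet R M (⨅ 𝔫 ∈ Finset.univ, (P 𝔫).asIdeal ^ k : Ideal R) :=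
    (Submodule.mem_torsionBySet_iff _ _).2 fun a => hx _ (hI a.2)
  rw [← Submodule.iSup_torsionBySet_ideal_eq_torsionBySet_iInf fun 𝔫 _ 𝔫' _ h =>
    Ideal.isCoprime_iff_sup_eq.1 (hc 𝔫 𝔫' h).pow] at hx'
  refine (iSup₂_le fun 𝔫 _ => ?_ : _ ≤ ⨆ 𝔪, G 𝔪) hx'
  refine le_trans (fun y hy => ?_) (le_iSup G (P 𝔫))
  exact (hG _ _).2 ⟨k, fun a ha => (Submodule.mem_torsionBySet_iff _ _).1 hy ⟨a, ha⟩⟩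

/-- The quotient by the kernel of the action on N embeds in the finite-dimensional algebra End N. -/
theorem exists_ideal_of_stable {A V : Type*} [CommRing A] [Algebra ℂ A] [AddCommGroup V]
    [Module ℂ V] (Φ : A →ₐ[ℂ] Module.End ℂ V) (N : Submodule ℂ V) [Module.Finite ℂ N]
    (hN : ∀ a, ∀ v ∈ N, Φ a v ∈ N) :
    ∃ I : Ideal A, IsArtinianRing (A ⧸ I) ∧ ∀ a ∈ I, ∀ v ∈ N, Φ a v = 0 := by
  let f : A →ₐ[ℂ] Module.End ℂ N :=
    { toFun := fun a => (Φ a).restrict (hN a)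
      map_one' := by ext v; simp
      map_mul' := fun a b => by ext v; simp
      map_zero' := by ext v; simp
      map_add' := fun a b => by ext v; simp
      commutes' := fun c => by ext v; simp }
  refine ⟨RingHom.ker f, ?_, fun a ha v hv => ?_⟩
  · have : Module.Finite ℂ (A ⧸ RingHom.ker f) :=
      Module.Finite.of_injective (Ideal.kerLiftAlg f).toLinearMap (Ideal.kerLiftAlg_injective f)
    exact IsArtinianRing.of_finite ℂ _
  · have := LinearMap.congr_fun (RingHom.mem_ker.1 ha) ⟨v, hv⟩
    exact congrArg Subtype.val this

end PrimaryComponents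

variable {n : ℕ}

/-! ## The Gelfand–Tsetlin subalgebra preserves the height -/

/-- If k ≤ m then E_{kk} lies in U_m and commutes with its center; if k > m it commutes with all of
U_m. -/
theorem commute_cartan_of_mem {k : ℕ} (hk : 1 ≤ k) (hkn : k ≤ n) {x : U n} (hx : x ∈ Γ n) :
    x * e n k k = e n k k * x := by
  have hle : Γ n ≤ Subalgebra.centralizer ℂ {e n k k} := by
    refine Algebra.adjoin_le ?_
    rintro x ⟨m, hm, hmn, hx⟩
    refine Subalgebra.mem_centralizer_iff ℂ |>.2 fun y hy => ?_
    rw [Set.mem_singleton_iff] at hy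
    subst hy
    rcases le_or_gt k m with h | h
    · exact (hx.2 _ (Algebra.subset_adjoin ⟨k, k, hk, h, hk, h, rfl⟩)).symm
    · have hU : Usub n m ≤ Subalgebra.centralizer ℂ {e n k k} := by
        refine Algebra.adjoin_le ?_
        rintro x ⟨i, j, hi, him, hj, hjm, rfl⟩
        refine Subalgebra.mem_centralizer_iff ℂ |>.2 fun y hy => ?_
        rw [Set.mem_singleton_iff] at hy
        subst hy
        rw [e_mul_e k k i j hk hkn hj (by omega), if_neg (by omega), if_neg (by omega), sub_zero,
          add_zero]
      exact Subalgebra.mem_centralizer_iff ℂ |>.1 (hU hx.1) _ rfl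
  exact (Subalgebra.mem_centralizer_iff ℂ |>.1 (hle hx) _ rfl).symm

theorem commute_gradingElement_of_mem {x : U n} (hx : x ∈ Γ n) :
    x * gradingElement n = gradingElement n * x := by
  rw [gradingElement, Finset.mul_sum, Finset.sum_mul]
  refine Finset.sum_congr rfl fun k hk => ?_
  rw [Finset.mem_Icc] at hk
  rw [mul_smul_comm, smul_mul_assoc, commute_cartan_of_mem hk.1 hk.2 hx]

/-- Abel summation. The weight of E_{kk} is a constant plus the difference of consecutive row sums,
so the sum of the k E_{kk} only sees the top row and minus the total of the lower rows. -/
theorem sum_mul_sub (s : ℕ → ℂ) (m : ℕ) :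
    ∑ k ∈ Finset.Icc 1 (m + 1), (k : ℂ) * (s k - s (k - 1)) =
      (m + 1) * s (m + 1) - s 0 - ∑ k ∈ Finset.Icc 1 m, s k := by
  induction m with
  | zero => simp
  | succ m ih =>
    rw [Finset.sum_Icc_succ_top (by omega), ih, Finset.sum_Icc_succ_top (by omega : 1 ≤ m + 1)]
    simp only [Nat.add_sub_cancel]
    push_cast
    ring

variable {lam : Fin n → ℂ} {L : Tableau n}

/-- The eigenvalue of the grading element on a tableau is determined by its height. -/
theorem exists_sum_weightCoeff (hn : 1 ≤ n) (C : Set (Rel n)) (L : Tableau n) :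
    ∃ c : ℂ, ∀ R ∈ tableaux C L,
      ∑ k ∈ Finset.Icc 1 n, -(k : ℂ) * weightCoeff R k = c - heightSum L R := by
  obtain ⟨m, rfl⟩ : ∃ m, n = m + 1 := ⟨n - 1, by omega⟩
  -- The constant collects the contributions of the top row, which all these tableaux share with L.
  refine ⟨-∑ k ∈ Finset.Icc 1 (m + 1), (k : ℂ) * (k - 1) -
    (m + 1) * ∑ i ∈ Finset.Icc 1 (m + 1), entry L (m + 1) i +
    ∑ k ∈ Finset.Icc 1 m, ∑ i ∈ Finset.Icc 1 k, entry L (m + 1) i, fun R hR => ?_⟩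
  have h1 : ∀ k : ℕ, -(k : ℂ) * weightCoeff R k = -((k : ℂ) * (k - 1)) -
      k * ((fun j => ∑ i ∈ Finset.Icc 1 j, entry R j i) k -
        (fun j => ∑ i ∈ Finset.Icc 1 j, entry R j i) (k - 1)) := fun k => by
    rw [weightCoeff]
    ring
  have h2 : ∑ i ∈ Finset.Icc 1 (m + 1), entry R (m + 1) i =
      ∑ i ∈ Finset.Icc 1 (m + 1), entry L (m + 1) i := Finset.sum_congr rfl fun i hi => by
    rw [Finset.mem_Icc] at hi
    exact entry_top_row hR hi.1 hi.2
  rw [Finset.sum_congr rfl fun k _ => h1 k, Finset.sum_sub_distrib, sum_mul_sub,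
    Finset.sum_neg_distrib, heightSum]
  simp only [Finset.sum_sub_distrib, Nat.add_sub_cancel, h2]
  simp
  ring

instance : Finite (Pos n) := by
  refine Finite.of_injective (β := Fin (n + 1) × Fin (n + 1))
    (fun p => (⟨p.row, Nat.lt_succ_of_le p.2.2.2⟩,
      ⟨p.col, Nat.lt_succ_of_le (p.2.2.1.trans p.2.2.2)⟩)) fun p q h => ?_
  simp only [Prod.mk.injEq, Fin.mk.injEq] at h
  exact Subtype.ext (Prod.ext h.1 h.2)

/-- There are finitely many tableaux of bounded height. -/
theorem finite_height_le (lam : Fin n → ℂ) (L : Tableau n) (D : ℕ) :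
    {S : tableaux (hwRelations lam) L | height L S.1 ≤ D}.Finite := by
  -- Each entry is the top entry of its column minus a natural number, which is one summand of the
  -- height and so at most D.
  have hfin : (Set.univ.pi fun p : Pos n =>
      (fun m : ℕ => entry L n p.col - m) '' Set.Iic D).Finite :=
    Set.Finite.pi fun p => (Set.finite_Iic D).image _
  refine Set.Finite.of_finite_image (f := Subtype.val) (hfin.subset ?_) Subtype.val_injective.injOn
  rintro _ ⟨⟨R, hR⟩, hD, rfl⟩ p -
  change height L R ≤ D at hD
  obtain ⟨m, hm⟩ := (le_top_of_mem hR p.2.1 p.2.2.1 p.2.2.2).exists_nat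
  refine ⟨m, ?_, ?_⟩
  · rcases p.2.2.2.eq_or_lt with hp | hp
    · have h0 : (m : ℂ) = 0 := by
        rw [← hm, hp, entry_top_row hR p.2.1 (p.2.2.1.trans p.2.2.2), sub_self]
      have : m = 0 := by exact_mod_cast h0
      simp [this]
    · have hnat : ∀ k i, 1 ≤ i → i ≤ k → k ≤ n → ∃ m : ℕ, entry L n i - entry R k i = m :=
        fun k i h1 h2 h3 => (le_top_of_mem hR h1 h2 h3).exists_nat
      choose! f hf using hnat
      have hsum : (height L R : ℂ) =
          ((∑ k ∈ Finset.Icc 1 (n - 1), ∑ i ∈ Finset.Icc 1 k, f k i : ℕ) : ℂ) := by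
        rw [height_cast hR, heightSum, Nat.cast_sum]
        refine Finset.sum_congr rfl fun k hk => ?_
        rw [Nat.cast_sum]
        refine Finset.sum_congr rfl fun i hi => ?_
        rw [Finset.mem_Icc] at hk hi
        exact hf k i hi.1 hi.2 (by omega)
      have hm' : m = f p.1.1 p.1.2 := by
        have := hf _ _ p.2.1 p.2.2.1 p.2.2.2
        rw [hm] at this
        exact_mod_cast this
      rw [Nat.cast_inj] at hsum
      rw [Set.mem_Iic, hm']
      refine le_trans ?_ (hsum ▸ hD)
      refine le_trans ?_ (Finset.single_le_sum (f := fun k => ∑ i ∈ Finset.Icc 1 k, f k i)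
        (fun _ _ => Nat.zero_le _) (Finset.mem_Icc.2 ⟨p.2.1.trans p.2.2.1, by omega⟩ :
          p.1.1 ∈ Finset.Icc 1 (n - 1)))
      exact Finset.single_le_sum (f := fun i => f p.1.1 i) (fun _ _ => Nat.zero_le _)
        (Finset.mem_Icc.2 ⟨p.2.1, p.2.2.1⟩)
  · change entry L n p.col - (m : ℂ) = R p
    rw [apply_eq_entry R p]
    change entry L n p.1.2 - (m : ℂ) = entry R p.1.1 p.1.2
    rw [← hm]
    ring

/-- The elements of the Gelfand–Tsetlin subalgebra preserve the height. -/
theorem height_eq_of_mem (hn : 1 ≤ n)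
    {ρ : gl n →ₗ⁅ℂ⁆ Module.End ℂ (TableauSpace (hwRelations lam) L)}
    (hH : ∀ k, 1 ≤ k → k ≤ n → ρ (E n k k) = weightOp (hwRelations lam) L k)
    {x : U n} (hx : x ∈ Γ n) (R S : tableaux (hwRelations lam) L)
    (h : UniversalEnvelopingAlgebra.lift ℂ ρ x (tab (hwRelations lam) L R.1) S ≠ 0) :
    height L S.1 = height L R.1 := by
  obtain ⟨c, hc⟩ := exists_sum_weightCoeff hn (hwRelations lam) L
  have h1 : ∀ R ∈ tableaux (hwRelations lam) L,
      UniversalEnvelopingAlgebra.lift ℂ ρ (gradingElement n) (tab (hwRelations lam) L R) =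
        (c - height L R) • tab (hwRelations lam) L R := by
    intro R hR
    rw [gradingElement, map_sum, LinearMap.sum_apply, height_cast hR, ← hc R hR, Finset.sum_smul]
    refine Finset.sum_congr rfl fun k hk => ?_
    rw [Finset.mem_Icc] at hk
    rw [map_smul, LinearMap.smul_apply, e, UniversalEnvelopingAlgebra.lift_ι_apply, hH k hk.1 hk.2,
      weightOp_tab, smul_smul]
  -- The grading element is diagonal in the tableaux. Applying it before and after x and comparing
  -- the coordinate at S forces equal eigenvalues, hence equal heights.
  have h2 : (Finsupp.lapply S).comp (UniversalEnvelopingAlgebra.lift ℂ ρ (gradingElement n)) =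
      (c - height L S.1) • (Finsupp.lapply S : TableauSpace (hwRelations lam) L →ₗ[ℂ] ℂ) := by
    refine tableauSpace_hom_ext fun R hR => ?_
    rw [LinearMap.comp_apply, h1 R hR, map_smul, LinearMap.smul_apply, Finsupp.lapply_apply,
      tab_apply]
    split_ifs with hRS
    · rw [hRS]
    · rw [smul_zero, smul_zero]
  have h3 := congrArg (fun y => UniversalEnvelopingAlgebra.lift ℂ ρ y (tab _ L R.1) S)
    (commute_gradingElement_of_mem hx)
  have h4 := LinearMap.congr_fun h2 (UniversalEnvelopingAlgebra.lift ℂ ρ x (tab _ L R.1))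
  simp only [map_mul, Module.End.mul_apply, h1 R.1 R.2, map_smul] at h3
  rw [LinearMap.comp_apply, LinearMap.smul_apply, Finsupp.lapply_apply, Finsupp.lapply_apply, ← h3,
    Finsupp.smul_apply, smul_eq_mul, smul_eq_mul] at h4
  have h5 := mul_right_cancel₀ h h4
  rw [sub_right_inj, Nat.cast_inj] at h5
  exact h5.symm

/-- A representation whose Cartan subalgebra acts on tableaux by the Gelfand–Tsetlin formulas is
locally finite over the Gelfand–Tsetlin subalgebra. -/
theorem exists_ideal_annihilating (hn : 1 ≤ n)
    {ρ : gl n →ₗ⁅ℂ⁆ Module.End ℂ (TableauSpace (hwRelations lam) L)}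
    (hH : ∀ k, 1 ≤ k → k ≤ n → ρ (E n k k) = weightOp (hwRelations lam) L k)
    (w : TableauSpace (hwRelations lam) L) :
    ∃ I : Ideal (Γ n), IsArtinianRing (Γ n ⧸ I) ∧
      ∀ a ∈ I, UniversalEnvelopingAlgebra.lift ℂ ρ (a : U n) w = 0 := by
  classical
  set D := w.support.sup fun S => height L S.1
  -- The tableaux of height at most D span a finite-dimensional subspace that contains w and is
  -- stable under Γ.
  set N : Submodule ℂ (TableauSpace (hwRelations lam) L) :=
    Finsupp.supported ℂ ℂ {S | height L S.1 ≤ D}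
  have hN : ∀ v, v ∈ N ↔ ∀ S, v S ≠ 0 → height L S.1 ≤ D := fun v => by
    rw [Finsupp.mem_supported]
    exact ⟨fun h S hS => h (Finsupp.mem_support_iff.2 hS),
      fun h S hS => h S (Finsupp.mem_support_iff.1 hS)⟩
  have hw : w ∈ N := (hN w).2 fun S hS =>
    Finset.le_sup (f := fun S : tableaux (hwRelations lam) L => height L S.1)
      (Finsupp.mem_support_iff.2 hS)
  have : Finite {S : tableaux (hwRelations lam) L | height L S.1 ≤ D} :=
    (finite_height_le lam L D).to_subtype
  have : Module.Finite ℂ N := Module.Finite.equiv (Finsupp.supportedEquivFinsupp _).symm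
  have hmaps : ∀ (a : Γ n), ∀ v ∈ N, UniversalEnvelopingAlgebra.lift ℂ ρ (a : U n) v ∈ N := by
    intro a v hv
    rw [tableauSpace_eq_sum v, Finsupp.sum, map_sum]
    refine sum_mem fun R hR => ?_
    rw [map_smul]
    refine N.smul_mem _ ((hN _).2 fun S hS => ?_)
    rw [height_eq_of_mem hn hH a.2 R S hS]
    exact (hN v).1 hv R (Finsupp.mem_support_iff.1 hR)
  obtain ⟨I, hI, h⟩ := exists_ideal_of_stable ((UniversalEnvelopingAlgebra.lift ℂ ρ).comp (Γ n).val)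
    N hmaps
  exact ⟨I, hI, fun a ha => h a ha w hw⟩

/-- `L(lam)` is a Gelfand–Tsetlin module. -/
theorem isGTModule_irrHW (hn : 1 ≤ n) (hlam : Standard lam) : IsGTModule n (IrrHW lam) := by
  classical
  obtain ⟨ρ, -, hH, φ, hφ⟩ := exists_tableau_equiv hlam
  have hG : ∀ (𝔪 : MaximalSpectrum (Γ n)) (x : IrrHW lam),
      x ∈ gtComponent (IrrHW lam) 𝔪.asIdeal ↔ ∃ k : ℕ, ∀ a ∈ 𝔪.asIdeal ^ k, a • x = 0 :=
    fun _ _ => Iff.rfl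
  refine ⟨inferInstance, DirectSum.isInternal_submodule_of_iSupIndep_of_iSup_eq_top
    (iSupIndep_primary hG) (eq_top_iff.2 fun x _ => ?_)⟩
  obtain ⟨I, hI, h⟩ := exists_ideal_annihilating hn hH (φ x)
  refine mem_iSup_primary hG I fun a ha => φ.injective ?_
  rw [map_zero, ← h a ha, ← hφ]
  rfl

end

end GelfandTsetlin
theorem mainTheorem11 (n : ℕ) (hn : 2 ≤ n) (lam : Fin n → ℂ)
    (hlam : ∀ i j : Fin n, i < j → j.val + 1 ≤ n - 1 →
      (¬∃ m : ℤ, lam i - lam j = m) ∨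
        ∃ m : ℤ, lam i - lam j = m ∧ (i.val : ℤ) - (j.val : ℤ) < m) :
    GelfandTsetlin.IsGTModule n (GelfandTsetlin.IrrHW lam) ∧
    GelfandTsetlin.IsAdmissible (GelfandTsetlin.hwRelations lam) ∧
    GelfandTsetlin.IsRealization (GelfandTsetlin.hwRelations lam)
      (GelfandTsetlin.hwTableau lam) ∧
    GelfandTsetlin.IsoTableauModule (n := n) (GelfandTsetlin.IrrHW lam)
      (GelfandTsetlin.hwRelations lam) (GelfandTsetlin.hwTableau lam) := by
  have hstd : GelfandTsetlin.Standard lam := hlam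
  obtain ⟨ρ, hρ, -, φ, hφ⟩ := GelfandTsetlin.exists_tableau_equiv hstd
  refine ⟨GelfandTsetlin.isGTModule_irrHW (by omega) hstd,
    GelfandTsetlin.isAdmissible_hwRelations hstd, GelfandTsetlin.isRealization_hwTableau hstd,
    ρ, hρ, φ, fun x v => ?_⟩
  rw [hφ, UniversalEnvelopingAlgebra.lift_ι_apply]
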